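/- Let $X,X_1,X_2,\dots$ be i.i.d. real random variables with a density $f$ and $E|X|<\infty$, $\mu=EX<0$; let $S_0=0$, $S_n=X_1+\dots+X_n$, $\tau_b=\inf\{n\ge 1:S_n>b\}$ and $u(b)=P(\tau_b<\infty)$ for $b>0$. Put $\bar F(x)=P(X>x)$, $\Lambda=-\log\bar F$, $\lambda=f/\bar F$, $G(x)=\int_x^\infty \bar F(s)\,ds$, and let $\Lambda^{-1}(y)=\inf\{x:\Lambda(x)\ge y\}$. *Sampling scheme.* Given $k\ge 0$, cut points $c_0(t)<\dots<c_k(t)$, $\delta_0\in(0,1/4)$ and $\kappa>0$, let $\theta=-\mu(1-\delta_0)/(1+\delta_0)^5$ and, with $t=b-s$, $$p_{**}=\min\{2\theta\bar F(t)/G(t),\,\delta_0^2\},\qquad p_j=\tfrac{\delta_0}{k+1}\,p_{**}\ (1\le j\le k),\qquad p_*=1-p_{**}-\sum_{j=1}^k p_j .$$ If $\kappa G(t)^2<1$ (that is, $t>\eta_*:=G^{-1}(\kappa^{-1/2})$), let $$q_s(x)=p_*\frac{f(x)I(x\le c_0)}{P(X\le c_0)}+p_{**}\frac{f(x)I(x>c_k)}{P(X>c_k)}+\sum_{j=1}^{k-1}p_j\frac{f(x)I(x\in(c_{j-1},c_j])}{P(X\in(c_{j-1},c_j])}+p_k\frac{f(t-x)I(x\in(c_{k-1},c_k])}{P(X\in(t-c_k,t-c_{k-1}])}$$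 (for $k=0$ only the first two terms are present), and otherwise let $q_s=f$. Let $Q=Q_b$ be the law of the Markov chain $(S_n)$ with $S_0=0$ whose increment from the state $s$ has density $q_s$, and let $$Z_b=I(\tau_b<\infty)\,L_b,\qquad L_b=\prod_{i=1}^{\tau_b}\frac{f(S_i-S_{i-1})}{q_{S_{i-1}}(S_i-S_{i-1})}.$$ The scheme is *strongly efficient* if for every $b>0$ the $q_s$ are probability densities and $E^QZ_b=u(b)$, and there is $K<\infty$ with $E^QZ_b^2=E[L_b;\tau_b<\infty]\le K\,u(b)^2$ for all $b>0$. **Theorem.** 1. Suppose that $\bar F(x)=L(x)x^{-\iota}$ for $x>0$, where $L$ is slowly varying at infinity and $\iota>3/2$. Take $k=0$ and $c_0(t)=\Lambda^{-1}(\Lambda(t)-a_{**})$. Then for all sufficiently small $a_{**},\delta_0>0$ there is $\kappa_0>0$ such that for every $\kappa\ge\kappa_0$ the scheme is strongly efficient and $$E^Q\tau_b\le\rho_0+\rho_1 b\qquad(b>0)$$ for some $\rho_0,\rho_1>0$ independent of $b$. 2. Suppose that there are $b_0>0$ and $\beta_0\in(0,1)$ such that (B1) $x\lambda(x)\to\infty$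 as $x\to\infty$; (B2) $\lambda(x)/\Lambda(x)\le\beta_0/x$ for $x\ge b_0$; (B3) $\lambda$ is non-increasing on $[b_0,\infty)$. Call $(\sigma_1,k,a_1,\dots,a_{k-1})$ admissible if $\sigma_1>0$, $2-2(1-x)^{\beta_0}-x^{\beta_0}\le 0$ on $[0,\sigma_1]$, $k\ge 2$, $0<a_1<\dots<a_{k-1}<1$, $a_1\le\sigma_1$, $a_{k-1}\ge 1-\sigma_1$, and, for some $\sigma_2>0$ and all $1\le j\le k-2$, $a_{j+1}-a_j\le\sigma_1/2$ and $a_j^{\beta_0}+(1-a_{j+1})^{\beta_0}\ge 1+\sigma_2$. Admissible choices exist. For every admissible choice, all $a_*,a_{**}>0$ and all $\delta_0\in(0,1/4)$, take $$c_0(t)=t-\Lambda^{-1}(\Lambda(t)-a_*),\qquad c_j(t)=a_jt\ (1\le j\le k-1),\qquad c_k(t)=\Lambda^{-1}(\Lambda(t)-a_{**}).$$ Then there is $\kappa_0>0$ such that for every $\kappa\ge\kappa_0$ the scheme is strongly efficient and, for all $\beta\in[0,\beta_0]$ and $\delta>0$ such that $\lambda(x)\ge\delta x^{\beta-1}$ for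 all large $x$, there are $\rho_0,\rho_1>0$ independent of $b$ with $$E^Q\tau_b\le\rho_0+\rho_1 b^{1-\beta}\qquad(b>0).$$ -/

import Mathlib

open MeasureTheory ProbabilityTheory Filter Topology

noncomputable section

namespace RWImportance

/-! ### The increment distribution -/

/-- The distribution on the line with density `f`. -/
def law (f : ℝ → ℝ) : Measure ℝ := volume.withDensity fun x => ENNReal.ofReal (f x)

/-- The mean of the increment distribution. -/
def mean (f : ℝ → ℝ) : ℝ := ∫ x, x ∂(law f)

/-- The right tail `P(X > x)`. -/
def tail (f : ℝ → ℝ) (x : ℝ) : ℝ := (law f).real (Set.Ioi x)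

/-- The cumulative hazard function `Λ`, so that `tail = exp (-Λ)`. -/
def cumHaz (f : ℝ → ℝ) (x : ℝ) : ℝ := -Real.log (tail f x)

/-- The hazard function `λ`, so that `f = λ * exp (-Λ)`. -/
def haz (f : ℝ → ℝ) (x : ℝ) : ℝ := f x / tail f x

/-- The (generalized) inverse `Λ⁻¹` of the cumulative hazard function. -/
def cumHazInv (f : ℝ → ℝ) (y : ℝ) : ℝ := sInf {x | y ≤ cumHaz f x}

/-- The integrated tail `G(x) = ∫_x^∞ P(X > s) ds`. -/
def intTail (f : ℝ → ℝ) (x : ℝ) : ℝ := ∫ s in Set.Ioi x, tail f s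

/-! ### The two sets of assumptions on the right tail -/

/-- Assumption A: the right tail is regularly varying with index `ι`. -/
def RegVaryingTail (f : ℝ → ℝ) (ι : ℝ) : Prop :=
  ∃ L : ℝ → ℝ,
    (∀ t ∈ Set.Ioc (0 : ℝ) 1, Tendsto (fun x => L (x * t) / L x) atTop (𝓝 1)) ∧
    ∀ x > 0, tail f x = L x * x ^ (-ι)

/-- Assumptions B1, B2 and B3, with the constants `b₀` and `β₀`. -/
structure SemiexpTail (f : ℝ → ℝ) (b₀ β₀ : ℝ) : Prop where
  b₀_pos : 0 < b₀
  β₀_pos : 0 < β₀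
  β₀_lt_one : β₀ < 1
  tendsto_mul_haz : Tendsto (fun x => x * haz f x) atTop atTop
  haz_div_cumHaz_le : ∀ x ≥ b₀, haz f x / cumHaz f x ≤ β₀ / x
  haz_antitone : AntitoneOn (haz f) (Set.Ici b₀)

/-! ### Path space, first passage time, likelihood ratio -/

/-- One step of the chain `S` whose increment from the state `s` has the density `q s`. -/
def stepKernel (q : ℝ → ℝ → ℝ) : Kernel ℝ ℝ :=
  Kernel.withDensity (Kernel.const ℝ volume) fun s y => ENNReal.ofReal (q s (y - s))

open Classical in
/-- The law on path space of the chain `S` with `S 0 = 0` whose increment from the state `s` has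
the density `q s`. It is a probability measure as soon as `q` is jointly measurable and each `q s`
is a probability density, and the zero measure if the `q s` do not define a Markov kernel. -/
def pathLaw (q : ℝ → ℝ → ℝ) : Measure (ℕ → ℝ) :=
  if h : IsMarkovKernel (stepKernel q) then
    haveI := h
    Kernel.traj (X := fun _ : ℕ => ℝ)
      (fun n => (stepKernel q).comap
        (fun S : (i : Finset.Iic n) → ℝ => S ⟨n, Finset.mem_Iic.2 le_rfl⟩)
        (measurable_pi_apply _)) 0 (fun _ => 0)
  else 0

/-- The path `n ↦ X 0 + ... + X (n - 1)` of the random walk with increments `X`. -/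
def walk {Ω : Type*} (X : ℕ → Ω → ℝ) (ω : Ω) (n : ℕ) : ℝ := ∑ i ∈ Finset.range n, X i ω

/-- The first passage time `τ_b = inf {n ≥ 1 : S n > b}`, with values in `ℕ ∪ {∞}`. -/
def passage (b : ℝ) (S : ℕ → ℝ) : ℕ∞ := ⨅ (n : ℕ) (_ : 1 ≤ n ∧ b < S n), (n : ℕ∞)

open Classical in
/-- The importance sampling estimator
`Z_b = I(τ_b < ∞) ∏_{i = 1}^{τ_b} f (S i - S (i - 1)) / q_{S (i - 1)} (S i - S (i - 1))`. -/
def estimator (f : ℝ → ℝ) (q : ℝ → ℝ → ℝ) (b : ℝ) (S : ℕ → ℝ) : ℝ :=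
  if passage b S < ⊤ then
    ∏ i ∈ Finset.range (passage b S).toNat, f (S (i + 1) - S i) / q (S i) (S (i + 1) - S i)
  else 0

/-- The first passage probability `u(b) = P(τ_b < ∞)`. -/
def ruinProb {Ω : Type*} [MeasurableSpace Ω] (P : Measure Ω) (X : ℕ → Ω → ℝ) (b : ℝ) : ℝ :=
  P.real {ω | passage b (walk X ω) < ⊤}

/-- The expected termination time `E^Q τ_b`, where `Q` is the path law given by `q b`. -/
def expTermination (q : ℝ → ℝ → ℝ → ℝ) (b : ℝ) : ENNReal :=
  ∫⁻ S, (passage b S : ENNReal) ∂(pathLaw (q b))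

/-- Strong efficiency of the estimators `Z_b`, `b > 0`, under the path laws `Q = Q_b` given by the
increment densities `q b`: they are unbiased for `u(b)`, and their second moments
`E^Q Z_b ^ 2 = E[L_b; τ_b < ∞]` are at most `K * u(b) ^ 2` with `K` independent of `b`. -/
def StronglyEfficient {Ω : Type*} [MeasurableSpace Ω] (P : Measure Ω) (X : ℕ → Ω → ℝ)
    (f : ℝ → ℝ) (q : ℝ → ℝ → ℝ → ℝ) : Prop :=
  (∀ b > 0, IsProbabilityMeasure (pathLaw (q b)) ∧
    ∫⁻ S, ENNReal.ofReal (estimator f (q b) b S) ∂(pathLaw (q b)) =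
      ENNReal.ofReal (ruinProb P X b)) ∧
  ∃ K > 0, ∀ b > 0,
    ∫⁻ S, ENNReal.ofReal (estimator f (q b) b S ^ 2) ∂(pathLaw (q b)) =
      ∫⁻ ω, ENNReal.ofReal (estimator f (q b) b (walk X ω)) ∂P ∧
    ∫⁻ S, ENNReal.ofReal (estimator f (q b) b S ^ 2) ∂(pathLaw (q b)) ≤
      ENNReal.ofReal (K * ruinProb P X b ^ 2)

/-! ### The mixture family -/

/-- The mixture density, at distance `t = b - s` from the level, with cut points
`c 0 < ... < c k` and weights `pReg` (regular jump), `pBig` (large jump), and `p 1, ..., p k`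
(interpolating components). For `k = 0` only the regular and the large jump remain, and they are
separated by `c 0`. -/
def mixture (f : ℝ → ℝ) (k : ℕ) (c : ℕ → ℝ) (pReg pBig : ℝ) (p : ℕ → ℝ) (t x : ℝ) : ℝ :=
  pReg * ((Set.Iic (c 0)).indicator f x / (law f).real (Set.Iic (c 0))) +
  pBig * ((Set.Ioi (c k)).indicator f x / (law f).real (Set.Ioi (c k))) +
  ∑ j ∈ Finset.Ico 1 k, p j *
    ((Set.Ioc (c (j - 1)) (c j)).indicator f x / (law f).real (Set.Ioc (c (j - 1)) (c j))) +
  if k = 0 then 0 else p k *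
    ((Set.Ioc (c (k - 1)) (c k)).indicator (fun y => f (t - y)) x /
      (law f).real (Set.Ioc (t - c k) (t - c (k - 1))))

/-- The constant `θ = -μ (1 - δ) / (1 + δ) ^ 5`. -/
def thetaConst (f : ℝ → ℝ) (δ : ℝ) : ℝ := -mean f * (1 - δ) / (1 + δ) ^ 5

/-- The weight of the large jump, `min {2 θ F̄(t) / G(t), δ ^ 2}`. -/
def bigWeight (f : ℝ → ℝ) (δ t : ℝ) : ℝ :=
  min (2 * thetaConst f δ * tail f t / intTail f t) (δ ^ 2)

/-- The importance sampling increment density at the state `s`, for the level `b`: the mixture with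
the cut points `c t 0 < ... < c t k`, `t = b - s`, and with the weights `bigWeight`,
`p_j = δ / (k + 1) * bigWeight` and `p_* = 1 - bigWeight - ∑ p_j`, as long as `κ G(t) ^ 2 < 1`
(that is, `t > η_* = G⁻¹(κ ^ (-1/2))`), and the original density otherwise. -/
def sampler (f : ℝ → ℝ) (k : ℕ) (c : ℝ → ℕ → ℝ) (δ κ b s x : ℝ) : ℝ :=
  if κ * intTail f (b - s) ^ 2 < 1 then
    mixture f k (c (b - s))
      (1 - bigWeight f δ (b - s) - k * (δ / (k + 1) * bigWeight f δ (b - s)))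
      (bigWeight f δ (b - s)) (fun _ => δ / (k + 1) * bigWeight f δ (b - s)) (b - s) x
  else f x

/-- The single cut point `Λ⁻¹(Λ(t) - a_**)` of the two-component mixture (`k = 0`). -/
def regCuts (f : ℝ → ℝ) (aBig t : ℝ) (_ : ℕ) : ℝ := cumHazInv f (cumHaz f t - aBig)

/-- The cut points `c_0 = t - Λ⁻¹(Λ(t) - a_*)`, `c_j = a_j t` for `0 < j < k`, and
`c_k = Λ⁻¹(Λ(t) - a_**)`. -/
def semiexpCuts (f : ℝ → ℝ) (k : ℕ) (a : ℕ → ℝ) (aReg aBig t : ℝ) (j : ℕ) : ℝ :=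
  if j = 0 then t - cumHazInv f (cumHaz f t - aReg)
  else if j < k then a j * t
  else cumHazInv f (cumHaz f t - aBig)

/-- The requirements on the numbers `a_1 < ... < a_{k-1}` that give the intermediate cut points. -/
structure IsGrid (β₀ σ₁ : ℝ) (k : ℕ) (a : ℕ → ℝ) : Prop where
  σ₁_pos : 0 < σ₁
  σ₁_small : ∀ x ∈ Set.Icc 0 σ₁, 2 - 2 * (1 - x) ^ β₀ - x ^ β₀ ≤ 0
  two_le : 2 ≤ k
  first_pos : 0 < a 1
  first_le : a 1 ≤ σ₁
  step_pos : ∀ j, 1 ≤ j → j + 1 < k → a j < a (j + 1)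
  step_le : ∀ j, 1 ≤ j → j + 1 < k → a (j + 1) - a j ≤ σ₁ / 2
  last_ge : 1 - σ₁ ≤ a (k - 1)
  last_lt : a (k - 1) < 1
  gap : ∃ σ₂ > 0, ∀ j, 1 ≤ j → j + 1 < k → 1 + σ₂ ≤ a j ^ β₀ + (1 - a (j + 1)) ^ β₀

end RWImportance

end

noncomputable section

namespace RWImportance

open scoped ENNReal

section

/-! Write F for `tail f`, G for `intTail f`, t for the distance to the level and r = F(t)/G(t). A
supersolution of a one-step inequality bounds an expectation up to first passage from above, a
subsolution bounds it from below. The theorem thus reduces to three functions of t.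

Lower bound, u(b) ≥ ε G(b). G is convex with slope -F, so for small ε one step of the original walk
satisfies F(t) + ε E[G(t - X); X ≤ t] ≥ ε G(t). The mean is negative, hence the walk goes to -∞ and
the subsolution vanishes along the paths (`exists_mul_intTail_le_ruinProb`).

Second moment, E[L_b; τ_b < ∞] ≤ κ G(b)². The Lyapunov function is min(κG², 1). Where κG² ≥ 1 the
original density is kept and there is nothing to prove. Elsewhere the regular jumps multiply κG² by
about 1 - 2rΔ with Δ = -μ - θ(1 + δ) > 0; the large jumps cost F(c_k)²/p_**, a multiple of FG that
is absorbed by a large κ; the intermediate jumps must cost o(FG) (`lyapunov_arith`,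
`lintegral_ratio_mul_le`). With k = 0 there are no intermediate jumps. For semiexponential tails λ/Λ
≤ β/x integrates to Λ(s) ≥ (s/t)^β Λ(t). This gives F(x)F(t - x)² ≤ F(t)² for x close to 0 relative
to t, the same with x and t - x exchanged, and a power of F(t) to spare in between; polynomial
factors are harmless because the tail beats every power (`eventually_interp_le`).

Termination. The Lyapunov function is ρ₀ + ρ₁ t^γ with γ = 1 or γ = 1 - β. A regular jump raises it
by about ρ₁ γ t^(γ-1)(-μ) on average, while with probability at least p_** e^(-a) the step passes
the level and removes all of it (`exists_termination`). For regular variation tF/G eventually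
exceeds some A > 1/2, because ι > 3/2, and 2θA e^(-a) > -μ for small a and δ. For semiexponential
tails t^γ r stays above a positive constant and t r → ∞ (`eventually_drift`). -/

lemma measurable_comp_pair {α : Type*} [MeasurableSpace α] {φ : ℝ → ℝ → ℝ≥0∞}
    (hφ : Measurable (Function.uncurry φ)) {a b : α → ℝ} (ha : Measurable a) (hb : Measurable b) :
    Measurable fun x => φ (a x) (b x) :=
  hφ.comp (ha.prodMk hb)

/-! ### Markov chains started at `0` -/

/-- The process `S` is a Markov chain with `S 0 = 0` and transition kernel `κ` under `μ`. -/
structure IsChain {Ω : Type*} [MeasurableSpace Ω] (μ : Measure Ω) (S : Ω → ℕ → ℝ)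
    (κ : Kernel ℝ ℝ) : Prop where
  measurable : ∀ n, Measurable fun ω => S ω n
  zero : ∀ᵐ ω ∂μ, S ω 0 = 0
  isProb : IsProbabilityMeasure μ
  step : ∀ (n : ℕ) (H : ((i : Finset.Iic n) → ℝ) → ℝ≥0∞) (φ : ℝ → ℝ → ℝ≥0∞), Measurable H →
    Measurable (Function.uncurry φ) →
    ∫⁻ ω, H (fun i => S ω i) * φ (S ω n) (S ω (n + 1)) ∂μ =
      ∫⁻ ω, H (fun i => S ω i) * ∫⁻ y, φ (S ω n) y ∂(κ (S ω n)) ∂μ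

lemma isChain_pathLaw (q : ℝ → ℝ → ℝ) [h : IsMarkovKernel (stepKernel q)] :
    IsChain (pathLaw q) (fun S => S) (stepKernel q) := by
  rw [pathLaw, dif_pos h]
  set K : (n : ℕ) → Kernel ((i : Finset.Iic n) → ℝ) ℝ := fun n => (stepKernel q).comap
        (fun S : (i : Finset.Iic n) → ℝ => S ⟨n, Finset.mem_Iic.2 le_rfl⟩)
        (measurable_pi_apply _) with hK
  refine ⟨fun n => measurable_pi_apply n, ?_, inferInstance, ?_⟩
  · have h0 := Kernel.traj_map_frestrictLe_apply (X := fun _ : ℕ => ℝ) (κ := K) 0 0 (fun _ => 0)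
    rw [Kernel.partialTraj_self, Kernel.id_apply] at h0
    have : ∀ᵐ x ∂(Measure.map (Preorder.frestrictLe 0) (Kernel.traj (X := fun _ : ℕ => ℝ) K 0 (fun _ => 0))), x = fun _ => 0 := by
      rw [h0, ae_dirac_eq]
      simp
    have := ae_of_ae_map (Preorder.measurable_frestrictLe 0).aemeasurable this
    filter_upwards [this] with x hx
    exact congrFun hx ⟨0, Finset.mem_Iic.2 le_rfl⟩
  · intro n H φ hH hφ
    have hψ : Measurable fun s => ∫⁻ y, φ s y ∂(stepKernel q s) :=
      Measurable.lintegral_kernel_prod_right hφ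
    have m1 : Measurable fun S : ℕ → ℝ => H (fun i : Finset.Iic n => S i) :=
      hH.comp (measurable_pi_lambda _ fun i => measurable_pi_apply _)
    have m2 : Measurable fun S : ℕ → ℝ => φ (S n) (S (n + 1)) :=
      measurable_comp_pair hφ (measurable_pi_apply n) (measurable_pi_apply (n + 1))
    have m3 : Measurable fun S : ℕ → ℝ => H (fun i : Finset.Iic n => S i) *
        φ (S n) (S (n + 1)) := m1.mul m2
    have m4 : Measurable fun S : ℕ → ℝ => H (fun i : Finset.Iic n => S i) *
        ∫⁻ y, φ (S n) y ∂(stepKernel q (S n)) := m1.mul (hψ.comp (measurable_pi_apply n))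
    -- Splitting the trajectory at time `n` freezes the coordinates up to `n` at `u`; only the law
    -- of coordinate `n + 1` given `u` is left.
    rw [← Kernel.traj_comp_partialTraj (X := fun _ : ℕ => ℝ) (κ := K) (Nat.zero_le n),
      Kernel.lintegral_comp _ _ _ m3,
      Kernel.lintegral_comp _ _ _ m4]
    refine lintegral_congr fun u => ?_
    rw [Kernel.lintegral_traj _ m3, Kernel.lintegral_traj _ m4]
    have e1 : ∀ x : ℕ → ℝ, (fun i : Finset.Iic n => Function.updateFinset x (Finset.Iic n) u i) = u := by
      intro x; ext i
      simp [Function.updateFinset, i.2]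
    have e2 : ∀ x : ℕ → ℝ, Function.updateFinset x (Finset.Iic n) u n =
        u ⟨n, Finset.mem_Iic.2 le_rfl⟩ := by
      intro x; simp [Function.updateFinset]
    have e3 : ∀ x : ℕ → ℝ, Function.updateFinset x (Finset.Iic n) u (n + 1) = x (n + 1) := by
      intro x; simp [Function.updateFinset]
    simp only [e1, e2, e3, lintegral_const, measure_univ, mul_one]
    have m5 : Measurable fun y => φ (u ⟨n, Finset.mem_Iic.2 le_rfl⟩) y := hφ.of_uncurry_left
    rw [lintegral_const_mul]
    · congr 1
      have := congrFun (congrArg DFunLike.coe (Kernel.map_traj_succ_self (X := fun _ : ℕ => ℝ) (κ := K) (a := n))) u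
      rw [Kernel.map_apply _ (measurable_pi_apply _)] at this
      calc _ = ∫⁻ y, φ (u ⟨n, Finset.mem_Iic.2 le_rfl⟩) y ∂(Measure.map (fun x : ℕ → ℝ => x (n+1)) (Kernel.traj (X := fun _ : ℕ => ℝ) K n u)) := by
            rw [lintegral_map m5 (measurable_pi_apply _)]
        _ = _ := by rw [this]; rfl
    · exact m5.comp (measurable_pi_apply _)

lemma lintegral_stepKernel {q : ℝ → ℝ → ℝ} (hq : Measurable (Function.uncurry q)) (s : ℝ)
    {φ : ℝ → ℝ≥0∞} (hφ : Measurable φ) :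
    ∫⁻ y, φ y ∂(stepKernel q s) = ∫⁻ x, φ (s + x) * ENNReal.ofReal (q s x) := by
  have hm : Measurable (Function.uncurry fun s y => ENNReal.ofReal (q s (y - s))) :=
    ENNReal.measurable_ofReal.comp (hq.comp (measurable_fst.prodMk (measurable_snd.sub measurable_fst)))
  rw [stepKernel, Kernel.lintegral_withDensity _ hm _ hφ, Kernel.const_apply,
    ← lintegral_add_left_eq_self _ s]
  refine lintegral_congr fun x => ?_
  rw [add_sub_cancel_left, mul_comm]

lemma isMarkovKernel_stepKernel {q : ℝ → ℝ → ℝ} (hq : Measurable (Function.uncurry q))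
    (h1 : ∀ s, ∫⁻ x, ENNReal.ofReal (q s x) = 1) : IsMarkovKernel (stepKernel q) := by
  refine ⟨fun s => ⟨?_⟩⟩
  have := lintegral_stepKernel hq s (φ := fun _ => 1) measurable_const
  simpa [h1] using this

lemma lintegral_law {f : ℝ → ℝ} (hf : Measurable f) {φ : ℝ → ℝ≥0∞} (hφ : Measurable φ) :
    ∫⁻ x, φ x ∂(law f) = ∫⁻ x, φ x * ENNReal.ofReal (f x) := by
  rw [law, lintegral_withDensity_eq_lintegral_mul _ (by fun_prop) hφ]
  exact lintegral_congr fun x => mul_comm _ _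

/-- The first `n` increments determine the path up to time `n` and are independent of `X n`, so the
joint law is a product and Fubini gives the Markov property. -/
lemma isChain_walk {Ω : Type*} [MeasurableSpace Ω] {P : Measure Ω} [IsProbabilityMeasure P]
    {X : ℕ → Ω → ℝ} {f : ℝ → ℝ} (hX : ∀ n, Measurable (X n)) (hindep : iIndepFun X P)
    (hf : Measurable f) (hlaw : ∀ n, P.map (X n) = law f) :
    IsChain P (walk X) (stepKernel fun _ => f) := by
  have hS : ∀ n, Measurable fun ω => walk X ω n := fun n =>
    Finset.measurable_fun_sum _ fun i _ => hX i
  refine ⟨hS, by simp [walk], inferInstance, ?_⟩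
  intro n H φ hH hφ
  have hq : Measurable (Function.uncurry fun _ : ℝ => f) := hf.comp measurable_snd
  have hXm : Measurable fun ω (i : Finset.range n) => X i ω := measurable_pi_lambda _ fun i => hX i
  have hind := hindep.indepFun_finset (Finset.range n) {n} (by simp) hX
  have hind2 : IndepFun (fun ω (i : Finset.range n) => X i ω) (X n) P :=
    hind.comp (φ := id) (ψ := fun v : (({n} : Finset ℕ) → ℝ) => v ⟨n, by simp⟩) measurable_id
      (measurable_pi_apply _)
  have hmap := (indepFun_iff_map_prod_eq_prod_map_map hXm.aemeasurable
    (hX n).aemeasurable).1 hind2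
  -- partial sums as functions of the increments
  set σ : (Finset.range n → ℝ) → (i : Finset.Iic n) → ℝ := fun v i =>
    ∑ j ∈ (Finset.range n).attach, if (j : ℕ) < i then v j else 0 with hσ
  have hσm : Measurable σ := by
    refine measurable_pi_lambda _ fun i => Finset.measurable_fun_sum _ fun j _ => ?_
    by_cases hj : (j : ℕ) < i
    · simpa [hj] using measurable_pi_apply j
    · simp [hj]
  have hσe : ∀ ω, σ (fun i => X i ω) = fun i : Finset.Iic n => walk X ω i := by
    intro ω; ext i
    simp only [hσ, walk]
    rw [Finset.sum_attach (Finset.range n) (fun j => if j < (i : ℕ) then X j ω else 0),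
      ← Finset.sum_filter]
    congr 1
    ext j
    have := Finset.mem_Iic.1 i.2
    simp only [Finset.mem_filter, Finset.mem_range]
    omega
  set last : Finset.Iic n := ⟨n, Finset.mem_Iic.2 le_rfl⟩
  have hprob : IsProbabilityMeasure (law f) := by
    rw [← hlaw 0]; exact Measure.isProbabilityMeasure_map (hX 0).aemeasurable
  have hσl : Measurable fun v => σ v last := (measurable_pi_apply last).comp hσm
  set Φ : (Finset.range n → ℝ) × ℝ → ℝ≥0∞ := fun p => H (σ p.1) * φ (σ p.1 last) (σ p.1 last + p.2)
    with hΦ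
  have hΦm : Measurable Φ := by
    refine (hH.comp (hσm.comp measurable_fst)).mul (hφ.comp (Measurable.prodMk ?_ ?_))
    · exact hσl.comp measurable_fst
    · exact (hσl.comp measurable_fst).add measurable_snd
  have e1 : ∀ ω, H (fun i => walk X ω i) * φ (walk X ω n) (walk X ω (n + 1)) =
      Φ ((fun i => X i ω), X n ω) := by
    intro ω
    simp only [hΦ, hσe]
    rw [show walk X ω (n+1) = walk X ω n + X n ω from Finset.sum_range_succ _ _]
  have hψ : ∀ s, ∫⁻ y, φ s y ∂(stepKernel (fun _ => f) s) = ∫⁻ x, φ s (s + x) ∂(law f) := by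
    intro s
    have hm : Measurable fun y => φ s y := hφ.of_uncurry_left
    rw [lintegral_stepKernel hq s hm, lintegral_law hf]
    exact hm.comp (measurable_const.add measurable_id)
  calc ∫⁻ ω, H (fun i => walk X ω i) * φ (walk X ω n) (walk X ω (n + 1)) ∂P
      = ∫⁻ ω, Φ ((fun i => X i ω), X n ω) ∂P := lintegral_congr e1
    _ = ∫⁻ p, Φ p ∂(P.map fun ω => ((fun i : Finset.range n => X i ω), X n ω)) := by
        rw [lintegral_map hΦm (hXm.prodMk (hX n))]
    _ = ∫⁻ v, ∫⁻ x, Φ (v, x) ∂(law f) ∂(P.map fun ω (i : Finset.range n) => X i ω) := by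
        rw [hmap, hlaw n, lintegral_prod _ hΦm.aemeasurable]
    _ = ∫⁻ ω, ∫⁻ x, Φ ((fun i => X i ω), x) ∂(law f) ∂P := by
        rw [lintegral_map (hΦm.lintegral_prod_right') hXm]
    _ = _ := by
        refine lintegral_congr fun ω => ?_
        simp only [hΦ, hσe, hψ]
        rw [lintegral_const_mul]
        exact hφ.comp (measurable_const.prodMk (measurable_const.add measurable_id))

/-! ### Additive and multiplicative functionals of a chain -/

/-- The operator `φ ↦ ∫ w(·, y) φ(y) κ(·, dy)`. -/
def weighted (κ : Kernel ℝ ℝ) (w : ℝ → ℝ → ℝ≥0∞) (φ : ℝ → ℝ≥0∞) (s : ℝ) : ℝ≥0∞ :=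
  ∫⁻ y, w s y * φ y ∂(κ s)

section weighted

variable {κ : Kernel ℝ ℝ} {w : ℝ → ℝ → ℝ≥0∞}

lemma measurable_weighted [IsSFiniteKernel κ] (hw : Measurable (Function.uncurry w))
    {φ : ℝ → ℝ≥0∞} (hφ : Measurable φ) : Measurable (weighted κ w φ) := by
  refine Measurable.lintegral_kernel_prod_right (f := fun s y => w s y * φ y) ?_
  exact hw.mul (hφ.comp measurable_snd)

lemma measurable_weighted_iterate [IsSFiniteKernel κ] (hw : Measurable (Function.uncurry w))
    {φ : ℝ → ℝ≥0∞} (hφ : Measurable φ) (n : ℕ) : Measurable ((weighted κ w)^[n] φ) := by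
  induction n with
  | zero => exact hφ
  | succ n ih => rw [Function.iterate_succ_apply']; exact measurable_weighted hw ih

/-- The Markov property, iterated, turns multiplicative functionals of the path into powers of one
operator. All later bounds are then inequalities between functions of one real variable. -/
lemma IsChain.lintegral_prod_mul {Ω : Type*} [MeasurableSpace Ω] {μ : Measure Ω} {S : Ω → ℕ → ℝ}
    [IsSFiniteKernel κ] (hS : IsChain μ S κ) (hw : Measurable (Function.uncurry w))
    (n : ℕ) {φ : ℝ → ℝ≥0∞} (hφ : Measurable φ) :
    ∫⁻ ω, (∏ i ∈ Finset.range n, w (S ω i) (S ω (i + 1))) * φ (S ω n) ∂μ =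
      (weighted κ w)^[n] φ 0 := by
  have := hS.isProb
  induction n generalizing φ with
  | zero =>
    have : (fun ω => φ (S ω 0)) =ᵐ[μ] fun _ => φ 0 := by
      filter_upwards [hS.zero] with ω h; rw [h]
    simp [lintegral_congr_ae this]
  | succ n ih =>
    rw [Function.iterate_succ_apply, ← ih (measurable_weighted hw hφ)]
    -- `attach` carries the bounds on the indices that exhibit the product as a function of the path
    -- up to time `n`.
    have hstep := hS.step n (fun v => ∏ i ∈ (Finset.range n).attach,
      w (v ⟨i, Finset.mem_Iic.2 (Finset.mem_range.1 i.2).le⟩) (v ⟨i + 1, Finset.mem_Iic.2 (Finset.mem_range.1 i.2)⟩))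
      (fun s y => w s y * φ y)
      (Finset.measurable_fun_prod _ fun i _ => measurable_comp_pair hw
        (measurable_pi_apply _) (measurable_pi_apply _))
      (hw.mul (hφ.comp measurable_snd))
    simp only at hstep
    have e : ∀ ω, ∏ i ∈ (Finset.range n).attach, w (S ω i) (S ω (i + 1)) =
        ∏ i ∈ Finset.range n, w (S ω i) (S ω (i + 1)) := fun ω =>
      Finset.prod_attach (Finset.range n) fun i => w (S ω i) (S ω (i + 1))
    simp only [e] at hstep
    simp only [Finset.prod_range_succ, mul_assoc]
    exact hstep

lemma IsChain.lintegral_prod_mul_pair {Ω : Type*} [MeasurableSpace Ω] {μ : Measure Ω}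
    {S : Ω → ℕ → ℝ} [IsSFiniteKernel κ] (hS : IsChain μ S κ) (hw : Measurable (Function.uncurry w))
    (n : ℕ) {e : ℝ → ℝ → ℝ≥0∞} (he : Measurable (Function.uncurry e)) :
    ∫⁻ ω, (∏ i ∈ Finset.range n, w (S ω i) (S ω (i + 1))) * e (S ω n) (S ω (n + 1)) ∂μ =
      (weighted κ w)^[n] (fun s => ∫⁻ y, e s y ∂(κ s)) 0 := by
  rw [← hS.lintegral_prod_mul hw n (Measurable.lintegral_kernel_prod_right he)]
  have hstep := hS.step n (fun v => ∏ i ∈ (Finset.range n).attach,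
      w (v ⟨i, Finset.mem_Iic.2 (Finset.mem_range.1 i.2).le⟩) (v ⟨i + 1, Finset.mem_Iic.2 (Finset.mem_range.1 i.2)⟩))
      e
      (Finset.measurable_fun_prod _ fun i _ => measurable_comp_pair hw
        (measurable_pi_apply _) (measurable_pi_apply _)) he
  simp only at hstep
  have e : ∀ ω, ∏ i ∈ (Finset.range n).attach, w (S ω i) (S ω (i + 1)) =
      ∏ i ∈ Finset.range n, w (S ω i) (S ω (i + 1)) := fun ω =>
    Finset.prod_attach (Finset.range n) fun i => w (S ω i) (S ω (i + 1))
  simpa only [e] using hstep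

/-- A supersolution `ψ` of `ψ = φ + T ψ` on a set `D` that `w` does not leave dominates the
minimal solution. -/
lemma sum_weighted_iterate_le [IsSFiniteKernel κ] (hw : Measurable (Function.uncurry w)) {D : Set ℝ}
    (hD : ∀ s y, y ∉ D → w s y = 0) {φ ψ : ℝ → ℝ≥0∞} (hφ : Measurable φ)
    (h : ∀ s ∈ D, φ s + weighted κ w ψ s ≤ ψ s) (N : ℕ) :
    ∀ s ∈ D, ∑ n ∈ Finset.range N, (weighted κ w)^[n] φ s ≤ ψ s := by
  induction N with
  | zero => simp
  | succ N ih =>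
    intro s hs
    refine le_trans ?_ (h s hs)
    rw [Finset.sum_range_succ', add_comm, Function.iterate_zero, id_eq]
    gcongr
    simp only [Function.iterate_succ_apply']
    calc ∑ n ∈ Finset.range N, weighted κ w ((weighted κ w)^[n] φ) s
        = ∫⁻ y, ∑ n ∈ Finset.range N, w s y * (weighted κ w)^[n] φ y ∂(κ s) := by
          rw [lintegral_finsetSum]
          · rfl
          · exact fun n _ => (hw.of_uncurry_left).mul (measurable_weighted_iterate hw hφ n)
      _ ≤ _ := by
          refine lintegral_mono fun y => ?_
          by_cases hy : y ∈ D
          · rw [← Finset.mul_sum]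
            gcongr
            exact ih y hy
          · simp [hD s y hy]

/-- A subsolution `ψ` of `ψ = φ + T ψ`, iterated. -/
lemma le_sum_weighted_iterate_add [IsSFiniteKernel κ] (hw : Measurable (Function.uncurry w))
    {D : Set ℝ} (hD : ∀ s y, y ∉ D → w s y = 0) {φ ψ : ℝ → ℝ≥0∞} (hφ : Measurable φ)
    (hψ : Measurable ψ) (h : ∀ s ∈ D, ψ s ≤ φ s + weighted κ w ψ s) (N : ℕ) :
    ∀ s ∈ D, ψ s ≤ ∑ n ∈ Finset.range N, (weighted κ w)^[n] φ s + (weighted κ w)^[N] ψ s := by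
  induction N with
  | zero => simp
  | succ N ih =>
    intro s hs
    refine (h s hs).trans ?_
    rw [Finset.sum_range_succ', add_comm _ ((weighted κ w)^[0] φ s), Function.iterate_zero, id_eq,
      add_assoc]
    gcongr
    simp only [Function.iterate_succ_apply']
    calc weighted κ w ψ s ≤ ∫⁻ y, (∑ n ∈ Finset.range N, w s y * (weighted κ w)^[n] φ y) +
            w s y * (weighted κ w)^[N] ψ y ∂(κ s) := by
          refine lintegral_mono fun y => ?_
          by_cases hy : y ∈ D
          · rw [← Finset.mul_sum, ← mul_add]
            gcongr
            exact ih y hy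
          · simp [hD s y hy]
      _ = _ := by
          rw [lintegral_add_right, lintegral_finsetSum]
          · rfl
          · exact fun n _ => (hw.of_uncurry_left).mul (measurable_weighted_iterate hw hφ n)
          · exact (hw.of_uncurry_left).mul (measurable_weighted_iterate hw hψ N)

end weighted

end

section

/-! ### First passage -/

lemma lt_passage_iff (b : ℝ) (S : ℕ → ℝ) (n : ℕ) :
    (n : ℕ∞) < passage b S ↔ ∀ i < n, S (i + 1) ≤ b := by
  rw [← ENat.add_one_le_iff (ENat.natCast_ne_top n), passage]
  simp only [le_iInf_iff]
  constructor
  · intro h i hi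
    by_contra! hb
    have := h (i + 1) ⟨by omega, hb⟩
    norm_cast at this
    omega
  · rintro h i ⟨h1, h2⟩
    by_contra! hlt
    norm_cast at hlt
    have := h (i - 1) (by omega)
    rw [Nat.sub_add_cancel h1] at this
    linarith

/-- The product of the weights `ρ` over the steps up to first passage, and `0` without passage. -/
def hit (ρ : ℝ → ℝ → ℝ≥0∞) (b : ℝ) (S : ℕ → ℝ) : ℝ≥0∞ :=
  open Classical in
  if passage b S < ⊤ then ∏ i ∈ Finset.range (passage b S).toNat, ρ (S i) (S (i + 1)) else 0

/-- The weight `ρ` on steps that stay below the level. -/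
def stay (ρ : ℝ → ℝ → ℝ≥0∞) (b s y : ℝ) : ℝ≥0∞ := (Set.Iic b).indicator (ρ s) y

/-- The weight `ρ` on steps that pass the level. -/
def exit (ρ : ℝ → ℝ → ℝ≥0∞) (b s y : ℝ) : ℝ≥0∞ := (Set.Ioi b).indicator (ρ s) y

lemma measurable_stay {ρ : ℝ → ℝ → ℝ≥0∞} (hρ : Measurable (Function.uncurry ρ)) (b : ℝ) :
    Measurable (Function.uncurry (stay ρ b)) :=
  hρ.indicator (measurable_snd measurableSet_Iic)

lemma measurable_exit {ρ : ℝ → ℝ → ℝ≥0∞} (hρ : Measurable (Function.uncurry ρ)) (b : ℝ) :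
    Measurable (Function.uncurry (exit ρ b)) :=
  hρ.indicator (measurable_snd measurableSet_Ioi)

/-- Decomposition by the passage time, which is never 0: the summand `n` belongs to passage at time
`n + 1`, and at most one summand is nonzero. -/
lemma hit_eq_tsum (ρ : ℝ → ℝ → ℝ≥0∞) (b : ℝ) (S : ℕ → ℝ) :
    hit ρ b S = ∑' n, (∏ i ∈ Finset.range n, stay ρ b (S i) (S (i + 1))) *
      exit ρ b (S n) (S (n + 1)) := by
  rw [hit]
  split_ifs with h
  · obtain ⟨N, hN⟩ := ENat.ne_top_iff_exists.1 h.ne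
    have hN0 : N ≠ 0 := by
      rintro rfl
      have := (lt_passage_iff b S 0).2 (by simp)
      rw [← hN] at this
      exact lt_irrefl _ this
    obtain ⟨n, rfl⟩ := Nat.exists_eq_succ_of_ne_zero hN0
    have h1 := (lt_passage_iff b S n).1 (by rw [← hN]; exact_mod_cast Nat.lt_succ_self n)
    have h2 : b < S (n + 1) := by
      by_contra! hb
      have := (lt_passage_iff b S (n + 1)).2 fun i hi => by
        rcases Nat.lt_succ_iff_lt_or_eq.1 hi with h | rfl
        · exact h1 i h
        · exact hb
      rw [← hN] at this
      exact lt_irrefl _ this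
    rw [tsum_eq_single n, ← hN, ENat.toNat_natCast, Nat.succ_eq_add_one, Finset.prod_range_succ]
    · congr 1
      · refine Finset.prod_congr rfl fun i hi => ?_
        rw [stay, Set.indicator_of_mem]
        exact h1 i (Finset.mem_range.1 hi)
      · rw [exit, Set.indicator_of_mem]
        exact h2
    · intro m hm
      rcases lt_or_gt_of_ne hm with h | h
      · rw [exit, Set.indicator_of_notMem, mul_zero]
        simpa using h1 m h
      · rw [Finset.prod_eq_zero (Finset.mem_range.2 h), zero_mul]
        rw [stay, Set.indicator_of_notMem]
        simpa using h2
  · symm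
    rw [ENNReal.tsum_eq_zero]
    intro n
    rw [exit, Set.indicator_of_notMem, mul_zero]
    have htop : passage b S = ⊤ := by simpa using h
    have := (lt_passage_iff b S (n + 1)).1 (by rw [htop]; exact ENat.natCast_lt_top _) n (by omega)
    simpa using this

/-- This is τ = ∑ I(τ > n), with the indicator written as a product of weights. -/
lemma passage_eq_tsum (b : ℝ) (S : ℕ → ℝ) :
    (passage b S : ℝ≥0∞) =
      ∑' n, ∏ i ∈ Finset.range n, stay (fun _ _ => 1) b (S i) (S (i + 1)) := by
  have h : ∀ n : ℕ, ∏ i ∈ Finset.range n, stay (fun _ _ => 1) b (S i) (S (i + 1)) =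
      if (n : ℕ∞) < passage b S then 1 else 0 := by
    intro n
    split_ifs with h
    · rw [lt_passage_iff] at h
      refine Finset.prod_eq_one fun i hi => ?_
      rw [stay, Set.indicator_of_mem]
      exact h i (Finset.mem_range.1 hi)
    · rw [lt_passage_iff] at h
      push Not at h
      obtain ⟨i, hi, hb⟩ := h
      refine Finset.prod_eq_zero (Finset.mem_range.2 hi) ?_
      rw [stay, Set.indicator_of_notMem]
      simpa using hb
  simp only [h]
  induction passage b S using ENat.recTopCoe with
  | top => simp
  | coe N =>
    simp only [Nat.cast_lt]
    rw [tsum_eq_sum (s := Finset.range N) (by intro n hn; simpa using hn)]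
    rw [Finset.sum_congr rfl fun n hn => if_pos (Finset.mem_range.1 hn)]
    simp

lemma IsChain.lintegral_hit {Ω : Type*} [MeasurableSpace Ω] {μ : Measure Ω} {S : Ω → ℕ → ℝ}
    {κ : Kernel ℝ ℝ} [IsSFiniteKernel κ] (hS : IsChain μ S κ) {ρ : ℝ → ℝ → ℝ≥0∞}
    (hρ : Measurable (Function.uncurry ρ)) (b : ℝ) :
    ∫⁻ ω, hit ρ b (S ω) ∂μ =
      ∑' n, (weighted κ (stay ρ b))^[n] (fun s => ∫⁻ y, exit ρ b s y ∂(κ s)) 0 := by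
  simp only [hit_eq_tsum]
  rw [lintegral_tsum]
  · exact tsum_congr fun n =>
      hS.lintegral_prod_mul_pair (measurable_stay hρ b) n (measurable_exit hρ b)
  · intro n
    refine Measurable.aemeasurable (Measurable.mul ?_ ?_)
    · exact Finset.measurable_fun_prod _ fun i _ =>
        measurable_comp_pair (measurable_stay hρ b) (hS.measurable i) (hS.measurable (i + 1))
    · exact measurable_comp_pair (measurable_exit hρ b) (hS.measurable n) (hS.measurable (n + 1))

/-- Change of measure for the weights up to first passage. -/
lemma IsChain.lintegral_hit_congr {Ω Ω' : Type*} [MeasurableSpace Ω] [MeasurableSpace Ω']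
    {μ : Measure Ω} {μ' : Measure Ω'} {S : Ω → ℕ → ℝ} {S' : Ω' → ℕ → ℝ}
    {κ κ' : Kernel ℝ ℝ} [IsSFiniteKernel κ] [IsSFiniteKernel κ'] (hS : IsChain μ S κ)
    (hS' : IsChain μ' S' κ') {ρ ρ' : ℝ → ℝ → ℝ≥0∞}
    (hρ : Measurable (Function.uncurry ρ)) (hρ' : Measurable (Function.uncurry ρ'))
    (h : ∀ s (ψ : ℝ → ℝ≥0∞), Measurable ψ →
      ∫⁻ y, ρ s y * ψ y ∂(κ s) = ∫⁻ y, ρ' s y * ψ y ∂(κ' s)) (b : ℝ) :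
    ∫⁻ ω, hit ρ b (S ω) ∂μ = ∫⁻ ω, hit ρ' b (S' ω) ∂μ' := by
  rw [hS.lintegral_hit hρ, hS'.lintegral_hit hρ']
  have hind : ∀ (A : Set ℝ) (σ : ℝ → ℝ → ℝ≥0∞) (ψ : ℝ → ℝ≥0∞) s y,
      A.indicator (σ s) y * ψ y = σ s y * A.indicator ψ y := by
    intro A σ ψ s y
    by_cases hy : y ∈ A <;> simp [hy]
  have h1 : (fun s => ∫⁻ y, exit ρ b s y ∂(κ s)) = fun s => ∫⁻ y, exit ρ' b s y ∂(κ' s) := by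
    ext s
    have := h s ((Set.Ioi b).indicator 1) (measurable_one.indicator measurableSet_Ioi)
    simpa [← hind, exit] using this
  have h2 : ∀ ψ : ℝ → ℝ≥0∞, Measurable ψ →
      weighted κ (stay ρ b) ψ = weighted κ' (stay ρ' b) ψ := by
    intro ψ hψ
    ext s
    simp only [weighted, stay, hind]
    exact h s _ (hψ.indicator measurableSet_Iic)
  have hm : Measurable fun s => ∫⁻ y, exit ρ b s y ∂(κ s) :=
    Measurable.lintegral_kernel_prod_right (measurable_exit hρ b)
  refine tsum_congr fun n => ?_
  rw [← h1]
  refine congrFun ?_ 0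
  induction n with
  | zero => rfl
  | succ n ih =>
    rw [Function.iterate_succ_apply', Function.iterate_succ_apply', ← ih,
      h2 _ (measurable_weighted_iterate (measurable_stay hρ b) hm n)]

/-- A Lyapunov bound for the weights up to first passage. -/
lemma IsChain.lintegral_hit_le {Ω : Type*} [MeasurableSpace Ω] {μ : Measure Ω} {S : Ω → ℕ → ℝ}
    {κ : Kernel ℝ ℝ} [IsSFiniteKernel κ] (hS : IsChain μ S κ) {ρ : ℝ → ℝ → ℝ≥0∞}
    (hρ : Measurable (Function.uncurry ρ)) {b : ℝ} (hb : 0 ≤ b) {g : ℝ → ℝ≥0∞}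
    (h1 : ∀ y, b < y → 1 ≤ g y) (h : ∀ s ≤ b, ∫⁻ y, ρ s y * g y ∂(κ s) ≤ g s) :
    ∫⁻ ω, hit ρ b (S ω) ∂μ ≤ g 0 := by
  rw [hS.lintegral_hit hρ, ENNReal.tsum_eq_iSup_nat]
  refine iSup_le fun N => sum_weighted_iterate_le (D := Set.Iic b) (measurable_stay hρ b) ?_
    (Measurable.lintegral_kernel_prod_right (measurable_exit hρ b)) ?_ N 0 hb
  · intro s y hy
    rw [stay, Set.indicator_of_notMem hy]
  · intro s hs
    refine le_trans ?_ (h s hs)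
    rw [weighted, ← lintegral_add_left (measurable_exit hρ b).of_uncurry_left]
    refine lintegral_mono fun y => ?_
    by_cases hy : y ≤ b
    · simp [exit, stay, hy]
    · have hy' : b < y := not_le.1 hy
      simp only [exit, stay, Set.mem_Ioi, hy', Set.indicator_of_mem, Set.mem_Iic, hy,
        not_false_eq_true, Set.indicator_of_notMem, zero_mul, add_zero]
      exact le_mul_of_one_le_right' (h1 y hy')

/-- A lower bound for the passage probability by a subsolution that vanishes along the paths. -/
lemma IsChain.le_lintegral_hit {Ω : Type*} [MeasurableSpace Ω] {μ : Measure Ω} {S : Ω → ℕ → ℝ}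
    {κ : Kernel ℝ ℝ} [IsSFiniteKernel κ] (hS : IsChain μ S κ) {b : ℝ} (hb : 0 ≤ b)
    {g : ℝ → ℝ≥0∞} (hg : Measurable g)
    (h : ∀ s ≤ b, g s ≤ κ s (Set.Ioi b) + ∫⁻ y in Set.Iic b, g y ∂(κ s))
    (hlim : Tendsto (fun n => ∫⁻ ω, g (S ω n) ∂μ) atTop (𝓝 0)) :
    g 0 ≤ ∫⁻ ω, hit (fun _ _ => 1) b (S ω) ∂μ := by
  have h1 : Measurable (Function.uncurry fun _ _ : ℝ => (1 : ℝ≥0∞)) := measurable_const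
  have hle : ∀ N, g 0 ≤ ∫⁻ ω, hit (fun _ _ => 1) b (S ω) ∂μ + ∫⁻ ω, g (S ω N) ∂μ := by
    intro N
    refine (le_sum_weighted_iterate_add (κ := κ) (ψ := g)
      (φ := fun s => ∫⁻ y, exit (fun _ _ => 1) b s y ∂(κ s)) (D := Set.Iic b) (measurable_stay h1 b) ?_
      (Measurable.lintegral_kernel_prod_right (measurable_exit h1 b)) hg ?_ N 0 hb).trans ?_
    · intro s y hy
      rw [stay, Set.indicator_of_notMem hy]
    · intro s hs
      refine (h s hs).trans (le_of_eq ?_)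
      congr 1
      · simp only [exit]
        rw [lintegral_indicator measurableSet_Ioi]
        simp
      · rw [weighted, ← lintegral_indicator measurableSet_Iic]
        refine lintegral_congr fun y => ?_
        by_cases hy : y ≤ b <;> simp [stay, hy]
    · gcongr
      · rw [hS.lintegral_hit h1]
        exact ENNReal.sum_le_tsum _
      · rw [← hS.lintegral_prod_mul (measurable_stay h1 b) N hg]
        refine lintegral_mono fun ω => mul_le_of_le_one_left' ?_
        refine Finset.prod_le_one' fun i _ => ?_
        exact Set.indicator_le_self _ _ _
  have := (tendsto_const_nhds (x := ∫⁻ ω, hit (fun _ _ => 1) b (S ω) ∂μ)).add hlim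
  rw [add_zero] at this
  exact ge_of_tendsto' this hle

/-- A Lyapunov bound for the mean passage time. -/
lemma IsChain.lintegral_passage_le {Ω : Type*} [MeasurableSpace Ω] {μ : Measure Ω}
    {S : Ω → ℕ → ℝ} {κ : Kernel ℝ ℝ} [IsSFiniteKernel κ] (hS : IsChain μ S κ) {b : ℝ} (hb : 0 ≤ b)
    {g : ℝ → ℝ≥0∞} (h : ∀ s ≤ b, 1 + ∫⁻ y in Set.Iic b, g y ∂(κ s) ≤ g s) :
    ∫⁻ ω, (passage b (S ω) : ℝ≥0∞) ∂μ ≤ g 0 := by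
  have h1 : Measurable (Function.uncurry fun _ _ : ℝ => (1 : ℝ≥0∞)) := measurable_const
  simp only [passage_eq_tsum]
  rw [lintegral_tsum]
  · have := fun n => hS.lintegral_prod_mul (measurable_stay h1 b) n (φ := fun _ => 1) measurable_const
    simp only [mul_one] at this
    simp only [this]
    rw [ENNReal.tsum_eq_iSup_nat]
    refine iSup_le fun N => sum_weighted_iterate_le (D := Set.Iic b) (measurable_stay h1 b) ?_
      measurable_const ?_ N 0 hb
    · intro s y hy
      rw [stay, Set.indicator_of_notMem hy]
    · intro s hs
      refine le_trans (le_of_eq ?_) (h s hs)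
      congr 1
      rw [weighted, ← lintegral_indicator measurableSet_Iic]
      refine lintegral_congr fun y => ?_
      by_cases hy : y ≤ b <;> simp [stay, hy]
  · intro n
    exact (Finset.measurable_fun_prod _ fun i _ =>
        measurable_comp_pair (measurable_stay h1 b) (hS.measurable i)
          (hS.measurable (i + 1))).aemeasurable

end

section

/-! ### Importance sampling -/

/-- The likelihood ratio of one step. -/
def likelihood (f : ℝ → ℝ) (q : ℝ → ℝ → ℝ) (s y : ℝ) : ℝ≥0∞ :=
  ENNReal.ofReal (f (y - s) / q s (y - s))

lemma measurable_likelihood {f : ℝ → ℝ} {q : ℝ → ℝ → ℝ} (hf : Measurable f)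
    (hq : Measurable (Function.uncurry q)) : Measurable (Function.uncurry (likelihood f q)) := by
  have h : Measurable fun p : ℝ × ℝ => p.2 - p.1 := measurable_snd.sub measurable_fst
  exact ENNReal.measurable_ofReal.comp
    ((hf.comp h).div (hq.comp (measurable_fst.prodMk h)))

/-- The exponent 0 is excluded because the estimator is 0 on paths without passage. -/
lemma ofReal_estimator_pow {f : ℝ → ℝ} {q : ℝ → ℝ → ℝ} (hf0 : ∀ x, 0 ≤ f x)
    (hq0 : ∀ s x, 0 ≤ q s x) (b : ℝ) (S : ℕ → ℝ) {m : ℕ} (hm : m ≠ 0) :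
    ENNReal.ofReal (estimator f q b S ^ m) = hit (fun s y => likelihood f q s y ^ m) b S := by
  rw [estimator, hit]
  split_ifs with h
  · rw [← Finset.prod_pow, ENNReal.ofReal_prod_of_nonneg]
    · refine Finset.prod_congr rfl fun i _ => ?_
      rw [likelihood, ENNReal.ofReal_pow (div_nonneg (hf0 _) (hq0 _ _))]
    · exact fun i _ => pow_nonneg (div_nonneg (hf0 _) (hq0 _ _)) _
  · simp [hm]

lemma ofReal_ruinProb {Ω : Type*} [MeasurableSpace Ω] {P : Measure Ω} [IsProbabilityMeasure P]
    {X : ℕ → Ω → ℝ} (hX : ∀ n, Measurable (X n)) (b : ℝ) :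
    ENNReal.ofReal (ruinProb P X b) = ∫⁻ ω, hit (fun _ _ => 1) b (walk X ω) ∂P := by
  rw [ruinProb, ofReal_measureReal]
  have hS : ∀ n, Measurable fun ω => walk X ω n := fun n =>
    Finset.measurable_fun_sum _ fun i _ => hX i
  have hms : MeasurableSet {ω | passage b (walk X ω) < ⊤} := by
    have : {ω | passage b (walk X ω) < ⊤} = {ω | ∀ n, walk X ω (n + 1) ≤ b}ᶜ := by
      ext ω
      simp only [Set.mem_ofPred_eq, Set.mem_compl_iff, lt_top_iff_ne_top, ne_eq, not_iff_not]
      constructor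
      · intro h n
        exact (lt_passage_iff b (walk X ω) (n + 1)).1 (by rw [h]; exact ENat.natCast_lt_top _) n
          (by omega)
      · intro h
        by_contra hne
        obtain ⟨N, hN⟩ := ENat.ne_top_iff_exists.1 hne
        have := (lt_passage_iff b (walk X ω) N).2 fun i _ => h i
        rw [← hN] at this
        exact lt_irrefl _ this
    rw [this]
    refine (MeasurableSet.iInter fun n => ?_).compl.congr (s := (⋂ n, {ω | walk X ω (n + 1) ≤ b})ᶜ) ?_
    · exact measurableSet_le (hS _) measurable_const
    · ext; simp
  rw [← lintegral_indicator_one hms]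
  refine lintegral_congr fun ω => ?_
  by_cases h : passage b (walk X ω) < ⊤ <;> simp [hit, h]

/-- Where q vanishes the ratio is 0 by the convention for division, and `hac` makes the right-hand
integrand vanish there too. -/
lemma lintegral_likelihood_mul {f : ℝ → ℝ} {q : ℝ → ℝ → ℝ} (hf : Measurable f)
    (hq : Measurable (Function.uncurry q)) (hq0 : ∀ s x, 0 ≤ q s x)
    (hac : ∀ s x, q s x = 0 → f x = 0) (s : ℝ) {ψ : ℝ → ℝ≥0∞} (hψ : Measurable ψ) :
    ∫⁻ y, likelihood f q s y * ψ y ∂(stepKernel q s) = ∫⁻ y, ψ y ∂(stepKernel (fun _ => f) s) := by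
  have hL := measurable_likelihood hf hq
  have hm : Measurable fun y => likelihood f q s y * ψ y := hL.of_uncurry_left.mul hψ
  rw [lintegral_stepKernel hq s hm,
    lintegral_stepKernel (q := fun _ => f) (hf.comp measurable_snd) s hψ]
  refine lintegral_congr fun x => ?_
  rw [mul_right_comm, mul_comm]
  congr 1
  rw [likelihood, add_sub_cancel_left]
  rcases (hq0 s x).eq_or_lt with h | h
  · simp [← h, hac s x h.symm]
  · rw [← ENNReal.ofReal_mul' h.le, div_mul_cancel₀ _ h.ne']

lemma isProbabilityMeasure_law {Ω : Type*} [MeasurableSpace Ω] {P : Measure Ω} [IsProbabilityMeasure P]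
    {X : ℕ → Ω → ℝ} {f : ℝ → ℝ} (hX : ∀ n, Measurable (X n))
    (hlaw : ∀ n, P.map (X n) = law f) : IsProbabilityMeasure (law f) := by
  rw [← hlaw 0]; exact Measure.isProbabilityMeasure_map (hX 0).aemeasurable

lemma lintegral_ofReal_density {f : ℝ → ℝ} (h : IsProbabilityMeasure (law f)) :
    ∫⁻ x, ENNReal.ofReal (f x) = 1 := by
  have := h.measure_univ
  rwa [law, withDensity_apply _ MeasurableSet.univ, Measure.restrict_univ] at this

/-- Strong efficiency from a lower bound for the passage probabilities and a Lyapunov function. -/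
theorem stronglyEfficient_of_lyapunov {Ω : Type*} [MeasurableSpace Ω] {P : Measure Ω} [IsProbabilityMeasure P]
    {X : ℕ → Ω → ℝ} {f : ℝ → ℝ} (hX : ∀ n, Measurable (X n))
    (hindep : iIndepFun X P) (hf : Measurable f) (hf0 : ∀ x, 0 ≤ f x)
    (hlaw : ∀ n, P.map (X n) = law f)
    {q : ℝ → ℝ → ℝ → ℝ}
    (hq : ∀ b, Measurable (Function.uncurry (q b))) (hq0 : ∀ b s x, 0 ≤ q b s x)
    (hq1 : ∀ b s, ∫⁻ x, ENNReal.ofReal (q b s x) = 1) (hac : ∀ b s x, q b s x = 0 → f x = 0)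
    {G : ℝ → ℝ} {ε C : ℝ} (hε : 0 < ε) (hC : 0 < C) (hG : ∀ b > 0, 0 ≤ G b)
    (hlow : ∀ b > 0, ε * G b ≤ ruinProb P X b) {g : ℝ → ℝ≥0∞} (hg : Measurable g)
    (hg1 : ∀ t < 0, 1 ≤ g t) (hgC : ∀ b > 0, g b ≤ ENNReal.ofReal (C * G b ^ 2))
    (hlyap : ∀ b > 0, ∀ s ≤ b,
      ∫⁻ x, ENNReal.ofReal (f x / q b s x) * g (b - s - x) ∂(law f) ≤ g (b - s)) :
    StronglyEfficient P X f q := by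
  have hwalk := isChain_walk hX hindep hf hlaw
  have hprob := isProbabilityMeasure_law hX hlaw
  have hker : IsMarkovKernel (stepKernel fun _ : ℝ => f) :=
    isMarkovKernel_stepKernel (hf.comp measurable_snd) fun _ => lintegral_ofReal_density hprob
  have hkerq : ∀ b, IsMarkovKernel (stepKernel (q b)) := fun b =>
    isMarkovKernel_stepKernel (hq b) (hq1 b)
  have hch := fun b => isChain_pathLaw (q b)
  have hL := fun b => measurable_likelihood hf (hq b)
  -- One of the two likelihood factors is spent on the change of measure from Q to P; the other one
  -- remains as the weight.
  have hsecond : ∀ b > 0, ∫⁻ S, ENNReal.ofReal (estimator f (q b) b S ^ 2) ∂(pathLaw (q b)) =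
      ∫⁻ ω, ENNReal.ofReal (estimator f (q b) b (walk X ω)) ∂P := by
    intro b _
    have e1 : ∀ S, ENNReal.ofReal (estimator f (q b) b S) = hit (likelihood f (q b)) b S := by
      intro S
      simpa using ofReal_estimator_pow hf0 (hq0 b) b S one_ne_zero
    simp only [ofReal_estimator_pow hf0 (hq0 b) b _ two_ne_zero, e1]
    refine (hch b).lintegral_hit_congr hwalk ((hL b).pow_const 2) (hL b) ?_ b
    intro s ψ hψ
    simp only [sq, mul_assoc]
    exact lintegral_likelihood_mul hf (hq b) (hq0 b) (hac b) s ((hL b).of_uncurry_left.mul hψ)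
  refine ⟨fun b hb => ⟨(hch b).isProb, ?_⟩, C / ε ^ 2, by positivity, fun b hb => ⟨hsecond b hb, ?_⟩⟩
  · rw [ofReal_ruinProb hX]
    have e1 : ∀ S, ENNReal.ofReal (estimator f (q b) b S) = hit (likelihood f (q b)) b S := by
      intro S
      simpa using ofReal_estimator_pow hf0 (hq0 b) b S one_ne_zero
    simp only [e1]
    refine (hch b).lintegral_hit_congr hwalk (hL b) measurable_const ?_ b
    intro s ψ hψ
    simpa using lintegral_likelihood_mul hf (hq b) (hq0 b) (hac b) s hψ
  · rw [hsecond b hb]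
    have e1 : ∀ S, ENNReal.ofReal (estimator f (q b) b S) = hit (likelihood f (q b)) b S := by
      intro S
      simpa using ofReal_estimator_pow hf0 (hq0 b) b S one_ne_zero
    simp only [e1]
    have hle := hwalk.lintegral_hit_le (hL b) hb.le (g := fun y => g (b - y))
      (fun y hy => hg1 _ (by linarith)) fun s hs => by
        refine le_trans (le_of_eq ?_) (hlyap b hb s hs)
        have hgm : Measurable fun y => g (b - y) := hg.comp (measurable_const.sub measurable_id)
        have hm : Measurable fun y => likelihood f (q b) s y * g (b - y) :=
          (hL b).of_uncurry_left.mul hgm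
        rw [lintegral_stepKernel (q := fun _ => f) (hf.comp measurable_snd) s hm, lintegral_law hf]
        · refine lintegral_congr fun x => ?_
          rw [likelihood, add_sub_cancel_left, sub_add_eq_sub_sub]
        · exact (ENNReal.measurable_ofReal.comp (hf.div (hq b).of_uncurry_left)).mul
            (hg.comp (measurable_const.sub measurable_id))
    simp only [sub_zero] at hle
    refine hle.trans ((hgC b hb).trans (ENNReal.ofReal_le_ofReal ?_))
    have h1 : (ε * G b) ^ 2 ≤ ruinProb P X b ^ 2 :=
      pow_le_pow_left₀ (mul_nonneg hε.le (hG b hb)) (hlow b hb) 2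
    calc C * G b ^ 2 = C / ε ^ 2 * (ε * G b) ^ 2 := by field_simp
      _ ≤ _ := by gcongr

/-- A bound for the mean termination time from a Lyapunov function. -/
theorem expTermination_le_of_lyapunov {q : ℝ → ℝ → ℝ → ℝ}
    (hq : ∀ b, Measurable (Function.uncurry (q b)))
    (hq1 : ∀ b s, ∫⁻ x, ENNReal.ofReal (q b s x) = 1) {h : ℝ → ℝ≥0∞} (hh : Measurable h)
    {b : ℝ} (hb : 0 < b)
    (hlyap : ∀ s ≤ b, 1 + ∫⁻ x in Set.Iic (b - s), h (b - s - x) * ENNReal.ofReal (q b s x) ≤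
      h (b - s)) :
    expTermination q b ≤ h b := by
  have := isMarkovKernel_stepKernel (hq b) (hq1 b)
  have hle := (isChain_pathLaw (q b)).lintegral_passage_le hb.le (g := fun y => h (b - y))
    fun s hs => by
      refine le_trans (le_of_eq ?_) (hlyap s hs)
      congr 1
      have hhm : Measurable fun y => h (b - y) := hh.comp (measurable_const.sub measurable_id)
      rw [← lintegral_indicator measurableSet_Iic,
        lintegral_stepKernel (hq b) s (hhm.indicator measurableSet_Iic),
        ← lintegral_indicator measurableSet_Iic]
      refine lintegral_congr fun x => ?_
      by_cases hx : x ≤ b - s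
      · have : s + x ≤ b := by linarith
        simp [hx, this, sub_add_eq_sub_sub]
      · have : ¬ s + x ≤ b := by linarith
        simp [hx, this]
  simpa [expTermination] using hle

end

section

/-! ### The right tail and the integrated tail -/

/-- A density with finite mean and unbounded right tail. -/
structure IsHeavy (f : ℝ → ℝ) : Prop where
  meas : Measurable f
  nonneg : ∀ x, 0 ≤ f x
  prob : IsProbabilityMeasure (law f)
  int : Integrable (fun x : ℝ => x) (law f)
  tail_pos : ∀ x, 0 < tail f x

/-- No sign is assumed: it is applied to a tangent line of G, which may be negative. -/
lemma ofReal_integral_le_lintegral {α : Type*} [MeasurableSpace α] {μ : Measure α} {u : α → ℝ}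
    (hu : Integrable u μ) : ENNReal.ofReal (∫ x, u x ∂μ) ≤ ∫⁻ x, ENNReal.ofReal (u x) ∂μ := by
  have h1 : ∫ x, u x ∂μ ≤ ∫ x, max (u x) 0 ∂μ :=
    integral_mono hu hu.pos_part fun x => le_max_left _ _
  refine (ENNReal.ofReal_le_ofReal h1).trans ?_
  rw [ofReal_integral_eq_lintegral_ofReal hu.pos_part (ae_of_all _ fun x => le_max_right _ _)]
  refine lintegral_mono fun x => ?_
  rcases le_total (u x) 0 with hx | hx <;> simp [hx]

namespace IsHeavy

variable {f : ℝ → ℝ} (h : IsHeavy f)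

lemma integrable (h : IsHeavy f) : Integrable f := by
  refine ⟨h.meas.aestronglyMeasurable, ?_⟩
  have := h.prob
  rw [hasFiniteIntegral_iff_ofReal (ae_of_all _ h.nonneg), lintegral_ofReal_density h.prob]
  exact ENNReal.one_lt_top

lemma real_eq (h : IsHeavy f) {A : Set ℝ} (hA : MeasurableSet A) : (law f).real A = ∫ x in A, f x := by
  rw [measureReal_def, law, withDensity_apply _ hA,
    integral_eq_lintegral_of_nonneg_ae (ae_of_all _ h.nonneg) h.meas.aestronglyMeasurable]

lemma tail_sub (h : IsHeavy f) {s t : ℝ} (hst : s ≤ t) :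
    tail f s - tail f t = (law f).real (Set.Ioc s t) := by
  have := h.prob
  rw [tail, tail, ← measureReal_sdiff (Set.Ioi_subset_Ioi hst) measurableSet_Ioi, Set.Ioi_sdiff_Ioi]

lemma tail_sub_eq_integral (h : IsHeavy f) (s t : ℝ) : tail f s - tail f t = ∫ x in s..t, f x := by
  rcases le_total s t with hst | hst
  · rw [h.tail_sub hst, h.real_eq measurableSet_Ioc, intervalIntegral.integral_of_le hst]
  · rw [← neg_sub, h.tail_sub hst, h.real_eq measurableSet_Ioc, intervalIntegral.integral_of_ge hst]

lemma real_Iic (h : IsHeavy f) (t : ℝ) : (law f).real (Set.Iic t) = 1 - tail f t := by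
  have := h.prob
  rw [tail, ← Set.compl_Iic, probReal_compl_eq_one_sub measurableSet_Iic, sub_sub_cancel]

lemma tail_antitone (h : IsHeavy f) : Antitone (tail f) := fun s t hst => by
  have := h.tail_sub hst
  have := measureReal_nonneg (μ := law f) (s := Set.Ioc s t)
  linarith

lemma tail_le_one (h : IsHeavy f) (t : ℝ) : tail f t ≤ 1 := by
  have := h.real_Iic t
  have := measureReal_nonneg (μ := law f) (s := Set.Iic t)
  linarith

lemma continuous_tail (h : IsHeavy f) : Continuous (tail f) := by
  have : tail f = fun t => tail f 0 - ∫ x in (0 : ℝ)..t, f x := by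
    ext t; rw [← h.tail_sub_eq_integral]; ring
  rw [this]
  exact continuous_const.sub
    (intervalIntegral.continuous_primitive (fun a b => h.integrable.intervalIntegrable) 0)

lemma tendsto_tail (h : IsHeavy f) : Tendsto (tail f) atTop (𝓝 0) := by
  have hp := h.prob
  have := tendsto_measure_iInter_atTop (μ := law f) (s := fun t : ℝ => Set.Ioi t)
    (fun t => measurableSet_Ioi.nullMeasurableSet) (fun s t hst => Set.Ioi_subset_Ioi hst)
    ⟨0, measure_ne_top _ _⟩
  have e : (⋂ t : ℝ, Set.Ioi t) = ∅ := by
    ext x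
    simp only [Set.mem_iInter, Set.mem_Ioi, Set.mem_empty_iff_false, iff_false, not_forall, not_lt]
    exact ⟨x, le_rfl⟩
  rw [e, measure_empty] at this
  exact (ENNReal.tendsto_toReal (by simp)).comp this

lemma tendsto_tail_atBot (h : IsHeavy f) : Tendsto (tail f) atBot (𝓝 1) := by
  have hp := h.prob
  have := tendsto_measure_iUnion_atBot (μ := law f) (s := fun t : ℝ => Set.Ioi t)
    (fun s t hst => Set.Ioi_subset_Ioi hst)
  have e : (⋃ t : ℝ, Set.Ioi t) = Set.univ := by
    ext x
    simp only [Set.mem_iUnion, Set.mem_Ioi, Set.mem_univ, iff_true]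
    exact ⟨x - 1, by linarith⟩
  rw [e, measure_univ] at this
  exact (ENNReal.tendsto_toReal (by simp)).comp this

/-- On the positive half-line this is the layer-cake formula for the positive part of the increment.
-/
lemma integrableOn_tail (h : IsHeavy f) (t : ℝ) : IntegrableOn (tail f) (Set.Ioi t) := by
  have hp := h.prob
  have h0 : IntegrableOn (tail f) (Set.Ioi 0) := by
    refine ⟨h.continuous_tail.aestronglyMeasurable, ?_⟩
    rw [hasFiniteIntegral_iff_ofReal (ae_of_all _ fun x => (h.tail_pos x).le)]
    have hpos : Integrable (fun x : ℝ => max x 0) (law f) := h.int.pos_part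
    have := lintegral_eq_lintegral_meas_lt (law f) (f := fun x : ℝ => max x 0)
      (ae_of_all _ fun x => le_max_right _ _) (by fun_prop)
    have hfin : ∫⁻ x, ENNReal.ofReal (max x 0) ∂(law f) < ∞ :=
      (hasFiniteIntegral_iff_ofReal (ae_of_all _ fun x => le_max_right _ _)).1 hpos.2
    rw [this] at hfin
    refine lt_of_le_of_lt (le_of_eq ?_) hfin
    refine setLIntegral_congr_fun measurableSet_Ioi fun t ht => ?_
    have e : {a : ℝ | t < max a 0} = Set.Ioi t := by
      ext a
      have : ¬ t < 0 := not_lt.2 (le_of_lt ht)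
      simp [this]
    rw [e, tail, ofReal_measureReal]
  rcases le_total 0 t with ht | ht
  · exact h0.mono_set (Set.Ioi_subset_Ioi ht)
  · rw [← Set.Ioc_union_Ioi_eq_Ioi ht]
    exact (h.continuous_tail.integrableOn_Ioc).union h0

lemma intTail_sub (h : IsHeavy f) (s t : ℝ) :
    intTail f s - intTail f t = ∫ x in s..t, tail f x := by
  rw [intTail, intTail, intervalIntegral.integral_Ioi_sub_Ioi' (h.integrableOn_tail s) (h.integrableOn_tail t)]

lemma intTail_sub_le (h : IsHeavy f) {s t : ℝ} (hst : s ≤ t) :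
    intTail f s - intTail f t ≤ (t - s) * tail f s := by
  rw [h.intTail_sub]
  calc ∫ x in s..t, tail f x ≤ ∫ _ in s..t, tail f s :=
        intervalIntegral.integral_mono_on hst (h.continuous_tail.intervalIntegrable _ _)
          (by simp) fun x hx => h.tail_antitone hx.1
    _ = _ := by simp

lemma le_intTail_sub (h : IsHeavy f) {s t : ℝ} (hst : s ≤ t) :
    (t - s) * tail f t ≤ intTail f s - intTail f t := by
  rw [h.intTail_sub]
  calc _ = ∫ _ in s..t, tail f t := by simp
    _ ≤ ∫ x in s..t, tail f x  :=
        intervalIntegral.integral_mono_on hst (by simp) (h.continuous_tail.intervalIntegrable _ _)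
          fun x hx => h.tail_antitone hx.2

lemma intTail_nonneg (h : IsHeavy f) (t : ℝ) : 0 ≤ intTail f t :=
  integral_nonneg fun x => (h.tail_pos x).le

lemma intTail_pos (h : IsHeavy f) (t : ℝ) : 0 < intTail f t := by
  have h1 := h.le_intTail_sub (s := t) (t := t + 1) (by linarith)
  have h2 := h.intTail_nonneg (t + 1)
  have h3 := h.tail_pos (t + 1)
  linarith

lemma intTail_antitone (h : IsHeavy f) : Antitone (intTail f) := fun s t hst => by
  have h1 := h.le_intTail_sub hst
  have := mul_nonneg (sub_nonneg.2 hst) (h.tail_pos t).le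
  linarith

lemma tendsto_intTail (h : IsHeavy f) : Tendsto (intTail f) atTop (𝓝 0) := by
  have h1 := intervalIntegral_tendsto_integral_Ioi 0 (h.integrableOn_tail 0) tendsto_id
  have e : intTail f = fun t => intTail f 0 - ∫ x in (0 : ℝ)..t, tail f x := by
    ext t; rw [← h.intTail_sub]; ring
  rw [e]
  simpa [intTail] using (tendsto_const_nhds (x := intTail f 0)).sub h1

/-- The convexity of the integrated tail. -/
lemma intTail_sub_ge (h : IsHeavy f) (t x : ℝ) : intTail f t + x * tail f t ≤ intTail f (t - x) := by
  rcases le_total 0 x with hx | hx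
  · have := h.le_intTail_sub (s := t - x) (t := t) (by linarith)
    rw [sub_sub_cancel] at this
    linarith
  · have := h.intTail_sub_le (s := t) (t := t - x) (by linarith)
    rw [sub_sub_cancel_left] at this
    linarith

lemma intTail_sub_le' (h : IsHeavy f) (t x : ℝ) :
    intTail f (t - x) ≤ intTail f t + x * tail f (t - x) := by
  have := h.intTail_sub_ge (t - x) (-x)
  rw [sub_neg_eq_add, sub_add_cancel] at this
  linarith

/-- The tangent of the convex function G² at t - x lies below it. The slope is taken at t - x and
not at t, which is why FG must be controlled over the whole range of regular jumps. -/
lemma sq_intTail_sub_le (h : IsHeavy f) (t x : ℝ) :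
    intTail f (t - x) ^ 2 ≤
      intTail f t ^ 2 + 2 * (x * (tail f (t - x) * intTail f (t - x))) := by
  have h1 := h.intTail_sub_le' t x
  have h2 := h.intTail_nonneg (t - x)
  nlinarith [sq_nonneg (intTail f (t - x) - intTail f t), h.intTail_nonneg t]

/-! ### The lower bound for the passage probability -/

/-- The subsolution is ε G at the positive part of the distance to the level. The constant is chosen
so that ε(G(0) + E|X|) ≤ 1. -/
lemma exists_mul_intTail_le_ruinProb (h : IsHeavy f) {Ω : Type*} [MeasurableSpace Ω] {P : Measure Ω}
    [IsProbabilityMeasure P] {X : ℕ → Ω → ℝ} (hX : ∀ n, Measurable (X n))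
    (hindep : iIndepFun X P) (hlaw : ∀ n, P.map (X n) = law f)
    (hint : Integrable (X 0) P) (hmean : ∫ ω, X 0 ω ∂P < 0) :
    ∃ ε > 0, ∀ b > 0, ε * intTail f b ≤ ruinProb P X b := by
  have hprob := h.prob
  set A := ∫ x, |x| ∂(law f) with hA
  have hA0 : 0 ≤ A := integral_nonneg fun x => abs_nonneg x
  set ε := 1 / (intTail f 0 + A + 1) with hε
  have hG0 := h.intTail_nonneg 0
  have hε0 : 0 < ε := by positivity
  have hεA : ε * (intTail f 0 + A) ≤ 1 := by
    rw [hε, one_div, inv_mul_le_one₀ (by positivity)]; linarith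
  refine ⟨ε, hε0, fun b hb => ?_⟩
  have hwalk := isChain_walk hX hindep h.meas hlaw
  have hfm : Measurable (Function.uncurry fun _ : ℝ => f) := h.meas.comp measurable_snd
  have hker : IsMarkovKernel (stepKernel fun _ : ℝ => f) :=
    isMarkovKernel_stepKernel hfm fun _ => lintegral_ofReal_density hprob
  have hGm : Measurable (intTail f) := h.intTail_antitone.measurable
  set g : ℝ → ℝ≥0∞ := fun y => ENNReal.ofReal (ε * intTail f (max (b - y) 0)) with hg
  have hgm : Measurable g := by
    refine ENNReal.measurable_ofReal.comp (measurable_const.mul (hGm.comp ?_))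
    fun_prop
  have key := hwalk.le_lintegral_hit hb.le hgm ?_ ?_
  · rw [← ofReal_ruinProb hX] at key
    simp only [hg, sub_zero, max_eq_left hb.le] at key
    exact (ENNReal.ofReal_le_ofReal_iff measureReal_nonneg).1 key
  · intro s hs
    set t := b - s with ht
    have ht0 : 0 ≤ t := by linarith
    have e1 : stepKernel (fun _ => f) s (Set.Ioi b) = ENNReal.ofReal (tail f t) := by
      have := lintegral_stepKernel hfm s (φ := (Set.Ioi b).indicator 1)
        (measurable_one.indicator measurableSet_Ioi)
      rw [lintegral_indicator_one measurableSet_Ioi] at this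
      have hm : Measurable fun x => (Set.Ioi b).indicator (1 : ℝ → ℝ≥0∞) (s + x) :=
        (measurable_one.indicator measurableSet_Ioi).comp (measurable_const.add measurable_id)
      rw [this, ← lintegral_law h.meas hm, tail, ofReal_measureReal, ← lintegral_indicator_one measurableSet_Ioi]
      refine lintegral_congr fun x => ?_
      by_cases hx : t < x
      · have : b < s + x := by linarith
        simp [hx, this]
      · have : ¬ b < s + x := by linarith
        simp [hx, this]
    have e2 : ∫⁻ y in Set.Iic b, g y ∂(stepKernel (fun _ => f) s) =
        ∫⁻ x in Set.Iic t, ENNReal.ofReal (ε * intTail f (t - x)) ∂(law f) := by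
      rw [← lintegral_indicator measurableSet_Iic, ← lintegral_indicator measurableSet_Iic,
        lintegral_stepKernel hfm s (hgm.indicator measurableSet_Iic), lintegral_law h.meas]
      · refine lintegral_congr fun x => ?_
        by_cases hx : x ≤ t
        · have h1 : s + x ≤ b := by linarith
          have h2 : max (b - (s + x)) 0 = t - x := by
            rw [max_eq_left (by linarith), ht]; ring
          simp only [Set.mem_Iic, h1, Set.indicator_of_mem, hg, h2, hx]
        · have : ¬ s + x ≤ b := by linarith
          simp [hx, this]
      · exact (ENNReal.measurable_ofReal.comp (measurable_const.mul
          (hGm.comp (measurable_const.sub measurable_id)))).indicator measurableSet_Iic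
    rw [e1, e2]
    have hi1 : IntegrableOn (fun x : ℝ => intTail f t + x * tail f t) (Set.Iic t) (law f) :=
      ((integrable_const _).add (h.int.mul_const _)).integrableOn
    have h3 : ENNReal.ofReal (∫ x in Set.Iic t, ε * (intTail f t + x * tail f t) ∂(law f)) ≤
        ∫⁻ x in Set.Iic t, ENNReal.ofReal (ε * intTail f (t - x)) ∂(law f) := by
      refine (ofReal_integral_le_lintegral (hi1.const_mul ε)).trans (lintegral_mono fun x => ?_)
      exact ENNReal.ofReal_le_ofReal (mul_le_mul_of_nonneg_left (h.intTail_sub_ge t x) hε0.le)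
    refine le_trans ?_ (add_le_add_right h3 _)
    rw [integral_const_mul, integral_add (integrable_const _) (h.int.mul_const _).integrableOn,
      integral_mul_const, integral_const, smul_eq_mul, measureReal_restrict_apply MeasurableSet.univ,
      Set.univ_inter, h.real_Iic]
    refine le_trans (ENNReal.ofReal_le_ofReal ?_) ENNReal.ofReal_add_le
    have h4 : -A ≤ ∫ x in Set.Iic t, x ∂(law f) := by
      have h5 : ∫ x in Set.Iic t, |x| ∂(law f) ≤ A :=
        setIntegral_le_integral h.int.abs (ae_of_all _ fun x => abs_nonneg x)
      have h6 := abs_integral_le_integral_abs (f := fun x : ℝ => x) (μ := (law f).restrict (Set.Iic t))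
      linarith [neg_abs_le (∫ x in Set.Iic t, x ∂(law f))]
    have h7 := h.intTail_antitone ht0
    have h8 := h.tail_pos t
    -- With the tangent line of G inserted, the subsolution inequality is exactly the nonnegativity
    -- of this product.
    have h9 : 0 ≤ tail f t * (1 - ε * intTail f t + ε * ∫ x in Set.Iic t, x ∂(law f)) := by
      refine mul_nonneg h8.le ?_
      nlinarith
    rw [max_eq_left ht0]
    nlinarith
  -- The strong law sends the walk to -∞, so the distance to the level tends to ∞ and G of it to 0;
  -- the constant ε G(0) dominates.
  · have hid : ∀ i, IdentDistrib (X i) (X 0) P P := fun i =>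
      ⟨(hX i).aemeasurable, (hX 0).aemeasurable, by rw [hlaw, hlaw]⟩
    have hslln := strong_law_ae_real X hint (fun i j hij => hindep.indepFun hij) hid
    have hbot : ∀ᵐ ω ∂P, Tendsto (walk X ω) atTop atBot := by
      filter_upwards [hslln] with ω hω
      have h1 := hω.neg_mul_atTop hmean tendsto_natCast_atTop_atTop
      refine h1.congr' ?_
      filter_upwards [eventually_gt_atTop 0] with n hn
      have : (n : ℝ) ≠ 0 := by positivity
      rw [div_mul_cancel₀ _ this, walk]
    have := tendsto_lintegral_of_dominated_convergence (μ := P)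
      (F := fun n ω => g (walk X ω n)) (f := fun _ => 0)
      (fun _ => ENNReal.ofReal (ε * intTail f 0)) (fun n => hgm.comp (hwalk.measurable n))
      (fun n => ae_of_all _ fun ω => ENNReal.ofReal_le_ofReal
        (mul_le_mul_of_nonneg_left (h.intTail_antitone (le_max_right _ _)) hε0.le))
      (by simp) ?_
    · simpa using this
    · filter_upwards [hbot] with ω hω
      have h1 : Tendsto (fun n => max (b - walk X ω n) 0) atTop atTop :=
        tendsto_atTop_mono (fun n => le_max_left _ _)
          (tendsto_atTop_add_const_left _ b (tendsto_neg_atBot_atTop.comp hω))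
      have h2 := ((h.tendsto_intTail.comp h1).const_mul ε)
      have h3 := (ENNReal.continuous_ofReal.tendsto _).comp h2
      rw [mul_zero, ENNReal.ofReal_zero] at h3
      exact h3

end IsHeavy

end

section

namespace IsHeavy

variable {f : ℝ → ℝ}

/-! ### The cumulative hazard function -/

lemma tail_eq_exp (h : IsHeavy f) (t : ℝ) : tail f t = Real.exp (-cumHaz f t) := by
  rw [cumHaz, neg_neg, Real.exp_log (h.tail_pos t)]

lemma cumHaz_mono (h : IsHeavy f) : Monotone (cumHaz f) := fun _ t hst =>
  neg_le_neg (Real.log_le_log (h.tail_pos t) (h.tail_antitone hst))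

lemma continuous_cumHaz (h : IsHeavy f) : Continuous (cumHaz f) :=
  (h.continuous_tail.log fun t => (h.tail_pos t).ne').neg

lemma tendsto_cumHaz (h : IsHeavy f) : Tendsto (cumHaz f) atTop atTop := by
  refine tendsto_neg_atBot_atTop.comp (Real.tendsto_log_nhdsGT_zero.comp ?_)
  exact tendsto_nhdsWithin_iff.2 ⟨h.tendsto_tail, Eventually.of_forall h.tail_pos⟩

lemma tendsto_cumHaz_atBot (h : IsHeavy f) : Tendsto (cumHaz f) atBot (𝓝 0) := by
  have := ((Real.continuousAt_log one_ne_zero).tendsto.comp h.tendsto_tail_atBot).neg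
  rw [Real.log_one, neg_zero] at this
  exact this

/-- Positivity of `y` bounds the set from below, since Λ tends to 0 at -∞. For `y ≤ 0` the set is
the whole line, its `sInf` is 0 by default, and the equivalence fails. -/
lemma cumHazInv_le_iff (h : IsHeavy f) {y : ℝ} (hy : 0 < y) (x : ℝ) :
    cumHazInv f y ≤ x ↔ y ≤ cumHaz f x := by
  have hne : {x | y ≤ cumHaz f x}.Nonempty := (h.tendsto_cumHaz.eventually_ge_atTop y).exists
  have hbdd : BddBelow {x | y ≤ cumHaz f x} := by
    obtain ⟨a, ha⟩ := (h.tendsto_cumHaz_atBot.eventually_lt_const hy).exists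
    refine ⟨a, fun x hx => ?_⟩
    by_contra! hlt
    have h1 : y ≤ cumHaz f x := hx
    exact absurd (h1.trans (h.cumHaz_mono hlt.le)) (not_le.2 ha)
  have hcl : IsClosed {x | y ≤ cumHaz f x} := isClosed_le continuous_const h.continuous_cumHaz
  constructor
  · intro hx
    have h1 : y ≤ cumHaz f (cumHazInv f y) := hcl.csInf_mem hne hbdd
    exact h1.trans (h.cumHaz_mono hx)
  · intro hx
    exact csInf_le hbdd hx

lemma cumHaz_cumHazInv (h : IsHeavy f) {y : ℝ} (hy : 0 < y) : cumHaz f (cumHazInv f y) = y := by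
  refine le_antisymm ?_ ((h.cumHazInv_le_iff hy _).1 le_rfl)
  refine le_of_tendsto (h.continuous_cumHaz.continuousWithinAt (s := Set.Iio (cumHazInv f y))) ?_
  filter_upwards [self_mem_nhdsWithin] with x hx
  by_contra! hlt
  exact absurd ((h.cumHazInv_le_iff hy x).2 hlt.le) (not_le.2 hx)

lemma measurable_cumHazInv (h : IsHeavy f) : Measurable (cumHazInv f) := by
  refine measurable_of_Iic fun x => ?_
  have : cumHazInv f ⁻¹' Set.Iic x = (Set.Ioi 0 ∩ Set.Iic (cumHaz f x)) ∪
      (Set.Iic 0 ∩ {_y : ℝ | (0 : ℝ) ≤ x}) := by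
    ext y
    rcases lt_or_ge 0 y with hy | hy
    · simp [hy, h.cumHazInv_le_iff hy]
    · have h1 : {x | y ≤ cumHaz f x} = Set.univ := by
        ext z
        simp only [Set.mem_univ, iff_true]
        have : 0 ≤ cumHaz f z :=
          neg_nonneg.2 (Real.log_nonpos (h.tail_pos z).le (h.tail_le_one z))
        exact hy.trans this
      have h2 : cumHazInv f y = 0 := by rw [cumHazInv, h1, Real.sInf_univ]
      simp [h2, hy, not_lt.2 hy]
  rw [this]
  exact (measurableSet_Ioi.inter measurableSet_Iic).union (measurableSet_Iic.inter (.const _))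

lemma measurable_shiftedInv (h : IsHeavy f) (a : ℝ) :
    Measurable fun t => cumHazInv f (cumHaz f t - a) :=
  h.measurable_cumHazInv.comp (h.cumHaz_mono.measurable.sub_const a)

lemma tail_cumHazInv (h : IsHeavy f) {a t : ℝ} (ha : a < cumHaz f t) :
    tail f (cumHazInv f (cumHaz f t - a)) = Real.exp a * tail f t := by
  rw [h.tail_eq_exp, h.cumHaz_cumHazInv (sub_pos.2 ha), h.tail_eq_exp, ← Real.exp_add]
  ring_nf

lemma cumHazInv_le (h : IsHeavy f) {a t : ℝ} (ha0 : 0 ≤ a) (ha : a < cumHaz f t) :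
    cumHazInv f (cumHaz f t - a) ≤ t :=
  (h.cumHazInv_le_iff (sub_pos.2 ha) t).2 (by linarith)

lemma lt_cumHazInv (h : IsHeavy f) {a t x : ℝ} (ha : a < cumHaz f t)
    (hx : Real.exp a * tail f t < tail f x) : x < cumHazInv f (cumHaz f t - a) := by
  by_contra! hlt
  have := h.tail_antitone hlt
  rw [h.tail_cumHazInv ha] at this
  linarith

/-! ### The mixture density -/

/-- The maximum makes the formula valid for endpoints in any order. Cut points may be out of order
for small t, and joint measurability of the density is needed for all t. -/
lemma real_Ioc (h : IsHeavy f) (s t : ℝ) :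
    (law f).real (Set.Ioc s t) = max (tail f s - tail f t) 0 := by
  rcases le_total s t with hst | hst
  · rw [← h.tail_sub hst, max_eq_left (sub_nonneg.2 (h.tail_antitone hst))]
  · rw [Set.Ioc_eq_empty (not_lt.2 hst), measureReal_empty,
      max_eq_right (sub_nonpos.2 (h.tail_antitone hst))]

lemma measurable_mixture (h : IsHeavy f) (k : ℕ) {c : ℝ → ℕ → ℝ}
    (hc : ∀ j, Measurable fun t => c t j) {p₁ p₂ p₃ : ℝ → ℝ} (h1 : Measurable p₁)
    (h2 : Measurable p₂) (h3 : Measurable p₃) :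
    Measurable fun z : ℝ × ℝ => mixture f k (c z.1) (p₁ z.1) (p₂ z.1) (fun _ => p₃ z.1) z.1 z.2 := by
  have hT : Measurable (tail f) := h.tail_antitone.measurable
  have hcm : ∀ j, Measurable fun z : ℝ × ℝ => c z.1 j := fun j => (hc j).comp measurable_fst
  have hf2 : Measurable fun z : ℝ × ℝ => f z.2 := h.meas.comp measurable_snd
  have hft : Measurable fun z : ℝ × ℝ => f (z.1 - z.2) :=
    h.meas.comp (measurable_fst.sub measurable_snd)
  have hIoc : ∀ i j (u : ℝ → ℝ → ℝ), (Measurable fun z : ℝ × ℝ => u z.1 z.2) →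
      Measurable fun z : ℝ × ℝ => (Set.Ioc (c z.1 i) (c z.1 j)).indicator (u z.1) z.2 := by
    intro i j u hu
    have := hu.indicator ((measurableSet_lt (hcm i) measurable_snd).inter
      (measurableSet_le measurable_snd (hcm j)))
    convert this using 2
    rfl
  have m0 : Measurable fun z : ℝ × ℝ => (Set.Iic (c z.1 0)).indicator f z.2 := by
    have := hf2.indicator (measurableSet_le measurable_snd (hcm 0))
    convert this using 2
    rfl
  have mk : Measurable fun z : ℝ × ℝ => (Set.Ioi (c z.1 k)).indicator f z.2 := by
    have := hf2.indicator (measurableSet_lt (hcm k) measurable_snd)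
    convert this using 2
    rfl
  simp only [mixture, h.real_Iic, h.real_Ioc]
  refine (((h1.comp measurable_fst).mul (m0.div ?_)).add
    ((h2.comp measurable_fst).mul (mk.div ?_)) |>.add ?_).add ?_
  · exact measurable_const.sub (hT.comp (hcm 0))
  · exact hT.comp (hcm k)
  · refine Finset.measurable_fun_sum _ fun j _ => (h3.comp measurable_fst).mul (Measurable.div ?_ ?_)
    · exact hIoc _ _ (fun _ => f) hf2
    · exact ((hT.comp (hcm _)).sub (hT.comp (hcm _))).max measurable_const
  · split_ifs
    · exact measurable_const
    · refine (h3.comp measurable_fst).mul (Measurable.div ?_ ?_)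
      · exact hIoc _ _ (fun t y => f (t - y)) hft
      · exact ((hT.comp (measurable_fst.sub (hcm _))).sub
          (hT.comp (measurable_fst.sub (hcm _)))).max measurable_const

lemma lintegral_reflected (h : IsHeavy f) (t : ℝ) {c d : ℝ} :
    ∫⁻ x in Set.Ioc c d, ENNReal.ofReal (f (t - x)) =
      ENNReal.ofReal ((law f).real (Set.Ioc (t - d) (t - c))) := by
  -- Reflection exchanges the open and the closed end of the interval, which is harmless because
  -- points are null sets.
  have := h.prob
  rw [ofReal_measureReal, law, withDensity_apply _ measurableSet_Ioc,
    ← setLIntegral_congr (Ico_ae_eq_Ioc (μ := volume)), ← lintegral_indicator measurableSet_Ico,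
    ← lintegral_indicator measurableSet_Ioc]
  conv_rhs => rw [← lintegral_sub_left_eq_self _ t]
  refine lintegral_congr fun x => ?_
  by_cases hx : x ∈ Set.Ico c d
  · have : t - x ∈ Set.Ioc (t - d) (t - c) := ⟨by linarith [hx.2], by linarith [hx.1]⟩
    simp only [hx, this, Set.indicator_of_mem]
  · have : t - x ∉ Set.Ioc (t - d) (t - c) := fun h' => hx ⟨by linarith [h'.2], by linarith [h'.1]⟩
    simp only [hx, this, not_false_eq_true, Set.indicator_of_notMem]

lemma lintegral_mul_component (h : IsHeavy f) {φ : ℝ → ℝ≥0∞} (hφ : Measurable φ) {A : Set ℝ}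
    (hA : MeasurableSet A) {p r : ℝ} (hp : 0 ≤ p) (hr : 0 ≤ r) :
    ∫⁻ x, φ x * ENNReal.ofReal (p * (A.indicator f x / r)) =
      ENNReal.ofReal (p / r) * ∫⁻ x in A, φ x ∂(law f) := by
  rw [← lintegral_indicator hA, lintegral_law h.meas (hφ.indicator hA), ← lintegral_const_mul]
  · refine lintegral_congr fun x => ?_
    by_cases hx : x ∈ A
    · simp only [hx, Set.indicator_of_mem]
      rw [mul_div_assoc', mul_div_right_comm, ENNReal.ofReal_mul (div_nonneg hp hr)]
      ring
    · simp [hx]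
  · exact (hφ.indicator hA).mul (ENNReal.measurable_ofReal.comp h.meas)

/-- Integrals against the mixture density. -/
lemma lintegral_mul_mixture (h : IsHeavy f) {φ : ℝ → ℝ≥0∞} (hφ : Measurable φ) (k : ℕ) (c : ℕ → ℝ)
    {p₁ p₂ p₃ : ℝ} (h1 : 0 ≤ p₁) (h2 : 0 ≤ p₂) (h3 : 0 ≤ p₃) (t : ℝ) :
    ∫⁻ x, φ x * ENNReal.ofReal (mixture f k c p₁ p₂ (fun _ => p₃) t x) =
      ENNReal.ofReal (p₁ / (1 - tail f (c 0))) * ∫⁻ x in Set.Iic (c 0), φ x ∂(law f) +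
      ENNReal.ofReal (p₂ / tail f (c k)) * ∫⁻ x in Set.Ioi (c k), φ x ∂(law f) +
      ∑ j ∈ Finset.Ico 1 k, ENNReal.ofReal (p₃ / (law f).real (Set.Ioc (c (j - 1)) (c j))) *
        ∫⁻ x in Set.Ioc (c (j - 1)) (c j), φ x ∂(law f) +
      if k = 0 then 0 else
        ENNReal.ofReal (p₃ / (law f).real (Set.Ioc (t - c k) (t - c (k - 1)))) *
          ∫⁻ x in Set.Ioc (c (k - 1)) (c k), φ x * ENNReal.ofReal (f (t - x)) := by
  have hi : ∀ (A : Set ℝ) (u : ℝ → ℝ) x, (∀ x, 0 ≤ u x) → 0 ≤ A.indicator u x := fun A u x hu =>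
    Set.indicator_nonneg (fun x _ => hu x) x
  have hft : ∀ x, 0 ≤ f (t - x) := fun x => h.nonneg _
  have n1 : ∀ x, 0 ≤ p₁ * ((Set.Iic (c 0)).indicator f x / (law f).real (Set.Iic (c 0))) := fun x =>
    mul_nonneg h1 (div_nonneg (hi _ _ _ h.nonneg) measureReal_nonneg)
  have n2 : ∀ x, 0 ≤ p₂ * ((Set.Ioi (c k)).indicator f x / (law f).real (Set.Ioi (c k))) := fun x =>
    mul_nonneg h2 (div_nonneg (hi _ _ _ h.nonneg) measureReal_nonneg)
  have n3 : ∀ x j, 0 ≤ p₃ * ((Set.Ioc (c (j - 1)) (c j)).indicator f x /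
      (law f).real (Set.Ioc (c (j - 1)) (c j))) := fun x j =>
    mul_nonneg h3 (div_nonneg (hi _ _ _ h.nonneg) measureReal_nonneg)
  have n4 : ∀ x, 0 ≤ if k = 0 then 0 else p₃ *
      ((Set.Ioc (c (k - 1)) (c k)).indicator (fun y => f (t - y)) x /
      (law f).real (Set.Ioc (t - c k) (t - c (k - 1)))) := fun x => by
    split_ifs
    · exact le_rfl
    · exact mul_nonneg h3 (div_nonneg (hi _ _ _ hft) measureReal_nonneg)
  have hI : ∀ A : Set ℝ, MeasurableSet A → Measurable (A.indicator f) := fun A hA =>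
    h.meas.indicator hA
  have mc : ∀ (A : Set ℝ) (p r : ℝ), MeasurableSet A →
      Measurable fun x => φ x * ENNReal.ofReal (p * (A.indicator f x / r)) := fun A p r hA =>
    hφ.mul (ENNReal.measurable_ofReal.comp (((hI A hA).div_const r).const_mul p))
  have hsplit : ∀ x, φ x * ENNReal.ofReal (mixture f k c p₁ p₂ (fun _ => p₃) t x) =
      φ x * ENNReal.ofReal (p₁ * ((Set.Iic (c 0)).indicator f x / (law f).real (Set.Iic (c 0)))) +
      φ x * ENNReal.ofReal (p₂ * ((Set.Ioi (c k)).indicator f x / (law f).real (Set.Ioi (c k)))) +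
      ∑ j ∈ Finset.Ico 1 k, φ x * ENNReal.ofReal (p₃ * ((Set.Ioc (c (j - 1)) (c j)).indicator f x /
        (law f).real (Set.Ioc (c (j - 1)) (c j)))) +
      φ x * ENNReal.ofReal (if k = 0 then 0 else p₃ *
        ((Set.Ioc (c (k - 1)) (c k)).indicator (fun y => f (t - y)) x /
        (law f).real (Set.Ioc (t - c k) (t - c (k - 1))))) := by
    intro x
    rw [mixture, ENNReal.ofReal_add _ (n4 x), ENNReal.ofReal_add _ (Finset.sum_nonneg fun j _ => n3 x j),
      ENNReal.ofReal_add (n1 x) (n2 x), ENNReal.ofReal_sum_of_nonneg fun j _ => n3 x j, mul_add, mul_add, mul_add,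
      Finset.mul_sum]
    · exact add_nonneg (n1 x) (n2 x)
    · exact add_nonneg (add_nonneg (n1 x) (n2 x)) (Finset.sum_nonneg fun j _ => n3 x j)
  simp only [hsplit]
  rw [lintegral_add_left, lintegral_add_left, lintegral_add_left, lintegral_finsetSum,
    h.lintegral_mul_component hφ measurableSet_Iic h1 measureReal_nonneg,
    h.lintegral_mul_component hφ measurableSet_Ioi h2 measureReal_nonneg, h.real_Iic]
  · congr 1
    · congr 1
      exact Finset.sum_congr rfl fun j _ =>
        h.lintegral_mul_component hφ measurableSet_Ioc h3 measureReal_nonneg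
    · split_ifs
      · simp
      · rw [← lintegral_indicator measurableSet_Ioc, ← lintegral_const_mul]
        · refine lintegral_congr fun x => ?_
          by_cases hx : x ∈ Set.Ioc (c (k - 1)) (c k)
          · simp only [hx, Set.indicator_of_mem]
            rw [mul_div_assoc', mul_div_right_comm,
              ENNReal.ofReal_mul (div_nonneg h3 measureReal_nonneg)]
            ring
          · simp [hx]
        · exact (hφ.mul (ENNReal.measurable_ofReal.comp
            (h.meas.comp (measurable_const.sub measurable_id)))).indicator measurableSet_Ioc
  · exact fun j _ => mc _ _ _ measurableSet_Ioc
  · exact mc _ _ _ measurableSet_Iic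
  · exact (mc _ _ _ measurableSet_Iic).add (mc _ _ _ measurableSet_Ioi)
  · exact ((mc _ _ _ measurableSet_Iic).add (mc _ _ _ measurableSet_Ioi)).add
      (Finset.measurable_fun_sum _ fun j _ => mc _ _ _ measurableSet_Ioc)

end IsHeavy

end

section

/-! ### Long-tailed distributions -/

/-- The right tail is asymptotically invariant under shifts. -/
def LongTailed (f : ℝ → ℝ) : Prop :=
  ∀ x, Tendsto (fun t => tail f (t - x) / tail f t) atTop (𝓝 1)

namespace IsHeavy

variable {f : ℝ → ℝ}

lemma longTailed_of_nonneg
    (hL : ∀ x ≥ 0, Tendsto (fun t => tail f (t - x) / tail f t) atTop (𝓝 1)) : LongTailed f := by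
  intro x
  rcases le_total 0 x with hx | hx
  · exact hL x hx
  · have h1 := (hL (-x) (by linarith)).comp (tendsto_atTop_add_const_right atTop (-x) tendsto_id)
    have h2 := h1.inv₀ one_ne_zero
    rw [inv_one] at h2
    refine h2.congr fun t => ?_
    simp only [Function.comp_apply, id_eq, inv_div, add_sub_cancel_right]
    rw [sub_eq_add_neg]

/-- For every fixed M, G(t) ≥ M F(t + M), and F(t + M) ≥ F(t)/2 eventually, so G dominates every
multiple of F. -/
lemma tendsto_ratio (h : IsHeavy f) (hL : LongTailed f) :
    Tendsto (fun t => tail f t / intTail f t) atTop (𝓝 0) := by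
  rw [Metric.tendsto_atTop]
  intro ε hε
  set M := 4 / ε with hM
  have hM0 : 0 < M := by positivity
  have h1 := (hL (-M)).eventually_const_le (show (1 / 2 : ℝ) < 1 by norm_num)
  obtain ⟨T, hT⟩ := eventually_atTop.1 h1
  refine ⟨T, fun t ht => ?_⟩
  have h2 := hT t ht
  have hF := h.tail_pos t
  have hG := h.intTail_pos t
  rw [sub_neg_eq_add, le_div_iff₀ hF] at h2
  have h3 := h.le_intTail_sub (s := t) (t := t + M) (by linarith)
  have h4 := h.intTail_nonneg (t + M)
  rw [add_sub_cancel_left] at h3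
  rw [Real.dist_eq, sub_zero, abs_of_pos (by positivity), div_lt_iff₀ hG]
  have h5 : M * (1 / 2 * tail f t) ≤ intTail f t := by nlinarith
  have h6 : M * ε = 4 := by rw [hM]; field_simp
  nlinarith

/-- The ratio of the values of G is squeezed between 1 + x r and 1 + x r F(t - x)/F(t) by convexity,
and r → 0. -/
lemma tendsto_weight_ratio (h : IsHeavy f) (hL : LongTailed f) (x : ℝ) :
    Tendsto (fun t => tail f (t - x) * intTail f (t - x) / (tail f t * intTail f t)) atTop
      (𝓝 1) := by
  have hr := h.tendsto_ratio hL
  have hG : Tendsto (fun t => intTail f (t - x) / intTail f t) atTop (𝓝 1) := by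
    have l1 : Tendsto (fun t => 1 + x * (tail f t / intTail f t)) atTop (𝓝 1) := by
      simpa using (hr.const_mul x).const_add 1
    have l2 : Tendsto (fun t => 1 + x * ((tail f (t - x) / tail f t) * (tail f t / intTail f t)))
        atTop (𝓝 1) := by
      simpa using (((hL x).mul hr).const_mul x).const_add 1
    refine tendsto_of_tendsto_of_tendsto_of_le_of_le l1 l2 (fun t => ?_) (fun t => ?_)
    · have hG := h.intTail_pos t
      have := h.intTail_sub_ge t x
      simp only
      rw [le_div_iff₀ hG, add_mul, one_mul, mul_assoc, div_mul_cancel₀ _ hG.ne']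
      exact this
    · have hG := h.intTail_pos t
      have hF := h.tail_pos t
      have := h.intTail_sub_le' t x
      simp only
      rw [div_le_iff₀ hG, add_mul, one_mul, div_mul_div_cancel₀ hF.ne', mul_assoc, div_mul_cancel₀ _ hG.ne']
      exact this
  have := (hL x).mul hG
  rw [one_mul] at this
  exact this.congr fun t => by rw [div_mul_div_comm]

/-- Dominated convergence: FG is non-increasing, so over x ≤ c(t) the weight is largest at c(t),
where `hC` bounds it; for fixed x the weight tends to 1. -/
lemma tendsto_regular_part (h : IsHeavy f) (hL : LongTailed f) {c : ℝ → ℝ}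
    (hc : Tendsto c atTop atTop) {C : ℝ}
    (hC : ∀ᶠ t in atTop, tail f (t - c t) * intTail f (t - c t) ≤ C * (tail f t * intTail f t)) :
    Tendsto (fun t => ∫ x in Set.Iic (c t),
      x * (tail f (t - x) * intTail f (t - x) / (tail f t * intTail f t)) ∂(law f)) atTop
      (𝓝 (mean f)) := by
  have hW : ∀ t, 0 < tail f t * intTail f t := fun t => mul_pos (h.tail_pos t) (h.intTail_pos t)
  have hWa : ∀ {s t}, s ≤ t → tail f t * intTail f t ≤ tail f s * intTail f s := fun hst =>
    mul_le_mul (h.tail_antitone hst) (h.intTail_antitone hst) (h.intTail_nonneg _) (h.tail_pos _).le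
  have hWm : Measurable fun t => tail f t * intTail f t :=
    h.tail_antitone.measurable.mul h.intTail_antitone.measurable
  simp only [← integral_indicator measurableSet_Iic]
  refine tendsto_integral_filter_of_dominated_convergence (fun x => max C 1 * |x|) ?_ ?_
    (h.int.abs.const_mul _) ?_
  · refine Eventually.of_forall fun t => Measurable.aestronglyMeasurable ?_
    refine Measurable.indicator ?_ measurableSet_Iic
    exact measurable_id.mul ((hWm.comp (measurable_const.sub measurable_id)).div_const _)
  · filter_upwards [hC, hc.eventually_ge_atTop 0] with t ht ht0
    refine ae_of_all _ fun x => ?_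
    by_cases hx : x ≤ c t
    · simp only [Set.mem_Iic, hx, Set.indicator_of_mem]
      rw [norm_mul, mul_comm, Real.norm_eq_abs, Real.norm_eq_abs, abs_of_pos (div_pos (hW _) (hW _))]
      refine mul_le_mul_of_nonneg_right ?_ (abs_nonneg x)
      rw [div_le_iff₀ (hW t)]
      calc _ ≤ tail f (t - c t) * intTail f (t - c t) := hWa (by linarith)
        _ ≤ _ := ht.trans (mul_le_mul_of_nonneg_right (le_max_left _ _) (hW t).le)
    · simp only [Set.mem_Iic, hx, not_false_eq_true, Set.indicator_of_notMem, norm_zero]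
      positivity
  · refine ae_of_all _ fun x => ?_
    have h1 := (h.tendsto_weight_ratio hL x).const_mul x
    rw [mul_one] at h1
    refine h1.congr' ?_
    filter_upwards [hc.eventually_ge_atTop x] with t ht
    simp [ht]

lemma tendsto_neg_part (h : IsHeavy f) {c : ℝ → ℝ} (hc : Tendsto c atTop atTop) :
    Tendsto (fun t => ∫ x in Set.Iic (c t), -x ∂(law f)) atTop (𝓝 (-mean f)) := by
  simp only [← integral_indicator measurableSet_Iic]
  rw [mean, ← integral_neg]
  refine tendsto_integral_filter_of_dominated_convergence (fun x => |x|) ?_ ?_ h.int.abs ?_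
  · exact Eventually.of_forall fun t => (measurable_neg.indicator measurableSet_Iic).aestronglyMeasurable
  · refine Eventually.of_forall fun t => ae_of_all _ fun x => ?_
    refine (norm_indicator_le_norm_self (fun x : ℝ => -x) x).trans ?_
    simp
  · refine ae_of_all _ fun x => tendsto_const_nhds.congr' ?_
    filter_upwards [hc.eventually_ge_atTop x] with t ht
    simp [ht]

/-- The second moment of the integrated tail over the regular jumps. -/
lemma eventually_sq_intTail_le (h : IsHeavy f) (hL : LongTailed f) {c : ℝ → ℝ}
    (hc : Tendsto c atTop atTop) {C : ℝ}
    (hC : ∀ᶠ t in atTop, tail f (t - c t) * intTail f (t - c t) ≤ C * (tail f t * intTail f t))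
    {η : ℝ} (hη : 0 < η) :
    ∀ᶠ t in atTop, ∫⁻ x in Set.Iic (c t), ENNReal.ofReal (intTail f (t - x) ^ 2) ∂(law f) ≤
      ENNReal.ofReal (intTail f t ^ 2 * (1 + 2 * (tail f t / intTail f t) * (mean f + η))) := by
  have hp := h.prob
  filter_upwards [(h.tendsto_regular_part hL hc hC).eventually_le_const
    (show mean f < mean f + η by linarith)] with t ht
  have hF := h.tail_pos t
  have hG := h.intTail_pos t
  have hm : Measurable fun x => intTail f (t - x) :=
    h.intTail_antitone.measurable.comp (measurable_const.sub measurable_id)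
  have hmF : Measurable fun x => tail f (t - x) :=
    h.tail_antitone.measurable.comp (measurable_const.sub measurable_id)
  have hb : ∀ x ∈ Set.Iic (c t), tail f (t - x) * intTail f (t - x) ≤
      tail f (t - c t) * intTail f (t - c t) := fun x hx =>
    mul_le_mul (h.tail_antitone (by linarith [Set.mem_Iic.1 hx]))
      (h.intTail_antitone (by linarith [Set.mem_Iic.1 hx])) (h.intTail_nonneg _) (h.tail_pos _).le
  have hi0 : IntegrableOn (fun x => x * (tail f (t - x) * intTail f (t - x)))
      (Set.Iic (c t)) (law f) := by
    refine Integrable.mono' (h.int.abs.integrableOn.mul_const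
      (tail f (t - c t) * intTail f (t - c t)))
      (measurable_id.mul (hmF.mul hm)).aestronglyMeasurable ?_
    refine (ae_restrict_iff' measurableSet_Iic).2 (ae_of_all _ fun x hx => ?_)
    rw [norm_mul, Real.norm_eq_abs, Real.norm_of_nonneg
      (mul_nonneg (h.tail_pos _).le (h.intTail_nonneg _))]
    exact mul_le_mul_of_nonneg_left (hb x hx) (abs_nonneg x)
  have hi1 : IntegrableOn (fun x => intTail f t ^ 2 +
      2 * (x * (tail f (t - x) * intTail f (t - x)))) (Set.Iic (c t)) (law f) :=
    (integrable_const _).add (hi0.const_mul 2)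
  calc ∫⁻ x in Set.Iic (c t), ENNReal.ofReal (intTail f (t - x) ^ 2) ∂(law f)
      ≤ ∫⁻ x in Set.Iic (c t), ENNReal.ofReal (intTail f t ^ 2 +
        2 * (x * (tail f (t - x) * intTail f (t - x)))) ∂(law f) :=
        lintegral_mono fun x => ENNReal.ofReal_le_ofReal (h.sq_intTail_sub_le t x)
    _ = ENNReal.ofReal (∫ x in Set.Iic (c t), intTail f t ^ 2 +
        2 * (x * (tail f (t - x) * intTail f (t - x))) ∂(law f)) := by
        rw [ofReal_integral_eq_lintegral_ofReal hi1]
        exact ae_of_all _ fun x => (sq_nonneg _).trans (h.sq_intTail_sub_le t x)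
    _ ≤ _ := by
        refine ENNReal.ofReal_le_ofReal ?_
        rw [integral_add (integrable_const _) (hi0.const_mul 2), integral_const, smul_eq_mul,
          integral_const_mul, measureReal_restrict_apply MeasurableSet.univ, Set.univ_inter]
        have e : ∫ x in Set.Iic (c t), x * (tail f (t - x) * intTail f (t - x)) ∂(law f) =
            (tail f t * intTail f t) * ∫ x in Set.Iic (c t),
              x * (tail f (t - x) * intTail f (t - x) / (tail f t * intTail f t)) ∂(law f) := by
          rw [← integral_const_mul]
          refine integral_congr_ae (ae_of_all _ fun x => ?_)
          field_simp
        rw [e]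
        have h1 : (law f).real (Set.Iic (c t)) ≤ 1 := measureReal_le_one
        have h2 : intTail f t ^ 2 * (1 + 2 * (tail f t / intTail f t) * (mean f + η)) =
            intTail f t ^ 2 + 2 * (tail f t * intTail f t * (mean f + η)) := by
          field_simp
        rw [h2]
        have h3 := mul_le_mul_of_nonneg_left ht (mul_pos hF hG).le
        nlinarith [sq_nonneg (intTail f t)]

end IsHeavy

end

section

/-! ### Validity of the sampling scheme -/

/-- The cut points `c` give a mixture of probability densities at distance `t`. -/
structure ValidCuts (f : ℝ → ℝ) (k : ℕ) (c : ℕ → ℝ) (a t : ℝ) : Prop where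
  cut_nonneg : ∀ j ≤ k, 0 ≤ c j
  reg_le : c 0 ≤ t
  half_le : 1 / 2 ≤ 1 - tail f (c 0)
  big : tail f (c k) = Real.exp a * tail f t
  mid_pos : ∀ j ∈ Finset.Ico 1 k, tail f (c j) < tail f (c (j - 1))
  interp_pos : k ≠ 0 → tail f (t - c (k - 1)) < tail f (t - c k)
  density_pos : k ≠ 0 → ∀ x ∈ Set.Ioc (c (k - 1)) (c k), 0 < f (t - x)

/-- The probability of a regular jump. -/
def regWeight (f : ℝ → ℝ) (k : ℕ) (δ t : ℝ) : ℝ :=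
  1 - bigWeight f δ t - k * (δ / (k + 1) * bigWeight f δ t)

/-- The sampling density at distance `t` from the level. -/
def mixDensity (f : ℝ → ℝ) (k : ℕ) (c : ℝ → ℕ → ℝ) (δ t x : ℝ) : ℝ :=
  mixture f k (c t) (regWeight f k δ t) (bigWeight f δ t)
    (fun _ => δ / (k + 1) * bigWeight f δ t) t x

lemma sampler_eq (f : ℝ → ℝ) (k : ℕ) (c : ℝ → ℕ → ℝ) (δ κ b s x : ℝ) :
    sampler f k c δ κ b s x =
      if κ * intTail f (b - s) ^ 2 < 1 then mixDensity f k c δ (b - s) x else f x := rfl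

namespace IsHeavy

variable {f : ℝ → ℝ} {δ : ℝ}

lemma thetaConst_pos (hμ : mean f < 0) (hδ : δ ∈ Set.Ioo (0 : ℝ) (1 / 4)) :
    0 < thetaConst f δ := by
  have h1 := hδ.1
  have h2 := hδ.2
  exact div_pos (mul_pos (by linarith) (by linarith)) (by positivity)

/-- This strict inequality is the positivity of the margin Δ in the second moment bound. -/
lemma thetaConst_mul_lt (hμ : mean f < 0) (hδ : δ ∈ Set.Ioo (0 : ℝ) (1 / 4)) :
    thetaConst f δ * (1 + δ) < -mean f := by
  have h1 := hδ.1
  have h2 := hδ.2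
  have h3 : (1 : ℝ) < (1 + δ) ^ 4 := one_lt_pow₀ (by linarith) (by norm_num)
  have e : thetaConst f δ * (1 + δ) = -mean f * (1 - δ) / (1 + δ) ^ 4 := by
    rw [thetaConst]; field_simp
  rw [e, div_lt_iff₀ (by positivity)]
  refine mul_lt_mul_of_pos_left ?_ (by linarith)
  linarith

lemma bigWeight_pos (h : IsHeavy f) (hμ : mean f < 0) (hδ : δ ∈ Set.Ioo (0 : ℝ) (1 / 4)) (t : ℝ) :
    0 < bigWeight f δ t := by
  have h1 := hδ.1
  have := thetaConst_pos hμ hδ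
  exact lt_min (div_pos (mul_pos (by linarith) (h.tail_pos t)) (h.intTail_pos t)) (by positivity)

lemma interpWeight_le (h : IsHeavy f) (hμ : mean f < 0) (hδ : δ ∈ Set.Ioo (0 : ℝ) (1 / 4)) (k : ℕ)
    (t : ℝ) : k * (δ / (k + 1) * bigWeight f δ t) ≤ δ * bigWeight f δ t := by
  have h1 := hδ.1
  have h2 := h.bigWeight_pos hμ hδ t
  rw [← mul_assoc]
  refine mul_le_mul_of_nonneg_right ?_ h2.le
  rw [mul_div_assoc', div_le_iff₀ (by positivity)]
  nlinarith

lemma le_regWeight (h : IsHeavy f) (hμ : mean f < 0) (hδ : δ ∈ Set.Ioo (0 : ℝ) (1 / 4)) (k : ℕ)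
    (t : ℝ) : 1 - bigWeight f δ t * (1 + δ) ≤ regWeight f k δ t := by
  have := h.interpWeight_le hμ hδ k t
  rw [regWeight]
  linarith

lemma regWeight_pos (h : IsHeavy f) (hμ : mean f < 0) (hδ : δ ∈ Set.Ioo (0 : ℝ) (1 / 4)) (k : ℕ)
    (t : ℝ) : 0 < regWeight f k δ t := by
  have h1 := hδ.1
  have h2 := hδ.2
  have h3 := h.le_regWeight hμ hδ k t
  have h4 : bigWeight f δ t ≤ δ ^ 2 := min_le_right _ _
  have h5 := h.bigWeight_pos hμ hδ t
  nlinarith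

lemma interpWeight_pos (h : IsHeavy f) (hμ : mean f < 0) (hδ : δ ∈ Set.Ioo (0 : ℝ) (1 / 4)) (k : ℕ)
    (t : ℝ) : 0 < δ / (k + 1) * bigWeight f δ t :=
  mul_pos (div_pos hδ.1 (by positivity)) (h.bigWeight_pos hμ hδ t)

lemma measurable_bigWeight (h : IsHeavy f) (δ : ℝ) : Measurable (bigWeight f δ) :=
  ((h.tail_antitone.measurable.const_mul _).div h.intTail_antitone.measurable).min measurable_const

lemma measurable_mixDensity (h : IsHeavy f) {k : ℕ} {c : ℝ → ℕ → ℝ}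
    (hc : ∀ j, Measurable fun t => c t j) (δ : ℝ) :
    Measurable fun z : ℝ × ℝ => mixDensity f k c δ z.1 z.2 := by
  have hb := h.measurable_bigWeight δ
  have hr : Measurable (regWeight f k δ) :=
    (hb.const_sub 1).sub ((hb.const_mul (δ / (k + 1))).const_mul (k : ℝ))
  exact h.measurable_mixture k hc hr hb (hb.const_mul (δ / (k + 1)))

lemma measurable_sampler (h : IsHeavy f) {k : ℕ} {c : ℝ → ℕ → ℝ}
    (hc : ∀ j, Measurable fun t => c t j) (δ κ b : ℝ) :
    Measurable (Function.uncurry (sampler f k c δ κ b)) := by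
  have ht : Measurable fun z : ℝ × ℝ => b - z.1 := measurable_const.sub measurable_fst
  have hs : MeasurableSet {z : ℝ × ℝ | κ * intTail f (b - z.1) ^ 2 < 1} :=
    measurableSet_lt (((h.intTail_antitone.measurable.comp ht).pow_const 2).const_mul κ)
      measurable_const
  have hm : Measurable fun z : ℝ × ℝ => mixDensity f k c δ z.1 z.2 := h.measurable_mixDensity hc δ
  have e : Function.uncurry (sampler f k c δ κ b) = fun z : ℝ × ℝ =>
      if κ * intTail f (b - z.1) ^ 2 < 1 then mixDensity f k c δ (b - z.1) z.2 else f z.2 := by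
    ext z
    exact sampler_eq ..
  rw [e]
  generalize mixDensity f k c δ = u at hm ⊢
  exact Measurable.ite hs (hm.comp (ht.prodMk measurable_snd)) (h.meas.comp measurable_snd)

variable {k : ℕ} {c : ℝ → ℕ → ℝ}

lemma mixDensity_terms_nonneg (h : IsHeavy f) (hμ : mean f < 0) (hδ : δ ∈ Set.Ioo (0 : ℝ) (1 / 4))
    (t x : ℝ) :
    0 ≤ regWeight f k δ t * ((Set.Iic (c t 0)).indicator f x / (law f).real (Set.Iic (c t 0))) ∧
    0 ≤ bigWeight f δ t * ((Set.Ioi (c t k)).indicator f x / (law f).real (Set.Ioi (c t k))) ∧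
    (∀ j, 0 ≤ δ / (k + 1) * bigWeight f δ t * ((Set.Ioc (c t (j - 1)) (c t j)).indicator f x /
      (law f).real (Set.Ioc (c t (j - 1)) (c t j)))) ∧
    0 ≤ if k = 0 then 0 else δ / (k + 1) * bigWeight f δ t *
      ((Set.Ioc (c t (k - 1)) (c t k)).indicator (fun y => f (t - y)) x /
      (law f).real (Set.Ioc (t - c t k) (t - c t (k - 1)))) := by
  have hi : ∀ (A : Set ℝ) (u : ℝ → ℝ) x, (∀ x, 0 ≤ u x) → 0 ≤ A.indicator u x := fun A u x hu =>
    Set.indicator_nonneg (fun x _ => hu x) x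
  refine ⟨?_, ?_, fun j => ?_, ?_⟩
  · exact mul_nonneg (h.regWeight_pos hμ hδ k t).le (div_nonneg (hi _ _ _ h.nonneg) measureReal_nonneg)
  · exact mul_nonneg (h.bigWeight_pos hμ hδ t).le (div_nonneg (hi _ _ _ h.nonneg) measureReal_nonneg)
  · exact mul_nonneg (h.interpWeight_pos hμ hδ k t).le
      (div_nonneg (hi _ _ _ h.nonneg) measureReal_nonneg)
  · split_ifs
    · exact le_rfl
    · exact mul_nonneg (h.interpWeight_pos hμ hδ k t).le
        (div_nonneg (hi _ _ _ fun y => h.nonneg _) measureReal_nonneg)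

lemma mixDensity_nonneg (h : IsHeavy f) (hμ : mean f < 0) (hδ : δ ∈ Set.Ioo (0 : ℝ) (1 / 4))
    (t x : ℝ) : 0 ≤ mixDensity f k c δ t x := by
  obtain ⟨h1, h2, h3, h4⟩ := h.mixDensity_terms_nonneg hμ hδ (k := k) (c := c) t x
  exact add_nonneg (add_nonneg (add_nonneg h1 h2) (Finset.sum_nonneg fun j _ => h3 j)) h4

lemma reg_le_mixDensity (h : IsHeavy f) (hμ : mean f < 0) (hδ : δ ∈ Set.Ioo (0 : ℝ) (1 / 4))
    {t x : ℝ} (hx : x ≤ c t 0) :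
    regWeight f k δ t * (f x / (1 - tail f (c t 0))) ≤ mixDensity f k c δ t x := by
  obtain ⟨h1, h2, h3, h4⟩ := h.mixDensity_terms_nonneg hμ hδ (k := k) (c := c) t x
  have h5 := Finset.sum_nonneg (s := Finset.Ico 1 k) fun j _ => h3 j
  rw [Set.indicator_of_mem (show x ∈ Set.Iic (c t 0) from hx), h.real_Iic] at h1
  rw [mixDensity, mixture, Set.indicator_of_mem (show x ∈ Set.Iic (c t 0) from hx), h.real_Iic]
  linarith

lemma big_le_mixDensity (h : IsHeavy f) (hμ : mean f < 0) (hδ : δ ∈ Set.Ioo (0 : ℝ) (1 / 4))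
    {t x : ℝ} (hx : c t k < x) :
    bigWeight f δ t * (f x / tail f (c t k)) ≤ mixDensity f k c δ t x := by
  obtain ⟨h1, h2, h3, h4⟩ := h.mixDensity_terms_nonneg hμ hδ (k := k) (c := c) t x
  have h5 := Finset.sum_nonneg (s := Finset.Ico 1 k) fun j _ => h3 j
  rw [mixDensity, mixture, Set.indicator_of_mem (show x ∈ Set.Ioi (c t k) from hx), ← tail]
  linarith

lemma mid_le_mixDensity (h : IsHeavy f) (hμ : mean f < 0) (hδ : δ ∈ Set.Ioo (0 : ℝ) (1 / 4))
    {t x : ℝ} {j : ℕ} (hj : j ∈ Finset.Ico 1 k) (hx : x ∈ Set.Ioc (c t (j - 1)) (c t j)) :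
    δ / (k + 1) * bigWeight f δ t * (f x / (law f).real (Set.Ioc (c t (j - 1)) (c t j))) ≤
      mixDensity f k c δ t x := by
  obtain ⟨h1, h2, h3, h4⟩ := h.mixDensity_terms_nonneg hμ hδ (k := k) (c := c) t x
  have h5 := Finset.single_le_sum (f := fun j => δ / (k + 1) * bigWeight f δ t *
    ((Set.Ioc (c t (j - 1)) (c t j)).indicator f x /
      (law f).real (Set.Ioc (c t (j - 1)) (c t j)))) (fun j _ => h3 j) hj
  simp only [Set.indicator_of_mem hx] at h5
  rw [mixDensity, mixture]
  linarith

lemma interp_le_mixDensity (h : IsHeavy f) (hμ : mean f < 0) (hδ : δ ∈ Set.Ioo (0 : ℝ) (1 / 4))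
    {t x : ℝ} (hk : k ≠ 0) (hx : x ∈ Set.Ioc (c t (k - 1)) (c t k)) :
    δ / (k + 1) * bigWeight f δ t *
      (f (t - x) / (law f).real (Set.Ioc (t - c t k) (t - c t (k - 1)))) ≤
      mixDensity f k c δ t x := by
  obtain ⟨h1, h2, h3, h4⟩ := h.mixDensity_terms_nonneg hμ hδ (k := k) (c := c) t x
  have h5 := Finset.sum_nonneg (s := Finset.Ico 1 k) fun j _ => h3 j
  rw [mixDensity, mixture, if_neg hk, Set.indicator_of_mem hx]
  linarith

/-- The cut points need not be increasing; going down from `k`, some interval must be entered. -/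
lemma exists_mem_Ioc_cut {c : ℕ → ℝ} {k : ℕ} {x : ℝ} (h0 : c 0 < x) (hk : x ≤ c k) :
    ∃ j, 1 ≤ j ∧ j ≤ k ∧ x ∈ Set.Ioc (c (j - 1)) (c j) := by
  induction k with
  | zero => exact absurd h0 (not_lt.2 hk)
  | succ k ih =>
    rcases le_or_gt x (c k) with hx | hx
    · obtain ⟨j, h1, h2, h3⟩ := ih hx
      exact ⟨j, h1, by omega, h3⟩
    · exact ⟨k + 1, by omega, le_rfl, by simpa using ⟨hx, hk⟩⟩

lemma _root_.RWImportance.ValidCuts.real_mid_pos (h : IsHeavy f) {c : ℕ → ℝ} {a t : ℝ}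
    (hv : ValidCuts f k c a t) {j : ℕ}
    (hj : j ∈ Finset.Ico 1 k) : 0 < (law f).real (Set.Ioc (c (j - 1)) (c j)) := by
  rw [h.real_Ioc]
  exact lt_max_of_lt_left (sub_pos.2 (hv.mid_pos j hj))

lemma _root_.RWImportance.ValidCuts.real_interp_pos (h : IsHeavy f) {c : ℕ → ℝ} {a t : ℝ}
    (hv : ValidCuts f k c a t) (hk : k ≠ 0) :
    0 < (law f).real (Set.Ioc (t - c k) (t - c (k - 1))) := by
  rw [h.real_Ioc]
  exact lt_max_of_lt_left (sub_pos.2 (hv.interp_pos hk))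

/-- Every component but the last is a multiple of f on its piece. The reflected one is not, so there
the positivity of f(t - x) from `density_pos` is needed. -/
lemma mixDensity_eq_zero (h : IsHeavy f) (hμ : mean f < 0) (hδ : δ ∈ Set.Ioo (0 : ℝ) (1 / 4))
    {a t x : ℝ} (hv : ValidCuts f k (c t) a t) (hx : mixDensity f k c δ t x = 0) : f x = 0 := by
  by_contra hne
  have hfx : 0 < f x := lt_of_le_of_ne (h.nonneg x) (Ne.symm hne)
  have hp3 := h.interpWeight_pos hμ hδ k t
  rcases le_or_gt x (c t 0) with h0 | h0
  · have h1 := h.reg_le_mixDensity hμ hδ (k := k) h0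
    have h2 := hv.half_le
    have h3 := mul_pos (h.regWeight_pos hμ hδ k t) (div_pos hfx (by linarith : 0 < 1 - tail f (c t 0)))
    linarith
  rcases lt_or_ge (c t k) x with h1 | h1
  · have h2 := h.big_le_mixDensity hμ hδ h1
    have h3 := mul_pos (h.bigWeight_pos hμ hδ t) (div_pos hfx (h.tail_pos (c t k)))
    linarith
  obtain ⟨j, hj1, hjk, hxj⟩ := exists_mem_Ioc_cut h0 h1
  rcases hjk.lt_or_eq with hlt | rfl
  · have hmem : j ∈ Finset.Ico 1 k := Finset.mem_Ico.2 ⟨hj1, hlt⟩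
    have h2 := h.mid_le_mixDensity hμ hδ hmem hxj
    have h3 := mul_pos hp3 (div_pos hfx (hv.real_mid_pos h hmem))
    linarith
  · have hk : j ≠ 0 := by omega
    have h2 := h.interp_le_mixDensity hμ hδ hk hxj
    have h3 := mul_pos hp3 (div_pos (hv.density_pos hk x hxj) (hv.real_interp_pos h hk))
    linarith

/-- A bound for integrals of functions that are bounded by `M` over the upward jumps. -/
lemma lintegral_mul_mixDensity_le (h : IsHeavy f) (hμ : mean f < 0)
    (hδ : δ ∈ Set.Ioo (0 : ℝ) (1 / 4)) {a t : ℝ} (hv : ValidCuts f k (c t) a t)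
    {φ : ℝ → ℝ≥0∞} (hφ : Measurable φ) {M : ℝ≥0∞} (hM : ∀ x, 0 < x → φ x ≤ M) :
    ∫⁻ x, φ x * ENNReal.ofReal (mixDensity f k c δ t x) ≤
      ENNReal.ofReal (regWeight f k δ t / (1 - tail f (c t 0))) *
        ∫⁻ x in Set.Iic (c t 0), φ x ∂(law f) +
      ENNReal.ofReal (bigWeight f δ t / tail f (c t k)) * ∫⁻ x in Set.Ioi (c t k), φ x ∂(law f) +
      ENNReal.ofReal (k * (δ / (k + 1) * bigWeight f δ t)) * M := by
  have hp := h.prob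
  set p₃ := δ / (k + 1) * bigWeight f δ t with hp₃
  have hp3 : 0 < p₃ := h.interpWeight_pos hμ hδ k t
  have hc0 : ∀ j < k, 0 ≤ c t j := fun j hj => hv.cut_nonneg j hj.le
  change ∫⁻ x, φ x * ENNReal.ofReal (mixture f k (c t) (regWeight f k δ t) (bigWeight f δ t)
    (fun _ => p₃) t x) ≤ _
  rw [h.lintegral_mul_mixture hφ k (c t) (h.regWeight_pos hμ hδ k t).le
    (h.bigWeight_pos hμ hδ t).le hp3.le t, add_assoc (_ + _)]
  gcongr
  have hmid : ∀ j ∈ Finset.Ico 1 k, ENNReal.ofReal (p₃ / (law f).real (Set.Ioc (c t (j - 1)) (c t j))) *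
        ∫⁻ x in Set.Ioc (c t (j - 1)) (c t j), φ x ∂(law f) ≤ ENNReal.ofReal p₃ * M := by
    intro j hj
    have hpos := hv.real_mid_pos h hj
    have h1 : ∫⁻ x in Set.Ioc (c t (j - 1)) (c t j), φ x ∂(law f) ≤
        M * ENNReal.ofReal ((law f).real (Set.Ioc (c t (j - 1)) (c t j))) := by
      rw [ofReal_measureReal, ← setLIntegral_const]
      refine setLIntegral_mono' measurableSet_Ioc fun x hx => hM x ?_
      exact lt_of_le_of_lt (hc0 (j - 1) (by have := Finset.mem_Ico.1 hj; omega)) hx.1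
    calc _ ≤ ENNReal.ofReal (p₃ / (law f).real (Set.Ioc (c t (j - 1)) (c t j))) *
          (M * ENNReal.ofReal ((law f).real (Set.Ioc (c t (j - 1)) (c t j)))) := by gcongr
      _ = _ := by
        rw [mul_left_comm, ← ENNReal.ofReal_mul (div_nonneg hp3.le hpos.le),
          div_mul_cancel₀ _ hpos.ne', mul_comm]
  refine (add_le_add_left (Finset.sum_le_sum hmid) _).trans ?_
  rw [Finset.sum_const, Nat.card_Ico, nsmul_eq_mul]
  rcases Nat.eq_zero_or_pos k with rfl | hk
  · simp
  · rw [if_neg hk.ne']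
    have hpos := hv.real_interp_pos h hk.ne'
    have h1 : ∫⁻ x in Set.Ioc (c t (k - 1)) (c t k), φ x * ENNReal.ofReal (f (t - x)) ≤
        M * ENNReal.ofReal ((law f).real (Set.Ioc (t - c t k) (t - c t (k - 1)))) := by
      rw [← h.lintegral_reflected, ← lintegral_const_mul _ (by
        exact ENNReal.measurable_ofReal.comp (h.meas.comp (measurable_const.sub measurable_id)))]
      refine setLIntegral_mono' measurableSet_Ioc fun x hx => ?_
      gcongr
      exact hM x (lt_of_le_of_lt (hc0 (k - 1) (by omega)) hx.1)
    have h2 : ENNReal.ofReal (p₃ / (law f).real (Set.Ioc (t - c t k) (t - c t (k - 1)))) *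
          ∫⁻ x in Set.Ioc (c t (k - 1)) (c t k), φ x * ENNReal.ofReal (f (t - x)) ≤
        ENNReal.ofReal p₃ * M := by
      calc _ ≤ ENNReal.ofReal (p₃ / (law f).real (Set.Ioc (t - c t k) (t - c t (k - 1)))) *
          (M * ENNReal.ofReal ((law f).real (Set.Ioc (t - c t k) (t - c t (k - 1))))) := by gcongr
      _ = _ := by
        rw [mul_left_comm, ← ENNReal.ofReal_mul (div_nonneg hp3.le hpos.le),
          div_mul_cancel₀ _ hpos.ne', mul_comm]
    refine (add_le_add_right h2 _).trans (le_of_eq ?_)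
    -- The `k - 1` ordinary intermediate components and the reflected one together carry `k` equal
    -- weights.
    obtain ⟨m, rfl⟩ := Nat.exists_eq_succ_of_ne_zero hk.ne'
    rw [ENNReal.ofReal_mul (Nat.cast_nonneg _), ENNReal.ofReal_natCast]
    push_cast
    ring

lemma lintegral_mixDensity (h : IsHeavy f) (hμ : mean f < 0)
    (hδ : δ ∈ Set.Ioo (0 : ℝ) (1 / 4)) {a t : ℝ} (hv : ValidCuts f k (c t) a t) :
    ∫⁻ x, ENNReal.ofReal (mixDensity f k c δ t x) = 1 := by
  have hp := h.prob
  set p₃ := δ / (k + 1) * bigWeight f δ t with hp₃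
  have hp3 : 0 < p₃ := h.interpWeight_pos hμ hδ k t
  have hp1 := h.regWeight_pos hμ hδ k t
  have hp2 := h.bigWeight_pos hμ hδ t
  have hcancel : ∀ {p r : ℝ}, 0 ≤ p → 0 < r →
      ENNReal.ofReal (p / r) * ENNReal.ofReal r = ENNReal.ofReal p := fun hp hr => by
    rw [← ENNReal.ofReal_mul (div_nonneg hp hr.le), div_mul_cancel₀ _ hr.ne']
  have e : ∀ x, ENNReal.ofReal (mixDensity f k c δ t x) = 1 * ENNReal.ofReal
      (mixture f k (c t) (regWeight f k δ t) (bigWeight f δ t) (fun _ => p₃) t x) := fun x =>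
    (one_mul _).symm
  have hreg : 0 < 1 - tail f (c t 0) := by linarith [hv.half_le]
  simp only [e]
  rw [h.lintegral_mul_mixture measurable_const k (c t) hp1.le hp2.le hp3.le t]
  have eR : ∀ A, law f A = ENNReal.ofReal ((law f).real A) := fun A => (ofReal_measureReal (μ := law f) (s := A)).symm
  simp only [one_mul, setLIntegral_one, h.lintegral_reflected, eR, h.real_Iic]
  rw [hcancel hp1.le hreg, ← tail, hcancel hp2.le (h.tail_pos _),
    Finset.sum_congr rfl fun j hj => hcancel hp3.le (hv.real_mid_pos h hj), Finset.sum_const,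
    Nat.card_Ico, nsmul_eq_mul]
  have hsum : regWeight f k δ t + bigWeight f δ t + k * p₃ = 1 := by rw [regWeight]; ring
  rcases Nat.eq_zero_or_pos k with rfl | hk
  · rw [if_pos rfl, ← ENNReal.ofReal_add hp1.le hp2.le]
    simpa using hsum
  · obtain ⟨m, rfl⟩ := Nat.exists_eq_succ_of_ne_zero hk.ne'
    rw [if_neg hk.ne', hcancel hp3.le (hv.real_interp_pos h hk.ne'), ← ENNReal.ofReal_one, ← hsum,
      ENNReal.ofReal_add (by positivity) (by positivity), ENNReal.ofReal_add hp1.le hp2.le,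
      ENNReal.ofReal_mul (Nat.cast_nonneg _), ENNReal.ofReal_natCast]
    push_cast
    ring

end IsHeavy

end

section

/-! ### Strong efficiency and termination of the scheme -/

/-- The asymptotic requirements on the cut points. -/
structure GoodCuts (f : ℝ → ℝ) (k : ℕ) (c : ℝ → ℕ → ℝ) (a δ : ℝ) : Prop where
  meas : ∀ j, Measurable fun t => c t j
  longTailed : LongTailed f
  valid : ∀ᶠ t in atTop, ValidCuts f k (c t) a t
  reg_tendsto : Tendsto (fun t => c t 0) atTop atTop
  reg_dom : ∃ C, ∀ᶠ t in atTop, tail f (t - c t 0) * intTail f (t - c t 0) ≤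
    C * (tail f t * intTail f t)
  mid : ∀ η > 0, ∀ᶠ t in atTop, ∫⁻ x in Set.Ioc (c t 0) (c t k),
    ENNReal.ofReal (f x / mixDensity f k c δ t x) * ENNReal.ofReal (intTail f (t - x) ^ 2) ∂(law f) ≤
      ENNReal.ofReal (η * (tail f t * intTail f t))

/-- Here m = -μ, e = e^(2a) and p is the regular weight. Since m = Δ + θ(1 + δ), dividing by p
leaves a gain of (3/2)rΔ relative to κG². The large jumps use Δ/2 of the coefficient 3Δ/2, thanks to
`hκe`, the intermediate jumps use Δ/2, and Δ/2 is left over. -/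
lemma lyapunov_arith {r G κ θ δ Δ m e p : ℝ} (hr : 0 < r) (hκ : 0 < κ) (hθ : 0 < θ)
    (hΔ : Δ = m - θ * (1 + δ)) (hΔ0 : 0 < Δ) (hδ : 0 < δ) (hκe : e / (θ * Δ) ≤ κ)
    (hp : 1 - 2 * θ * r * (1 + δ) ≤ p) (hy : 2 * θ * r * (1 + δ) < 1)
    (hx : 0 ≤ 1 + 2 * r * (-m + Δ / 4)) :
    1 / p * κ * (G ^ 2 * (1 + 2 * r * (-m + Δ / 4))) + e * (r * G) ^ 2 / (2 * θ * r) +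
      κ * (Δ / 2 * (r * G * G)) ≤ κ * G ^ 2 := by
  have hp0 : 0 < p := by linarith
  have h1 : 1 / p * (1 + 2 * r * (-m + Δ / 4)) ≤ 1 - 3 / 2 * r * Δ := by
    rw [one_div, inv_mul_le_iff₀ hp0]
    have h2 : 1 + 2 * r * (-m + Δ / 4) ≤ (1 - 2 * θ * r * (1 + δ)) * (1 - 3 / 2 * r * Δ) := by
      rw [show m = Δ + θ * (1 + δ) by linarith]
      have : 0 ≤ 2 * θ * r * (1 + δ) * (3 / 2 * r * Δ) := by positivity
      nlinarith
    have h3 : 0 ≤ 1 - 3 / 2 * r * Δ := by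
      by_contra! hneg
      have := mul_neg_of_pos_of_neg (by linarith : 0 < 1 - 2 * θ * r * (1 + δ)) hneg
      linarith
    exact h2.trans (mul_le_mul_of_nonneg_right hp h3)
  have h4 : e * (r * G) ^ 2 / (2 * θ * r) ≤ κ * (Δ / 2 * (r * G ^ 2)) := by
    have e1 : e * (r * G) ^ 2 / (2 * θ * r) = e / (θ * Δ) * (Δ / 2 * (r * G ^ 2)) := by
      field_simp
    rw [e1]
    exact mul_le_mul_of_nonneg_right hκe (by positivity)
  have h5 : 1 / p * κ * (G ^ 2 * (1 + 2 * r * (-m + Δ / 4))) ≤ κ * G ^ 2 * (1 - 3 / 2 * r * Δ) := by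
    calc _ = κ * G ^ 2 * (1 / p * (1 + 2 * r * (-m + Δ / 4))) := by ring
      _ ≤ _ := mul_le_mul_of_nonneg_left h1 (by positivity)
  calc _ ≤ κ * G ^ 2 * (1 - 3 / 2 * r * Δ) + κ * (Δ / 2 * (r * G ^ 2)) +
      κ * (Δ / 2 * (r * G * G)) := by linarith
    _ = κ * G ^ 2 - κ * G ^ 2 * (r * Δ) / 2 := by ring
    _ ≤ _ := by
      have : 0 ≤ κ * G ^ 2 * (r * Δ) := by positivity
      linarith

namespace IsHeavy

variable {f : ℝ → ℝ} {δ a κ : ℝ} {k : ℕ} {c : ℝ → ℕ → ℝ}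

lemma sampler_nonneg (h : IsHeavy f) (hμ : mean f < 0) (hδ : δ ∈ Set.Ioo (0 : ℝ) (1 / 4))
    (b s x : ℝ) : 0 ≤ sampler f k c δ κ b s x := by
  rw [sampler_eq]
  split_ifs
  · exact h.mixDensity_nonneg hμ hδ _ _
  · exact h.nonneg x

lemma lintegral_sampler (h : IsHeavy f) (hμ : mean f < 0) (hδ : δ ∈ Set.Ioo (0 : ℝ) (1 / 4))
    (hv : ∀ t, κ * intTail f t ^ 2 < 1 → ValidCuts f k (c t) a t) (b s : ℝ) :
    ∫⁻ x, ENNReal.ofReal (sampler f k c δ κ b s x) = 1 := by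
  simp only [sampler_eq]
  split_ifs with hs
  · exact h.lintegral_mixDensity hμ hδ (hv _ hs)
  · exact lintegral_ofReal_density h.prob

lemma sampler_eq_zero (h : IsHeavy f) (hμ : mean f < 0) (hδ : δ ∈ Set.Ioo (0 : ℝ) (1 / 4))
    (hv : ∀ t, κ * intTail f t ^ 2 < 1 → ValidCuts f k (c t) a t) (b s x : ℝ)
    (hx : sampler f k c δ κ b s x = 0) : f x = 0 := by
  rw [sampler_eq] at hx
  split_ifs at hx with hs
  · exact h.mixDensity_eq_zero hμ hδ (hv _ hs) hx
  · exact hx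

/-- The Lyapunov inequality for the second moment, at distance `t`. -/
lemma lintegral_ratio_mul_le (h : IsHeavy f) (hμ : mean f < 0) (hδ : δ ∈ Set.Ioo (0 : ℝ) (1 / 4))
    {t Δ : ℝ} (hΔ : Δ = -mean f - thetaConst f δ * (1 + δ)) (hκ : 0 < κ)
    (hκe : Real.exp a ^ 2 / (thetaConst f δ * Δ) ≤ κ) (hv : ValidCuts f k (c t) a t)
    (hbig : 2 * thetaConst f δ * (tail f t / intTail f t) ≤ δ ^ 2)
    (hsmall : 0 ≤ 1 + 2 * (tail f t / intTail f t) * (mean f + Δ / 4))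
    (hreg : ∫⁻ x in Set.Iic (c t 0), ENNReal.ofReal (intTail f (t - x) ^ 2) ∂(law f) ≤
      ENNReal.ofReal (intTail f t ^ 2 * (1 + 2 * (tail f t / intTail f t) * (mean f + Δ / 4))))
    (hmid : ∫⁻ x in Set.Ioc (c t 0) (c t k), ENNReal.ofReal (f x / mixDensity f k c δ t x) *
      ENNReal.ofReal (intTail f (t - x) ^ 2) ∂(law f) ≤
      ENNReal.ofReal (Δ / 2 * (tail f t * intTail f t))) :
    ∫⁻ x, ENNReal.ofReal (f x / mixDensity f k c δ t x) *
      ENNReal.ofReal (min (κ * intTail f (t - x) ^ 2) 1) ∂(law f) ≤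
      ENNReal.ofReal (κ * intTail f t ^ 2) := by
  have hp := h.prob
  have hd1 := hδ.1
  have hd2 := hδ.2
  have hF := h.tail_pos t
  have hG := h.intTail_pos t
  have hθ := thetaConst_pos hμ hδ
  have hΔ0 : 0 < Δ := by
    have := thetaConst_mul_lt hμ hδ
    linarith
  set r := tail f t / intTail f t with hr
  have hr0 : 0 < r := div_pos hF hG
  have hrG : tail f t = r * intTail f t := by rw [hr, div_mul_cancel₀ _ hG.ne']
  have hbw : bigWeight f δ t = 2 * thetaConst f δ * r := by
    rw [bigWeight, mul_div_assoc]
    exact min_eq_left hbig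
  set p := regWeight f k δ t with hpdef
  have hp0 : 0 < p := h.regWeight_pos hμ hδ k t
  have hp1 : 1 - 2 * thetaConst f δ * r * (1 + δ) ≤ p := by
    have := h.le_regWeight hμ hδ k t
    rwa [hbw] at this
  have hb0 := h.bigWeight_pos hμ hδ t
  have hq0 := h.mixDensity_nonneg (k := k) (c := c) hμ hδ t
  -- A single component of the mixture suffices to bound the likelihood ratio; where f vanishes the
  -- ratio is 0 for any denominator.
  have hratio : ∀ {x w : ℝ}, 0 < w → w * f x ≤ mixDensity f k c δ t x →
      f x / mixDensity f k c δ t x ≤ 1 / w := by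
    intro x w hw hle
    rcases (h.nonneg x).eq_or_lt with h0 | h0
    · rw [← h0, zero_div]; positivity
    · have hq : 0 < mixDensity f k c δ t x := lt_of_lt_of_le (mul_pos hw h0) hle
      rw [div_le_div_iff₀ hq hw, one_mul, mul_comm]
      exact hle
  have hmin : ∀ x, ENNReal.ofReal (min (κ * intTail f (t - x) ^ 2) 1) ≤
      ENNReal.ofReal κ * ENNReal.ofReal (intTail f (t - x) ^ 2) := fun x => by
    rw [← ENNReal.ofReal_mul hκ.le]
    exact ENNReal.ofReal_le_ofReal (min_le_left _ _)
  set u : ℝ → ℝ≥0∞ := fun x => ENNReal.ofReal (f x / mixDensity f k c δ t x) *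
      ENNReal.ofReal (min (κ * intTail f (t - x) ^ 2) 1) with hu
  have hGm : Measurable fun x => ENNReal.ofReal (intTail f (t - x) ^ 2) :=
    ENNReal.measurable_ofReal.comp ((h.intTail_antitone.measurable.comp
      (measurable_const.sub measurable_id)).pow_const 2)
  -- regular jumps
  have hA1 : ∫⁻ x in Set.Iic (c t 0), u x ∂(law f) ≤
      ENNReal.ofReal (1 / p * κ * (intTail f t ^ 2 * (1 + 2 * r * (mean f + Δ / 4)))) := by
    calc _ ≤ ∫⁻ x in Set.Iic (c t 0), ENNReal.ofReal (1 / p * κ) *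
          ENNReal.ofReal (intTail f (t - x) ^ 2) ∂(law f) := by
          refine setLIntegral_mono' measurableSet_Iic fun x hx => ?_
          rw [ENNReal.ofReal_mul (by positivity), mul_assoc]
          refine mul_le_mul' (ENNReal.ofReal_le_ofReal (hratio hp0 ?_)) (hmin x)
          refine le_trans ?_ (h.reg_le_mixDensity hμ hδ (k := k) hx)
          refine mul_le_mul_of_nonneg_left ?_ hp0.le
          have h1 := hv.half_le
          have h2 := h.tail_pos (c t 0)
          rw [le_div_iff₀ (by linarith)]
          nlinarith [h.nonneg x]
      _ = ENNReal.ofReal (1 / p * κ) * ∫⁻ x in Set.Iic (c t 0),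
          ENNReal.ofReal (intTail f (t - x) ^ 2) ∂(law f) := lintegral_const_mul _ hGm
      _ ≤ _ := by
          rw [ENNReal.ofReal_mul (p := 1 / p * κ) (by positivity)]
          gcongr
  -- large jumps
  have hA2 : ∫⁻ x in Set.Ioi (c t k), u x ∂(law f) ≤
      ENNReal.ofReal (Real.exp a ^ 2 * (r * intTail f t) ^ 2 / (2 * thetaConst f δ * r)) := by
    have hFk := h.tail_pos (c t k)
    calc _ ≤ ∫⁻ x in Set.Ioi (c t k), ENNReal.ofReal (tail f (c t k) / bigWeight f δ t) ∂(law f) := by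
          refine setLIntegral_mono' measurableSet_Ioi fun x hx => ?_
          rw [hu]
          -- After a large jump the Lyapunov function is bounded by 1 instead of κG², so this cost
          -- does not grow with κ.
          refine (mul_le_of_le_one_right' ?_).trans (ENNReal.ofReal_le_ofReal ?_)
          · rw [← ENNReal.ofReal_one]
            exact ENNReal.ofReal_le_ofReal (min_le_right _ _)
          · have := hratio (x := x) (div_pos hb0 hFk) ?_
            · rwa [one_div_div] at this
            · have h1 := h.big_le_mixDensity hμ hδ (k := k) (c := c) hx
              rwa [mul_div_assoc', mul_div_right_comm] at h1
      _ = ENNReal.ofReal (tail f (c t k) / bigWeight f δ t * tail f (c t k)) := by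
          rw [setLIntegral_const, ENNReal.ofReal_mul (by positivity), tail, ofReal_measureReal]
      _ = _ := by
          rw [hbw, hv.big, hrG]
          congr 1
          field_simp
  -- intermediate jumps
  have hA3 : ∫⁻ x in Set.Ioc (c t 0) (c t k), u x ∂(law f) ≤
      ENNReal.ofReal (κ * (Δ / 2 * (r * intTail f t * intTail f t))) := by
    calc _ ≤ ∫⁻ x in Set.Ioc (c t 0) (c t k), ENNReal.ofReal κ *
          (ENNReal.ofReal (f x / mixDensity f k c δ t x) *
            ENNReal.ofReal (intTail f (t - x) ^ 2)) ∂(law f) := by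
          refine lintegral_mono fun x => ?_
          rw [mul_left_comm]
          exact mul_le_mul_right (hmin x) _
      _ = ENNReal.ofReal κ * ∫⁻ x in Set.Ioc (c t 0) (c t k),
          (ENNReal.ofReal (f x / mixDensity f k c δ t x) *
            ENNReal.ofReal (intTail f (t - x) ^ 2)) ∂(law f) :=
          lintegral_const_mul' _ _ ENNReal.ofReal_ne_top
      _ ≤ _ := by
          rw [ENNReal.ofReal_mul hκ.le, ← hrG]
          gcongr
  have hcover : (Set.univ : Set ℝ) ⊆ (Set.Iic (c t 0) ∪ Set.Ioi (c t k)) ∪ Set.Ioc (c t 0) (c t k) := by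
    intro x _
    rcases le_or_gt x (c t 0) with h0 | h0
    · exact Or.inl (Or.inl h0)
    rcases lt_or_ge (c t k) x with h1 | h1
    · exact Or.inl (Or.inr h1)
    · exact Or.inr ⟨h0, h1⟩
  have hy : 2 * thetaConst f δ * r * (1 + δ) < 1 := by nlinarith
  calc ∫⁻ x, u x ∂(law f) = ∫⁻ x in Set.univ, u x ∂(law f) := by rw [Measure.restrict_univ]
    _ ≤ ∫⁻ x in (Set.Iic (c t 0) ∪ Set.Ioi (c t k)) ∪ Set.Ioc (c t 0) (c t k), u x ∂(law f) :=
        lintegral_mono_set hcover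
    _ ≤ (∫⁻ x in Set.Iic (c t 0), u x ∂(law f) + ∫⁻ x in Set.Ioi (c t k), u x ∂(law f)) +
        ∫⁻ x in Set.Ioc (c t 0) (c t k), u x ∂(law f) :=
        (lintegral_union_le _ _ _).trans (by gcongr; exact lintegral_union_le _ _ _)
    _ ≤ _ := add_le_add (add_le_add hA1 hA2) hA3
    _ ≤ _ := by
        rw [← ENNReal.ofReal_add, ← ENNReal.ofReal_add]
        · refine ENNReal.ofReal_le_ofReal ?_
          have := lyapunov_arith (G := intTail f t) (m := -mean f) hr0 hκ hθ hΔ hΔ0 hd1 hκe hp1 hy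
            (by rwa [neg_neg])
          rwa [neg_neg] at this
        all_goals positivity

/-- Strong efficiency for all large `κ`. -/
theorem exists_stronglyEfficient (h : IsHeavy f) (hμ : mean f < 0)
    (hδ : δ ∈ Set.Ioo (0 : ℝ) (1 / 4)) (hc : GoodCuts f k c a δ)
    {Ω : Type*} [MeasurableSpace Ω] {P : Measure Ω}
    [IsProbabilityMeasure P] {X : ℕ → Ω → ℝ} (hX : ∀ n, Measurable (X n))
    (hindep : iIndepFun X P) (hlaw : ∀ n, P.map (X n) = law f)
    (hint : Integrable (X 0) P) (hmean : ∫ ω, X 0 ω ∂P < 0) :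
    ∃ κ₀ > 0, ∀ κ ≥ κ₀, StronglyEfficient P X f (sampler f k c δ κ) ∧
      ∃ t₀ > 0, ∀ t, κ * intTail f t ^ 2 < 1 → t₀ ≤ t ∧ ValidCuts f k (c t) a t := by
  have hp := h.prob
  have hθ := thetaConst_pos hμ hδ
  set Δ := -mean f - thetaConst f δ * (1 + δ) with hΔ
  have hΔ0 : 0 < Δ := by
    have := thetaConst_mul_lt hμ hδ
    linarith
  obtain ⟨C, hC⟩ := hc.reg_dom
  have hr := h.tendsto_ratio hc.longTailed
  have e1 := (hr.const_mul (2 * thetaConst f δ)).eventually_le_const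
    (show 2 * thetaConst f δ * 0 < δ ^ 2 by have := hδ.1; rw [mul_zero]; positivity)
  have e2 := ((hr.const_mul 2).mul_const (mean f + Δ / 4)).eventually_const_le
    (show -1 < 2 * 0 * (mean f + Δ / 4) by simp)
  obtain ⟨T, hT⟩ := eventually_atTop.1 ((((hc.valid.and e1).and e2).and
    (h.eventually_sq_intTail_le hc.longTailed hc.reg_tendsto hC (show 0 < Δ / 4 by positivity))).and
    (hc.mid (Δ / 2) (by positivity)))
  set t₀ := max T 1 with ht₀
  have hG0 := h.intTail_pos t₀
  -- The first entry confines the mixture to t ≥ t₀, where the asymptotic estimates hold; the second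
  -- makes the cost of the large jumps affordable. As t₀ ≥ 1, the Lyapunov function is 1 beyond the
  -- level.
  refine ⟨max (1 / intTail f t₀ ^ 2) (Real.exp a ^ 2 / (thetaConst f δ * Δ)),
    lt_max_of_lt_left (by positivity), fun κ hκ => ?_⟩
  have hκ1 : 1 / intTail f t₀ ^ 2 ≤ κ := (le_max_left _ _).trans hκ
  have hκ2 : Real.exp a ^ 2 / (thetaConst f δ * Δ) ≤ κ := (le_max_right _ _).trans hκ
  have hκ0 : 0 < κ := lt_of_lt_of_le (by positivity) hκ1
  have hκG : 1 ≤ κ * intTail f t₀ ^ 2 := by rwa [div_le_iff₀ (by positivity)] at hκ1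
  have hfar : ∀ t, κ * intTail f t ^ 2 < 1 → t₀ ≤ t := by
    intro t ht
    by_contra! hlt
    have h1 := pow_le_pow_left₀ hG0.le (h.intTail_antitone hlt.le) 2
    have h2 := mul_le_mul_of_nonneg_left h1 hκ0.le
    linarith
  have hvalid : ∀ t, κ * intTail f t ^ 2 < 1 → ValidCuts f k (c t) a t := fun t ht =>
    (hT t ((le_max_left _ _).trans (hfar t ht))).1.1.1.1
  refine ⟨?_, t₀, lt_of_lt_of_le one_pos (le_max_right _ _), fun t ht => ⟨hfar t ht, hvalid t ht⟩⟩
  obtain ⟨ε, hε, hlow⟩ := h.exists_mul_intTail_le_ruinProb hX hindep hlaw hint hmean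
  refine stronglyEfficient_of_lyapunov hX hindep h.meas h.nonneg hlaw
    (fun b => h.measurable_sampler hc.meas δ κ b) (fun b s x => h.sampler_nonneg hμ hδ b s x)
    (h.lintegral_sampler hμ hδ hvalid) (h.sampler_eq_zero hμ hδ hvalid) hε hκ0
    (fun b _ => h.intTail_nonneg b) hlow
    (g := fun t => ENNReal.ofReal (min (κ * intTail f t ^ 2) 1)) ?_ ?_ ?_ ?_
  · exact ENNReal.measurable_ofReal.comp
      (((h.intTail_antitone.measurable.pow_const 2).const_mul κ).min measurable_const)
  · intro t ht
    have : ¬ κ * intTail f t ^ 2 < 1 := fun hlt => by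
      have h1 := hfar t hlt
      have h2 : (1 : ℝ) ≤ t₀ := le_max_right _ _
      linarith
    rw [min_eq_right (not_lt.1 this), ENNReal.ofReal_one]
  · exact fun b _ => ENNReal.ofReal_le_ofReal (min_le_left _ _)
  · intro b _ s _
    simp only [sampler_eq]
    split_ifs with hs
    · rw [min_eq_left hs.le]
      obtain ⟨⟨⟨⟨h1, h2⟩, h3⟩, h4⟩, h5⟩ := hT (b - s) ((le_max_left _ _).trans (hfar _ hs))
      exact h.lintegral_ratio_mul_le hμ hδ hΔ hκ0 hκ2 h1 h2 (by linarith) h4 h5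
    · rw [min_eq_right (not_lt.1 hs), ENNReal.ofReal_one]
      calc _ ≤ ∫⁻ _, 1 ∂(law f) := by
            refine lintegral_mono fun x => ?_
            rw [← one_mul (1 : ℝ≥0∞), ← ENNReal.ofReal_one]
            exact mul_le_mul' (ENNReal.ofReal_le_ofReal (div_self_le_one _))
              (ENNReal.ofReal_le_ofReal (min_le_right _ _))
        _ = 1 := by simp

end IsHeavy

end

/-! ### Mean termination time -/

section

/-- Bernoulli's inequality: the concave power lies below its tangent at t. -/
lemma sub_rpow_le {γ t x : ℝ} (hγ0 : 0 ≤ γ) (hγ1 : γ ≤ 1) (ht : 0 < t) (hx : x ≤ t) :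
    (t - x) ^ γ ≤ t ^ γ - γ * t ^ (γ - 1) * x := by
  have h1 : -1 ≤ -(x / t) := by
    rw [neg_le_neg_iff, div_le_one ht]; exact hx
  have h2 := rpow_one_add_le_one_add_mul_self h1 hγ0 hγ1
  have e : t - x = t * (1 + -(x / t)) := by field_simp; ring
  rw [e, Real.mul_rpow ht.le (by linarith), Real.rpow_sub_one ht.ne']
  calc _ ≤ t ^ γ * (1 + γ * -(x / t)) := mul_le_mul_of_nonneg_left h2 (by positivity)
    _ = _ := by field_simp; ring

lemma rpow_le_one_add {γ u : ℝ} (hγ0 : 0 ≤ γ) (hγ1 : γ ≤ 1) (hu : 0 ≤ u) : u ^ γ ≤ 1 + u := by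
  rcases le_total u 1 with h1 | h1
  · have := Real.rpow_le_one hu h1 hγ0
    linarith
  · have := Real.rpow_le_rpow_of_exponent_le h1 hγ1
    rw [Real.rpow_one] at this
    linarith

namespace IsHeavy

variable {f : ℝ → ℝ} {δ a κ : ℝ} {k : ℕ} {c : ℝ → ℕ → ℝ}

/-- `D` bounds the conditional mean of -X on a regular jump. Intermediate jumps are positive and
cannot increase the Lyapunov function; given a large jump, the level is passed with probability
F(t)/F(c_k) = e^(-a), and then nothing is left. So the increase over regular jumps and the unit of
time are paid by p_** e^(-a) times the current value. -/
lemma termination_mixture (h : IsHeavy f) (hμ : mean f < 0) (hδ : δ ∈ Set.Ioo (0 : ℝ) (1 / 4))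
    (ha : 0 ≤ a) {t γ ρ₀ ρ₁ D : ℝ} (ht : 0 < t) (hv : ValidCuts f k (c t) a t) (hγ0 : 0 ≤ γ)
    (hγ1 : γ ≤ 1) (hρ0 : 0 ≤ ρ₀) (hρ1 : 0 ≤ ρ₁)
    (hD : 0 ≤ D) (hN : ∫ x in Set.Iic (c t 0), -x ∂(law f) ≤ D * (1 - tail f (c t 0)))
    (hdrift : 1 + ρ₁ * (γ * t ^ (γ - 1) * D) ≤
      bigWeight f δ t * Real.exp (-a) * (ρ₀ + ρ₁ * t ^ γ)) :
    1 + ∫⁻ x in Set.Iic t, ENNReal.ofReal (ρ₀ + ρ₁ * (t - x) ^ γ) *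
      ENNReal.ofReal (mixDensity f k c δ t x) ≤ ENNReal.ofReal (ρ₀ + ρ₁ * t ^ γ) := by
  have hp := h.prob
  set M := ρ₀ + ρ₁ * t ^ γ with hM
  have hM0 : 0 ≤ M := by positivity
  set φ : ℝ → ℝ≥0∞ := (Set.Iic t).indicator fun x => ENNReal.ofReal (ρ₀ + ρ₁ * (t - x) ^ γ) with hφ
  have hφm : Measurable φ := by
    refine Measurable.indicator ?_ measurableSet_Iic
    fun_prop
  have hφM : ∀ x, 0 < x → φ x ≤ ENNReal.ofReal M := by
    intro x hx
    by_cases hxt : x ≤ t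
    · rw [hφ, Set.indicator_of_mem (Set.mem_Iic.2 hxt)]
      refine ENNReal.ofReal_le_ofReal ?_
      have := Real.rpow_le_rpow (sub_nonneg.2 hxt) (by linarith : t - x ≤ t) hγ0
      rw [hM]
      gcongr
    · rw [hφ, Set.indicator_of_notMem (by simpa using hxt)]; exact zero_le
  have hmain := h.lintegral_mul_mixDensity_le hμ hδ hv hφm hφM
  have hp1 := h.regWeight_pos hμ hδ k t
  have hp2 := h.bigWeight_pos hμ hδ t
  have hp3 := h.interpWeight_pos hμ hδ k t
  have hP : 0 < 1 - tail f (c t 0) := by linarith [hv.half_le]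
  have hFt := h.tail_pos t
  have hFk := h.tail_pos (c t k)
  -- regular jumps
  have hreg : ∫⁻ x in Set.Iic (c t 0), φ x ∂(law f) ≤
      ENNReal.ofReal ((1 - tail f (c t 0)) * (M + ρ₁ * (γ * t ^ (γ - 1) * D))) := by
    have hneg : Integrable (fun x => ρ₁ * (γ * t ^ (γ - 1)) * -x) (law f) := h.int.neg.const_mul _
    have hi : IntegrableOn (fun x => M + ρ₁ * (γ * t ^ (γ - 1)) * -x) (Set.Iic (c t 0)) (law f) :=
      ((integrable_const _).add hneg).integrableOn
    have hle : ∀ x ∈ Set.Iic (c t 0),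
        ρ₀ + ρ₁ * (t - x) ^ γ ≤ M + ρ₁ * (γ * t ^ (γ - 1)) * -x := by
      intro x hx
      have := mul_le_mul_of_nonneg_left (sub_rpow_le hγ0 hγ1 ht
        ((Set.mem_Iic.1 hx).trans hv.reg_le)) hρ1
      rw [hM]
      linarith
    calc _ ≤ ∫⁻ x in Set.Iic (c t 0), ENNReal.ofReal (M + ρ₁ * (γ * t ^ (γ - 1)) * -x) ∂(law f) := by
          refine setLIntegral_mono' measurableSet_Iic fun x hx => ?_
          rw [hφ, Set.indicator_of_mem (Set.mem_Iic.2 ((Set.mem_Iic.1 hx).trans hv.reg_le))]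
          exact ENNReal.ofReal_le_ofReal (hle x hx)
      _ = ENNReal.ofReal (∫ x in Set.Iic (c t 0), M + ρ₁ * (γ * t ^ (γ - 1)) * -x ∂(law f)) := by
          rw [ofReal_integral_eq_lintegral_ofReal hi]
          refine (ae_restrict_iff' measurableSet_Iic).2 (ae_of_all _ fun x hx => ?_)
          refine le_trans ?_ (hle x hx)
          have : 0 ≤ t - x := by linarith [(Set.mem_Iic.1 hx).trans hv.reg_le]
          simp only [Pi.zero_apply]
          positivity
      _ ≤ _ := by
          refine ENNReal.ofReal_le_ofReal ?_
          rw [integral_add (integrable_const _) hneg.integrableOn, integral_const,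
            smul_eq_mul, integral_const_mul, measureReal_restrict_apply MeasurableSet.univ,
            Set.univ_inter, h.real_Iic]
          have := mul_le_mul_of_nonneg_left hN (by positivity : 0 ≤ ρ₁ * (γ * t ^ (γ - 1)))
          linarith
  -- large jumps
  have hbig : ∫⁻ x in Set.Ioi (c t k), φ x ∂(law f) ≤
      ENNReal.ofReal (M * (tail f (c t k) - tail f t)) := by
    have hnn : 0 ≤ tail f (c t k) - tail f t := by
      rw [hv.big]
      have := Real.one_le_exp ha
      nlinarith
    calc ∫⁻ x in Set.Ioi (c t k), φ x ∂(law f)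
        = ∫⁻ x in Set.Ioc (c t k) t, ENNReal.ofReal (ρ₀ + ρ₁ * (t - x) ^ γ) ∂(law f) := by
          rw [hφ, setLIntegral_indicator measurableSet_Iic, Set.inter_comm, Set.Ioi_inter_Iic]
      _ ≤ ∫⁻ x in Set.Ioc (c t k) t, ENNReal.ofReal M ∂(law f) := by
          refine setLIntegral_mono' measurableSet_Ioc fun x hx => ?_
          have := hφM x (lt_of_le_of_lt (hv.cut_nonneg k le_rfl) hx.1)
          rwa [hφ, Set.indicator_of_mem (show x ∈ Set.Iic t from hx.2)] at this
      _ = _ := by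
          rw [setLIntegral_const, ← ofReal_measureReal, h.real_Ioc, max_eq_left hnn,
            ENNReal.ofReal_mul hM0]
  have hexp : tail f t / tail f (c t k) = Real.exp (-a) := by
    rw [hv.big, Real.exp_neg]
    field_simp
  calc 1 + ∫⁻ x in Set.Iic t, ENNReal.ofReal (ρ₀ + ρ₁ * (t - x) ^ γ) *
      ENNReal.ofReal (mixDensity f k c δ t x)
      = 1 + ∫⁻ x, φ x * ENNReal.ofReal (mixDensity f k c δ t x) := by
        rw [← lintegral_indicator measurableSet_Iic]
        congr 1
        refine lintegral_congr fun x => ?_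
        by_cases hx : x ∈ Set.Iic t <;> simp only [hφ, hx, Set.indicator_of_mem,
          not_false_eq_true, Set.indicator_of_notMem, zero_mul]
    _ ≤ ENNReal.ofReal 1 + (ENNReal.ofReal (regWeight f k δ t / (1 - tail f (c t 0)) *
          ((1 - tail f (c t 0)) * (M + ρ₁ * (γ * t ^ (γ - 1) * D)))) +
        ENNReal.ofReal (bigWeight f δ t / tail f (c t k) * (M * (tail f (c t k) - tail f t))) +
        ENNReal.ofReal (k * (δ / (k + 1) * bigWeight f δ t) * M)) := by
        rw [ENNReal.ofReal_one]
        refine add_le_add le_rfl (hmain.trans ?_)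
        rw [ENNReal.ofReal_mul (p := regWeight f k δ t / (1 - tail f (c t 0))) (by positivity),
          ENNReal.ofReal_mul (p := bigWeight f δ t / tail f (c t k)) (by positivity),
          ENNReal.ofReal_mul (p := k * (δ / (k + 1) * bigWeight f δ t)) (by positivity)]
        gcongr
    _ ≤ ENNReal.ofReal M := by
        have e1 : regWeight f k δ t / (1 - tail f (c t 0)) *
          ((1 - tail f (c t 0)) * (M + ρ₁ * (γ * t ^ (γ - 1) * D))) =
          regWeight f k δ t * (M + ρ₁ * (γ * t ^ (γ - 1) * D)) := by
          field_simp
        have e2 : bigWeight f δ t / tail f (c t k) * (M * (tail f (c t k) - tail f t)) =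
            bigWeight f δ t * M * (1 - Real.exp (-a)) := by
          rw [← hexp]
          field_simp
        have e3 : 0 ≤ 1 - Real.exp (-a) := by
          have := Real.exp_le_one_iff.2 (neg_nonpos.2 ha)
          linarith
        rw [e1, e2, ← ENNReal.ofReal_add (by positivity) (by positivity),
          ← ENNReal.ofReal_add (by positivity) (by positivity),
          ← ENNReal.ofReal_add (by positivity) (by positivity)]
        refine ENNReal.ofReal_le_ofReal ?_
        have hsum : k * (δ / (k + 1) * bigWeight f δ t) =
            1 - bigWeight f δ t - regWeight f k δ t := by rw [regWeight]; ring
        rw [hsum]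
        have hle1 : regWeight f k δ t ≤ 1 := by
          have : 0 ≤ k * (δ / (k + 1) * bigWeight f δ t) := by positivity
          linarith
        have hd : 0 ≤ ρ₁ * (γ * t ^ (γ - 1) * D) := by positivity
        nlinarith

/-- On the bounded range t ≤ T a step passes the level with probability at least F(T). This removes
ρ₀, and a large ρ₀ pays for the rest, estimated through u^γ ≤ 1 + u. -/
lemma termination_density (h : IsHeavy f) {t T γ ρ₀ ρ₁ : ℝ} (ht : 0 ≤ t) (htT : t ≤ T)
    (hγ0 : 0 ≤ γ) (hγ1 : γ ≤ 1) (hρ0 : 0 ≤ ρ₀) (hρ1 : 0 ≤ ρ₁)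
    (hlarge : 1 + ρ₁ * (1 + T + ∫ x, |x| ∂(law f)) ≤ tail f T * ρ₀) :
    1 + ∫⁻ x in Set.Iic t, ENNReal.ofReal (ρ₀ + ρ₁ * (t - x) ^ γ) * ENNReal.ofReal (f x) ≤
      ENNReal.ofReal (ρ₀ + ρ₁ * t ^ γ) := by
  have hp := h.prob
  set A := ∫ x, |x| ∂(law f) with hA
  have hm : Measurable fun x => ENNReal.ofReal (ρ₀ + ρ₁ * (t - x) ^ γ) := by fun_prop
  have habs : Integrable (fun x : ℝ => ρ₁ * (1 + t + |x|)) (law f) :=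
    ((integrable_const _).add h.int.abs).const_mul _
  have hi : IntegrableOn (fun x : ℝ => ρ₀ + ρ₁ * (1 + t + |x|)) (Set.Iic t) (law f) :=
    ((integrable_const _).add habs).integrableOn
  have e1 : ∫⁻ x in Set.Iic t, ENNReal.ofReal (ρ₀ + ρ₁ * (t - x) ^ γ) * ENNReal.ofReal (f x) =
      ∫⁻ x in Set.Iic t, ENNReal.ofReal (ρ₀ + ρ₁ * (t - x) ^ γ) ∂(law f) := by
    rw [← lintegral_indicator measurableSet_Iic, ← lintegral_indicator measurableSet_Iic,
      lintegral_law h.meas (hm.indicator measurableSet_Iic)]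
    refine lintegral_congr fun x => ?_
    by_cases hx : x ∈ Set.Iic t <;> simp only [hx, Set.indicator_of_mem,
      not_false_eq_true, Set.indicator_of_notMem, zero_mul]
  have e2 : ∫⁻ x in Set.Iic t, ENNReal.ofReal (ρ₀ + ρ₁ * (t - x) ^ γ) ∂(law f) ≤
      ENNReal.ofReal (∫ x in Set.Iic t, ρ₀ + ρ₁ * (1 + t + |x|) ∂(law f)) := by
    rw [ofReal_integral_eq_lintegral_ofReal hi (ae_of_all _ fun x => by
      simp only [Pi.zero_apply]; positivity)]
    refine setLIntegral_mono' measurableSet_Iic fun x hx => ENNReal.ofReal_le_ofReal ?_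
    have h1 := rpow_le_one_add hγ0 hγ1 (sub_nonneg.2 (Set.mem_Iic.1 hx))
    have h2 : (t - x) ^ γ ≤ 1 + t + |x| := by linarith [neg_abs_le x]
    gcongr
  rw [e1]
  refine (add_le_add_right e2 1).trans ?_
  have hnn : 0 ≤ ∫ x in Set.Iic t, ρ₀ + ρ₁ * (1 + t + |x|) ∂(law f) :=
    integral_nonneg fun x => by positivity
  rw [← ENNReal.ofReal_one, ← ENNReal.ofReal_add zero_le_one hnn]
  refine ENNReal.ofReal_le_ofReal ?_
  rw [integral_add (integrable_const _) habs.integrableOn, integral_const, smul_eq_mul,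
    measureReal_restrict_apply MeasurableSet.univ, Set.univ_inter, h.real_Iic]
  have h1 : ∫ x in Set.Iic t, ρ₁ * (1 + t + |x|) ∂(law f) ≤ ρ₁ * (1 + T + A) := by
    calc _ ≤ ∫ x, ρ₁ * (1 + t + |x|) ∂(law f) :=
          setIntegral_le_integral habs (ae_of_all _ fun x => by
            simp only [Pi.zero_apply]; positivity)
      _ = ρ₁ * (1 + t + A) := by
          rw [integral_const_mul, integral_add (integrable_const _) h.int.abs]
          simp [hA]
      _ ≤ _ := by gcongr
  have h2 := mul_le_mul_of_nonneg_right (h.tail_antitone htT) hρ0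
  have h3 : 0 ≤ ρ₁ * t ^ γ := by positivity
  linarith

/-- Bounds for the mean termination time. -/
theorem exists_termination (h : IsHeavy f) (hμ : mean f < 0)
    (hδ : δ ∈ Set.Ioo (0 : ℝ) (1 / 4)) (ha : 0 ≤ a) (hc : GoodCuts f k c a δ) {t₀ : ℝ}
    (ht₀ : 0 < t₀) (hv : ∀ t, κ * intTail f t ^ 2 < 1 → t₀ ≤ t ∧ ValidCuts f k (c t) a t)
    {γ η ε : ℝ} (hγ0 : 0 ≤ γ) (hγ1 : γ ≤ 1) (hη : 0 < η) (hε : 0 < ε)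
    (hdrift : ∀ᶠ t in atTop, γ * t ^ (γ - 1) * (-mean f + η) + ε ≤
      2 * thetaConst f δ * (tail f t / intTail f t) * Real.exp (-a) * t ^ γ) :
    ∃ ρ₀ > 0, ∃ ρ₁ > 0, ∀ b > 0,
      expTermination (sampler f k c δ κ) b ≤ ENNReal.ofReal (ρ₀ + ρ₁ * b ^ γ) := by
  have hp := h.prob
  have hθ := thetaConst_pos hμ hδ
  have hδ0 := hδ.1
  set A := ∫ x, |x| ∂(law f) with hA
  have hA0 : 0 ≤ A := integral_nonneg fun x => abs_nonneg x
  have hr := h.tendsto_ratio hc.longTailed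
  have e1 := (hr.const_mul (2 * thetaConst f δ)).eventually_le_const
    (show 2 * thetaConst f δ * 0 < δ ^ 2 by rw [mul_zero]; positivity)
  have e2 : ∀ᶠ t in atTop, κ * intTail f t ^ 2 < 1 := by
    refine ((h.tendsto_intTail.pow 2).const_mul κ).eventually_lt_const ?_
    simp
  have e3 : ∀ᶠ t in atTop, ∫ x in Set.Iic (c t 0), -x ∂(law f) ≤
      (-mean f + η) * (1 - tail f (c t 0)) := by
    have l1 := h.tendsto_neg_part hc.reg_tendsto
    have l2 := ((h.tendsto_tail.comp hc.reg_tendsto).const_sub 1).const_mul (-mean f + η)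
    filter_upwards [(l2.sub l1).eventually_const_le (u := 0) (by linarith)] with t ht
    simp only [Function.comp_apply] at ht
    linarith
  obtain ⟨T', hT'⟩ := eventually_atTop.1 (((e1.and e2).and e3).and hdrift)
  set T := max T' t₀ with hT
  have hT0 : 0 < T := lt_of_lt_of_le ht₀ (le_max_right _ _)
  -- A lower bound for the large-jump weight that is uniform over 0 ≤ t ≤ T.
  set w := min (2 * thetaConst f δ * tail f T / intTail f 0) (δ ^ 2) with hw
  have hFT := h.tail_pos T
  have hG0 := h.intTail_pos 0
  have hw0 : 0 < w := lt_min (by positivity) (by positivity)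
  set ρ₁ := 1 / ε with hρ₁
  have hρ1 : 0 < ρ₁ := by positivity
  -- The constant 1/ε turns the asymptotic drift into at least 1. `B₁` covers t₀ ≤ t < T, where the
  -- mixture is used before the asymptotics hold, and `B₂` covers the range where the original
  -- density is used.
  set B₁ := (1 + ρ₁ * (γ * t₀ ^ (γ - 1) * (2 * A))) / (w * Real.exp (-a)) with hB₁
  set B₂ := (1 + ρ₁ * (1 + T + A)) / tail f T with hB₂
  have hB1 : 0 < B₁ := by positivity
  have hB2 : 0 < B₂ := by positivity
  set ρ₀ := B₁ + B₂ with hρ₀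
  have hρ0 : 0 < ρ₀ := by positivity
  refine ⟨ρ₀, hρ0, ρ₁, hρ1, fun b hb => ?_⟩
  refine expTermination_le_of_lyapunov (h := fun t => ENNReal.ofReal (ρ₀ + ρ₁ * t ^ γ))
    (fun b => h.measurable_sampler hc.meas δ κ b)
    (h.lintegral_sampler hμ hδ fun t ht => (hv t ht).2) (by fun_prop) hb fun s hs => ?_
  set t := b - s with ht
  have ht0 : 0 ≤ t := by linarith
  simp only [sampler_eq, ← ht]
  split_ifs with hκt
  · obtain ⟨htt, hvt⟩ := hv t hκt
    have htpos : 0 < t := lt_of_lt_of_le ht₀ htt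
    rcases le_or_gt T t with hTt | hTt
    · obtain ⟨⟨⟨h1, h2⟩, h3⟩, h4⟩ := hT' t ((le_max_left _ _).trans hTt)
      refine h.termination_mixture hμ hδ ha htpos hvt hγ0 hγ1 hρ0.le hρ1.le
        (by linarith : 0 ≤ -mean f + η) h3 ?_
      have hbw : bigWeight f δ t = 2 * thetaConst f δ * (tail f t / intTail f t) := by
        rw [bigWeight, mul_div_assoc]
        exact min_eq_left h1
      rw [← hbw] at h4
      have h5 := mul_le_mul_of_nonneg_left h4 hρ1.le
      have h6 : ρ₁ * ε = 1 := by rw [hρ₁]; field_simp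
      have h7 := h.bigWeight_pos hμ hδ t
      have h8 : 0 ≤ bigWeight f δ t * Real.exp (-a) * ρ₀ := by positivity
      linarith
    -- The factor 2 compensates for normalisation: a regular jump has original probability at least
    -- 1/2.
    · refine h.termination_mixture hμ hδ ha htpos hvt hγ0 hγ1 hρ0.le hρ1.le
        (by positivity : 0 ≤ 2 * A) ?_ ?_
      · have h1 : ∫ x in Set.Iic (c t 0), -x ∂(law f) ≤ A := by
          calc _ ≤ ∫ x in Set.Iic (c t 0), |x| ∂(law f) :=
                integral_mono h.int.neg.integrableOn h.int.abs.integrableOn fun x => neg_le_abs x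
            _ ≤ A := setIntegral_le_integral h.int.abs (ae_of_all _ fun x => abs_nonneg x)
        have h2 := hvt.half_le
        nlinarith
      · have h1 : w ≤ bigWeight f δ t := by
          refine min_le_min ?_ le_rfl
          have h2 := h.tail_antitone hTt.le
          have h3 := h.intTail_antitone ht0
          have h4 := h.intTail_pos t
          have h5 := h.tail_pos t
          gcongr
        have h2 : t ^ (γ - 1) ≤ t₀ ^ (γ - 1) :=
          Real.rpow_le_rpow_of_nonpos ht₀ htt (by linarith)
        have h3 : B₁ * (w * Real.exp (-a)) = 1 + ρ₁ * (γ * t₀ ^ (γ - 1) * (2 * A)) := by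
          rw [hB₁]; field_simp
        calc 1 + ρ₁ * (γ * t ^ (γ - 1) * (2 * A))
            ≤ 1 + ρ₁ * (γ * t₀ ^ (γ - 1) * (2 * A)) := by gcongr
          _ = w * Real.exp (-a) * B₁ := by rw [← h3]; ring
          _ ≤ _ := by
            have h7 := h.bigWeight_pos hμ hδ t
            have h8 : B₁ ≤ ρ₀ + ρ₁ * t ^ γ := by
              have : 0 ≤ ρ₁ * t ^ γ := by positivity
              linarith
            gcongr
  · have hTt : t ≤ T := by
      by_contra! hlt
      exact hκt (hT' t ((le_max_left _ _).trans hlt.le)).1.1.2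
    refine h.termination_density ht0 hTt hγ0 hγ1 hρ0.le hρ1.le ?_
    have h3 : tail f T * B₂ = 1 + ρ₁ * (1 + T + A) := by
      rw [hB₂]; field_simp
    rw [← h3]
    gcongr
    linarith

end IsHeavy

end

section

/-! ### Regularly varying tails -/

variable {f : ℝ → ℝ} {ι : ℝ}

lemma RegVaryingTail.tail_pos (hR : RegVaryingTail f ι) (hp : IsProbabilityMeasure (law f)) (t : ℝ) :
    0 < tail f t := by
  obtain ⟨L, hL, htail⟩ := hR
  -- At dilation 1 the ratio is L(x)/L(x), which would be 0 if L(x) = 0; its limit 1 therefore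
  -- forces L to be eventually nonzero.
  have h1 := hL 1 ⟨one_pos, le_rfl⟩
  have h2 : ∀ᶠ x in atTop, L x ≠ 0 := by
    filter_upwards [h1.eventually_ne one_ne_zero] with x hx hx0
    simp [hx0] at hx
  obtain ⟨x, ⟨hx, hxt⟩, hx0⟩ :=
    ((h2.and (eventually_ge_atTop t)).and (eventually_gt_atTop 0)).exists
  have h3 : tail f x ≠ 0 := by
    rw [htail x hx0]
    exact mul_ne_zero hx (Real.rpow_pos_of_pos hx0 _).ne'
  have h4 : 0 < tail f x := lt_of_le_of_ne measureReal_nonneg h3.symm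
  exact h4.trans_le (measureReal_mono (Set.Ioi_subset_Ioi hxt) (measure_ne_top _ _))

namespace IsHeavy

lemma tendsto_tail_mul_div (hR : RegVaryingTail f ι) {s : ℝ} (hs : 0 < s) :
    Tendsto (fun t => tail f (t * s) / tail f t) atTop (𝓝 (s ^ (-ι))) := by
  have key : ∀ s ∈ Set.Ioc (0 : ℝ) 1,
      Tendsto (fun t => tail f (t * s) / tail f t) atTop (𝓝 (s ^ (-ι))) := by
    intro s hs
    obtain ⟨L, hL, htail⟩ := hR
    have h1 := (hL s hs).mul_const (s ^ (-ι))
    rw [one_mul] at h1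
    refine h1.congr' ?_
    filter_upwards [eventually_gt_atTop 0] with t ht
    have h2 := Real.rpow_pos_of_pos ht (-ι)
    rw [htail t ht, htail (t * s) (mul_pos ht hs.1), Real.mul_rpow ht.le hs.1.le]
    field_simp
  rcases le_or_gt s 1 with hs1 | hs1
  · exact key s ⟨hs, hs1⟩
  -- The assumption covers dilations in (0, 1] only; larger ones are inverted.
  · have h1 := ((key s⁻¹ ⟨inv_pos.2 hs, inv_le_one_of_one_le₀ hs1.le⟩).comp
      (tendsto_id.atTop_mul_const hs)).inv₀ (Real.rpow_pos_of_pos (inv_pos.2 hs) _).ne'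
    rw [Real.inv_rpow hs.le, inv_inv] at h1
    refine h1.congr fun t => ?_
    simp only [Function.comp_apply, id_eq, inv_div]
    rw [mul_assoc, mul_inv_cancel₀ hs.ne', mul_one]

lemma exists_tail_lt (h : IsHeavy f) (hR : RegVaryingTail f ι) {b : ℝ} (hb : 1 < b) :
    ∃ η ∈ Set.Ioo (0 : ℝ) 1, ∀ᶠ t in atTop, tail f ((1 - η) * t) < b * tail f t := by
  have h1 : ContinuousAt (fun x : ℝ => (1 - x) ^ (-ι)) 0 :=
    ContinuousAt.rpow_const (by fun_prop) (Or.inl (by norm_num))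
  have h2 : ∀ᶠ x in 𝓝 (0 : ℝ), (1 - x) ^ (-ι) < b :=
    h1.eventually_lt_const (by simpa using hb)
  have h3 : ∀ᶠ x in 𝓝[>] (0 : ℝ), (1 - x) ^ (-ι) < b := h2.filter_mono nhdsWithin_le_nhds
  obtain ⟨η, hη, hη01⟩ := (h3.and (Ioo_mem_nhdsGT (show (0 : ℝ) < 1 by norm_num))).exists
  refine ⟨η, hη01, ?_⟩
  filter_upwards [(tendsto_tail_mul_div hR (sub_pos.2 hη01.2)).eventually_lt_const hη] with t ht
  rw [div_lt_iff₀ (h.tail_pos t), mul_comm t] at ht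
  exact ht

/-- A fixed shift is eventually smaller than the dilation by 1 - η, and the latter changes the tail
by a factor close to 1. -/
lemma longTailed_of_regVarying (h : IsHeavy f) (hR : RegVaryingTail f ι) : LongTailed f := by
  refine longTailed_of_nonneg fun x hx => ?_
  refine tendsto_order.2 ⟨fun b hb => ?_, fun b hb => ?_⟩
  · refine Eventually.of_forall fun t => hb.trans_le ?_
    rw [one_le_div (h.tail_pos t)]
    exact h.tail_antitone (by linarith)
  · obtain ⟨η, hη, hev⟩ := h.exists_tail_lt hR hb
    filter_upwards [hev, eventually_ge_atTop (x / η)] with t ht hxt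
    rw [div_lt_iff₀ (h.tail_pos t)]
    refine (h.tail_antitone ?_).trans_lt ht
    have := (div_le_iff₀ hη.1).1 hxt
    linarith

/-- A one-sided form of Karamata's theorem. -/
lemma exists_mul_intTail_le (h : IsHeavy f) (hι : 3 / 2 < ι) (hR : RegVaryingTail f ι) :
    ∃ A > 1 / 2, ∀ᶠ t in atTop, A * intTail f t ≤ t * tail f t := by
  -- The slope of x^(1-ι) at 1 is 1 - ι < -1/2. So some x > 1 has x · x^(-ι) < 1 - (x - 1)/2, and
  -- there is room for a q > x^(-ι) with xq below the same bound.
  have hd : HasDerivAt (fun x : ℝ => x ^ (1 - ι)) (1 - ι) 1 := by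
    simpa using Real.hasDerivAt_rpow_const (x := 1) (p := 1 - ι) (Or.inl one_ne_zero)
  have h1 : Tendsto (slope (fun x : ℝ => x ^ (1 - ι)) 1) (𝓝[>] 1) (𝓝 (1 - ι)) :=
    (hasDerivAt_iff_tendsto_slope.1 hd).mono_left
      (nhdsWithin_mono _ (fun x (hx : 1 < x) => (ne_of_gt hx : x ≠ 1)))
  obtain ⟨x, hx, hx1⟩ := ((h1.eventually_lt_const (show 1 - ι < -(1 / 2) by linarith)).and
    self_mem_nhdsWithin).exists
  have hx0 : 0 < x := by linarith
  rw [slope_def_field, div_lt_iff₀ (by linarith), Real.one_rpow, sub_eq_add_neg 1 ι,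
    Real.rpow_add hx0, Real.rpow_one] at hx
  obtain ⟨q, hq, hqx⟩ := exists_between (show x ^ (-ι) < (1 - (x - 1) / 2) / x by
    rw [lt_div_iff₀ hx0]; linarith)
  rw [lt_div_iff₀ hx0] at hqx
  -- Regular variation gives G(xt) ≤ xq G(t), while G(t) - G(xt) ≤ (x - 1)t F(t); combining the two
  -- gives this constant.
  refine ⟨(1 - x * q) / (x - 1), ?_, ?_⟩
  · rw [gt_iff_lt, lt_div_iff₀ (by linarith)]; linarith
  obtain ⟨T, hT⟩ := eventually_atTop.1
    ((tendsto_tail_mul_div hR hx0).eventually_lt_const hq)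
  filter_upwards [eventually_ge_atTop T, eventually_ge_atTop 0] with t ht ht0
  have e1 : intTail f (x * t) ≤ x * q * intTail f t := by
    have e2 := integral_comp_mul_left_Ioi (tail f) t hx0
    rw [smul_eq_mul] at e2
    have e3 : ∫ s in Set.Ioi t, tail f (x * s) ≤ ∫ s in Set.Ioi t, q * tail f s := by
      refine setIntegral_mono_on ((integrableOn_Ioi_comp_mul_left_iff _ _ hx0).2
        (h.integrableOn_tail _)) ((h.integrableOn_tail t).const_mul q) measurableSet_Ioi
        fun s hs => ?_
      have := hT s (ht.trans (Set.mem_Ioi.1 hs).le)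
      rw [div_lt_iff₀ (h.tail_pos s), mul_comm s] at this
      exact this.le
    rw [e2, integral_const_mul] at e3
    have e4 := mul_le_mul_of_nonneg_left e3 hx0.le
    rw [mul_inv_cancel_left₀ hx0.ne'] at e4
    rw [mul_assoc]
    exact e4
  have e2 := h.intTail_sub_le (show t ≤ x * t by nlinarith)
  rw [div_mul_eq_mul_div, div_le_iff₀ (by linarith)]
  linarith

lemma tendsto_shiftedInv (h : IsHeavy f) (a : ℝ) :
    Tendsto (fun t => cumHazInv f (cumHaz f t - a)) atTop atTop := by
  refine tendsto_atTop.2 fun M => ?_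
  have h1 : ∀ᶠ t in atTop, Real.exp a * tail f t < tail f M :=
    (h.tendsto_tail.const_mul (Real.exp a)).eventually_lt_const (by simpa using h.tail_pos M)
  filter_upwards [h1, h.tendsto_cumHaz.eventually_gt_atTop a] with t ht hta
  exact (h.lt_cumHazInv hta ht).le

lemma goodCuts_regCuts (h : IsHeavy f) (hι : 3 / 2 < ι) (hR : RegVaryingTail f ι) {a : ℝ}
    (ha : 0 < a) (δ : ℝ) : GoodCuts f 0 (regCuts f a) a δ where
  meas _ := h.measurable_shiftedInv a
  longTailed := h.longTailed_of_regVarying hR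
  valid := by
    filter_upwards [h.tendsto_cumHaz.eventually_gt_atTop a,
      (h.tendsto_shiftedInv a).eventually_ge_atTop 0,
      (h.tendsto_tail.comp (h.tendsto_shiftedInv a)).eventually_le_const
        (show (0 : ℝ) < 1 / 2 by norm_num)] with t h1 h2 h3
    simp only [Function.comp_apply] at h3
    exact
      { cut_nonneg := fun _ _ => h2
        reg_le := h.cumHazInv_le ha.le h1
        half_le := by simp only [regCuts]; linarith
        big := h.tail_cumHazInv h1
        mid_pos := by simp
        interp_pos := by simp
        density_pos := by simp }
  reg_tendsto := h.tendsto_shiftedInv a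
  reg_dom := by
    -- Since F((1 - η)t) < e^a F(t), the cut point is at most (1 - η)t, so t - c₀ ≥ ηt. There F is
    -- comparable to F(t) by regular variation, and G to t F(t) by the Karamata bound from above and
    -- G(t) ≥ t F(2t) from below.
    obtain ⟨η, hη, hev⟩ := h.exists_tail_lt hR (Real.one_lt_exp_iff.2 ha)
    obtain ⟨A, hA, hAev⟩ := h.exists_mul_intTail_le hι hR
    have hη0 := hη.1
    set C₁ := η ^ (-ι) + 1
    set c₂ := (2 : ℝ) ^ (-ι) / 2 with hc₂
    have hC1 : 0 < C₁ := by positivity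
    have hc2 : 0 < c₂ := by positivity
    have hA0 : 0 < A := by linarith
    refine ⟨C₁ * (η * C₁ / (A * c₂)), ?_⟩
    have l1 := (tendsto_tail_mul_div hR hη0).eventually_lt_const (lt_add_one _)
    have l2 := (tendsto_tail_mul_div hR two_pos).eventually_const_lt
      (show c₂ < 2 ^ (-ι) by
        have : (0 : ℝ) < 2 ^ (-ι) := by positivity
        linarith)
    filter_upwards [hev, l1, l2, h.tendsto_cumHaz.eventually_gt_atTop a, eventually_gt_atTop 0,
      (tendsto_id.const_mul_atTop hη0).eventually hAev] with t h1 h2 h3 h4 h5 h6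
    simp only [id_eq] at h6
    have hF := h.tail_pos t
    have hc0 : regCuts f a t 0 ≤ (1 - η) * t := by
      by_contra! hlt
      have := h.tail_antitone hlt.le
      rw [regCuts, h.tail_cumHazInv h4] at this
      linarith
    have h7 : η * t ≤ t - regCuts f a t 0 := by linarith
    rw [div_lt_iff₀ hF] at h2
    rw [lt_div_iff₀ hF] at h3
    rw [mul_comm t] at h2 h3
    have g1 : tail f (t - regCuts f a t 0) ≤ C₁ * tail f t := (h.tail_antitone h7).trans h2.le
    have g2 : t * (c₂ * tail f t) ≤ intTail f t := by
      have := h.le_intTail_sub (show t ≤ 2 * t by linarith)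
      have := h.intTail_nonneg (2 * t)
      have : t * (c₂ * tail f t) ≤ t * tail f (2 * t) := by gcongr
      linarith
    have g3 : intTail f (t - regCuts f a t 0) ≤ η * C₁ / (A * c₂) * intTail f t := by
      have e1 := h.intTail_antitone h7
      have e2 : η * t * tail f (η * t) ≤ η * t * (C₁ * tail f t) := by gcongr
      calc intTail f (t - regCuts f a t 0) ≤ intTail f (η * t) := e1
        _ ≤ η * t * (C₁ * tail f t) / A := by
            rw [le_div_iff₀ hA0]; linarith
        _ = η * C₁ / (A * c₂) * (t * (c₂ * tail f t)) := by field_simp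
        _ ≤ _ := by gcongr
    calc _ ≤ C₁ * tail f t * (η * C₁ / (A * c₂) * intTail f t) := by
          have := h.intTail_nonneg (t - regCuts f a t 0)
          gcongr
      _ = _ := by ring
  mid η hη := by
    refine Eventually.of_forall fun t => ?_
    simp [regCuts]

/-- The two-component scheme for regularly varying tails. -/
theorem regVarying_scheme (h : IsHeavy f) (hμ : mean f < 0) (hι : 3 / 2 < ι)
    (hR : RegVaryingTail f ι) {Ω : Type*} [MeasurableSpace Ω] {P : Measure Ω}
    [IsProbabilityMeasure P] {X : ℕ → Ω → ℝ} (hX : ∀ n, Measurable (X n))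
    (hindep : iIndepFun X P) (hlaw : ∀ n, P.map (X n) = law f)
    (hint : Integrable (X 0) P) (hmean : ∫ ω, X 0 ω ∂P < 0) :
    ∃ ε > 0, ∀ aBig ∈ Set.Ioo (0 : ℝ) ε, ∀ δ₀ ∈ Set.Ioo (0 : ℝ) (min ε (1 / 4)),
      ∃ κ₀ > 0, ∀ κ ≥ κ₀, StronglyEfficient P X f (sampler f 0 (regCuts f aBig) δ₀ κ) ∧
        ∃ ρ₀ > 0, ∃ ρ₁ > 0, ∀ b > 0,
          expTermination (sampler f 0 (regCuts f aBig) δ₀ κ) b ≤ ENNReal.ofReal (ρ₀ + ρ₁ * b) := by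
  obtain ⟨A, hA, hAev⟩ := h.exists_mul_intTail_le hι hR
  -- At δ = a = 0 this expression is 2A > 1; continuity keeps it above 1 for small parameters, and
  -- this is where their smallness enters.
  have hcont : ContinuousAt (fun p : ℝ × ℝ =>
      2 * ((1 - p.1) / (1 + p.1) ^ 5) * A * Real.exp (-p.2)) (0, 0) := by
    have : ContinuousAt (fun p : ℝ × ℝ => (1 - p.1) / (1 + p.1) ^ 5) (0, 0) :=
      ContinuousAt.div (by fun_prop) (by fun_prop) (by norm_num)
    fun_prop
  have hnear : ∀ᶠ p : ℝ × ℝ in 𝓝 (0, 0),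
      1 < 2 * ((1 - p.1) / (1 + p.1) ^ 5) * A * Real.exp (-p.2) :=
    hcont.tendsto.eventually_const_lt (by simp; linarith)
  obtain ⟨ε, hε, hball⟩ := Metric.eventually_nhds_iff.1 hnear
  refine ⟨ε, hε, fun a ha δ hδ => ?_⟩
  have hδ' : δ ∈ Set.Ioo (0 : ℝ) (1 / 4) := ⟨hδ.1, hδ.2.trans_le (min_le_right _ _)⟩
  have hone : 1 < 2 * ((1 - δ) / (1 + δ) ^ 5) * A * Real.exp (-a) := by
    refine hball (y := (δ, a)) ?_
    rw [Prod.dist_eq, Real.dist_eq, Real.dist_eq]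
    simp only [sub_zero, abs_of_pos hδ.1, abs_of_pos ha.1]
    exact max_lt (hδ.2.trans_le (min_le_left _ _)) ha.2
  have hgood := h.goodCuts_regCuts hι hR ha.1 δ
  obtain ⟨κ₀, hκ₀, hκ⟩ := h.exists_stronglyEfficient hμ hδ' hgood hX hindep hlaw hint hmean
  refine ⟨κ₀, hκ₀, fun κ hκκ => ⟨(hκ κ hκκ).1, ?_⟩⟩
  obtain ⟨t₀, ht₀, hv⟩ := (hκ κ hκκ).2
  -- The excess of 2θA e^(-a) over -μ: one half allows for the truncated mean, the other is the
  -- drift.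
  set D := -mean f * (2 * ((1 - δ) / (1 + δ) ^ 5) * A * Real.exp (-a) - 1) with hD
  have hD0 : 0 < D := mul_pos (by linarith) (by linarith)
  have hdrift : ∀ᶠ t in atTop, (1 : ℝ) * t ^ ((1 : ℝ) - 1) * (-mean f + D / 2) + D / 2 ≤
      2 * thetaConst f δ * (tail f t / intTail f t) * Real.exp (-a) * t ^ (1 : ℝ) := by
    filter_upwards [hAev] with t ht
    have hG := h.intTail_pos t
    have hθ := thetaConst_pos hμ hδ'
    rw [sub_self, Real.rpow_zero, Real.rpow_one]
    have e1 : A ≤ tail f t / intTail f t * t := by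
      rw [div_mul_eq_mul_div, le_div_iff₀ hG]; linarith
    calc _ = 2 * thetaConst f δ * A * Real.exp (-a) := by
          rw [hD, thetaConst]; ring
      _ ≤ 2 * thetaConst f δ * (tail f t / intTail f t * t) * Real.exp (-a) := by gcongr
      _ = _ := by ring
  simpa using h.exists_termination hμ hδ' ha.1.le hgood ht₀ hv zero_le_one le_rfl (half_pos hD0)
    (half_pos hD0) hdrift

end IsHeavy

end

section

/-! ### Semiexponential tails: the hazard function -/

/-- The hazard function is only monotone, so Λ' = λ can fail at countably many points; differential
inequalities still integrate. -/
lemma le_of_hasDerivAt_off_countable {g g' : ℝ → ℝ} {s t : ℝ} (hst : s ≤ t) {S : Set ℝ}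
    (hS : S.Countable) (hc : ContinuousOn g (Set.Icc s t))
    (hd : ∀ x ∈ Set.Ioo s t \ S, HasDerivAt g (g' x) x) (hi : IntervalIntegrable g' volume s t)
    (hle : ∀ x ∈ Set.Icc s t, g' x ≤ 0) : g t ≤ g s := by
  have h1 := integral_eq_of_hasDerivAt_off_countable_of_le g g' hst hS hc hd hi
  have h2 : ∫ x in s..t, g' x ≤ 0 :=
    (intervalIntegral.integral_mono_on hst hi intervalIntegrable_const hle).trans_eq (by simp)
  linarith

/-- The assumptions on a semiexponential tail, on a half-line where the hazard function is positive
and the cumulative hazard is at least one. -/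
structure RegularHazard (f : ℝ → ℝ) (b β : ℝ) : Prop where
  one_le : 1 ≤ b
  β_pos : 0 < β
  β_lt_one : β < 1
  haz_pos : ∀ x ≥ b, 0 < haz f x
  one_le_cumHaz : ∀ x ≥ b, 1 ≤ cumHaz f x
  haz_le : ∀ x ≥ b, x * haz f x ≤ β * cumHaz f x
  anti : AntitoneOn (haz f) (Set.Ici b)
  tendsto_mul_haz : Tendsto (fun x => x * haz f x) atTop atTop

variable {f : ℝ → ℝ} {b₀ b β : ℝ}

lemma SemiexpTail.tail_pos (hS : SemiexpTail f b₀ β) (hp : IsProbabilityMeasure (law f)) (t : ℝ) :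
    0 < tail f t := by
  obtain ⟨x, hx, hxt⟩ := ((hS.tendsto_mul_haz.eventually_gt_atTop 0).and
    (eventually_ge_atTop t)).exists
  have h3 : tail f x ≠ 0 := by
    -- If the tail vanished at x, division by zero would make the hazard there 0, against `hx`.
    intro h0
    simp [haz, h0] at hx
  have h4 : 0 < tail f x := lt_of_le_of_ne measureReal_nonneg h3.symm
  exact h4.trans_le (measureReal_mono (Set.Ioi_subset_Ioi hxt) (measure_ne_top _ _))

namespace IsHeavy

lemma exists_regularHazard (h : IsHeavy f) (hS : SemiexpTail f b₀ β) :
    ∃ b, RegularHazard f b β := by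
  obtain ⟨T, hT⟩ := eventually_atTop.1 ((hS.tendsto_mul_haz.eventually_gt_atTop 0).and
    (h.tendsto_cumHaz.eventually_ge_atTop 1))
  set b := max 1 (max b₀ T) with hb
  have hb1 : 1 ≤ b := le_max_left _ _
  have hb0 : b₀ ≤ b := (le_max_left _ _).trans (le_max_right _ _)
  have hbT : T ≤ b := (le_max_right _ _).trans (le_max_right _ _)
  refine ⟨b, hb1, hS.β₀_pos, hS.β₀_lt_one, fun x hx => ?_, fun x hx => (hT x (hbT.trans hx)).2,
    fun x hx => ?_, hS.haz_antitone.mono (Set.Ici_subset_Ici.2 hb0), hS.tendsto_mul_haz⟩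
  · have h1 := (hT x (hbT.trans hx)).1
    have hx0 : 0 < x := by linarith [show b ≤ x from hx]
    exact (pos_iff_pos_of_mul_pos h1).1 hx0
  · have h1 := (hT x (hbT.trans hx)).2
    have hx0 : 0 < x := by linarith [show b ≤ x from hx]
    have h2 := hS.haz_div_cumHaz_le x (hb0.trans hx)
    rw [div_le_div_iff₀ (by linarith) hx0] at h2
    linarith

lemma density_eq (h : IsHeavy f) (x : ℝ) : f x = haz f x * tail f x := by
  rw [haz, div_mul_cancel₀ _ (h.tail_pos x).ne']

lemma continuous_intTail (h : IsHeavy f) : Continuous (intTail f) := by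
  have h1 : intTail f = fun t => intTail f 0 - ∫ x in (0 : ℝ)..t, tail f x := by
    funext t
    rw [← h.intTail_sub]; ring
  rw [h1]
  exact continuous_const.sub (intervalIntegral.continuous_primitive
    (fun _ _ => h.continuous_tail.intervalIntegrable _ _) 0)

lemma hasDerivAt_intTail (h : IsHeavy f) (x : ℝ) : HasDerivAt (intTail f) (-tail f x) x := by
  have h1 : intTail f = fun t => intTail f 0 - ∫ x in (0 : ℝ)..t, tail f x := by
    funext t
    rw [← h.intTail_sub]; ring
  rw [h1]
  exact (intervalIntegral.integral_hasDerivAt_right (h.continuous_tail.intervalIntegrable _ _)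
    (h.continuous_tail.stronglyMeasurableAtFilter _ _) h.continuous_tail.continuousAt).const_sub _

lemma hasDerivAt_tail (h : IsHeavy f) {x : ℝ} (hx : ContinuousAt (haz f) x) :
    HasDerivAt (tail f) (-f x) x := by
  have h1 : tail f = fun t => tail f 0 - ∫ x in (0 : ℝ)..t, f x := by
    funext t
    rw [← h.tail_sub_eq_integral]; ring
  have h2 : ContinuousAt f x := by
    have : f = fun x => haz f x * tail f x := funext h.density_eq
    rw [this]
    exact hx.mul h.continuous_tail.continuousAt
  rw [h1]
  exact (intervalIntegral.integral_hasDerivAt_right h.integrable.intervalIntegrable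
    h.meas.stronglyMeasurable.stronglyMeasurableAtFilter h2).const_sub _

lemma hasDerivAt_cumHaz (h : IsHeavy f) {x : ℝ} (hx : ContinuousAt (haz f) x) :
    HasDerivAt (cumHaz f) (haz f x) x := by
  have := ((h.hasDerivAt_tail hx).log (h.tail_pos x).ne').neg
  rw [neg_div, neg_neg] at this
  exact this

end IsHeavy

namespace RegularHazard

lemma countable_not_continuousAt (hz : RegularHazard f b β) :
    {x ∈ Set.Ioi b | ¬ContinuousAt (haz f) x}.Countable := by
  refine Set.Countable.mono (fun x hx => ?_) hz.anti.countable_not_continuousWithinAt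
  exact ⟨(Set.mem_Ioi.1 hx.1).le, fun hc => hx.2 (hc.continuousAt (Ici_mem_nhds hx.1))⟩

lemma continuousAt_of_notMem {s t x : ℝ} (hs : b ≤ s)
    (hx : x ∈ Set.Ioo s t \ {x ∈ Set.Ioi b | ¬ContinuousAt (haz f) x}) :
    ContinuousAt (haz f) x := by
  by_contra hc
  exact hx.2 ⟨hs.trans_lt hx.1.1, hc⟩

lemma intervalIntegrable_haz (hz : RegularHazard f b β) {s t : ℝ} (hs : b ≤ s) (hst : s ≤ t) :
    IntervalIntegrable (haz f) volume s t := by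
  refine AntitoneOn.intervalIntegrable (hz.anti.mono ?_)
  rw [Set.uIcc_of_le hst]
  exact fun x hx => hs.trans hx.1

lemma cumHaz_sub_le (hz : RegularHazard f b β) (h : IsHeavy f) {s t : ℝ} (hs : b ≤ s)
    (hst : s ≤ t) : cumHaz f t - cumHaz f s ≤ haz f s * (t - s) := by
  have := le_of_hasDerivAt_off_countable (g := fun x => cumHaz f x - haz f s * x)
    (g' := fun x => haz f x - haz f s) hst hz.countable_not_continuousAt
    ((h.continuous_cumHaz.sub (continuous_const.mul continuous_id)).continuousOn)
    (fun x hx => (h.hasDerivAt_cumHaz (continuousAt_of_notMem hs hx)).sub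
      (by simpa using (hasDerivAt_id x).const_mul (haz f s)))
    ((hz.intervalIntegrable_haz hs hst).sub intervalIntegrable_const)
    (fun x hx => sub_nonpos.2 (hz.anti hs (hs.trans hx.1) hx.1))
  linarith

lemma le_cumHaz_sub (hz : RegularHazard f b β) (h : IsHeavy f) {s t : ℝ} (hs : b ≤ s)
    (hst : s ≤ t) : haz f t * (t - s) ≤ cumHaz f t - cumHaz f s := by
  have := le_of_hasDerivAt_off_countable (g := fun x => haz f t * x - cumHaz f x)
    (g' := fun x => haz f t - haz f x) hst hz.countable_not_continuousAt
    (((continuous_const.mul continuous_id).sub h.continuous_cumHaz).continuousOn)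
    (fun x hx => HasDerivAt.sub (by simpa using (hasDerivAt_id x).const_mul (haz f t))
      (h.hasDerivAt_cumHaz (continuousAt_of_notMem hs hx)))
    (intervalIntegrable_const.sub (hz.intervalIntegrable_haz hs hst))
    (fun x hx => sub_nonpos.2 (hz.anti (hs.trans hx.1) (hs.trans hst) hx.2))
  linarith

lemma tail_lt (hz : RegularHazard f b β) (h : IsHeavy f) {s t : ℝ} (hs : b ≤ s) (hst : s < t) :
    tail f t < tail f s := by
  have h1 := hz.le_cumHaz_sub h hs hst.le
  have h2 := mul_pos (hz.haz_pos t (hs.trans hst.le)) (sub_pos.2 hst)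
  rw [h.tail_eq_exp, h.tail_eq_exp, Real.exp_lt_exp]
  linarith

/-- The cumulative hazard grows at most like a power, relative to any starting point. -/
lemma rpow_mul_cumHaz_le (hz : RegularHazard f b β) (h : IsHeavy f) {s t : ℝ} (hs : b ≤ s)
    (hst : s ≤ t) : (s / t) ^ β * cumHaz f t ≤ cumHaz f s := by
  have hs0 : 0 < s := by linarith [hz.one_le]
  have ht0 : 0 < t := by linarith
  have hcs := hz.one_le_cumHaz s hs
  have hct := hz.one_le_cumHaz t (hs.trans hst)
  have hpos : ∀ x ∈ Set.Icc s t, x ≠ 0 := fun x hx => (hs0.trans_le hx.1).ne'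
  have hcpos : ∀ x ∈ Set.Icc s t, cumHaz f x ≠ 0 := fun x hx => by
    linarith [hz.one_le_cumHaz x (hs.trans hx.1)]
  -- log Λ has derivative λ/Λ ≤ β/x, so log Λ(x) - β log x is non-increasing.
  have h1 := le_of_hasDerivAt_off_countable
    (g := fun x => Real.log (cumHaz f x) - β * Real.log x)
    (g' := fun x => haz f x / cumHaz f x - β * x⁻¹) hst hz.countable_not_continuousAt
    ((h.continuous_cumHaz.continuousOn.log hcpos).sub
      (continuousOn_const.mul (continuousOn_id.log hpos)))
    (fun x hx => ((h.hasDerivAt_cumHaz (continuousAt_of_notMem hs hx)).log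
      (hcpos x (Set.Ioo_subset_Icc_self hx.1))).sub
      ((Real.hasDerivAt_log (hpos x (Set.Ioo_subset_Icc_self hx.1))).const_mul β))
    (by
      rw [← Set.uIcc_of_le hst] at hpos hcpos
      refine IntervalIntegrable.sub ?_ ?_
      · simp only [div_eq_mul_inv]
        exact (hz.intervalIntegrable_haz hs hst).mul_continuousOn
          (h.continuous_cumHaz.continuousOn.inv₀ hcpos)
      · exact (continuousOn_const.mul (continuousOn_id.inv₀ hpos)).intervalIntegrable)
    (fun x hx => by
      have hx0 : 0 < x := hs0.trans_le hx.1
      have hc := hz.one_le_cumHaz x (hs.trans hx.1)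
      have := hz.haz_le x (hs.trans hx.1)
      rw [sub_nonpos, ← div_eq_mul_inv, div_le_div_iff₀ (by linarith) hx0]
      linarith)
  rw [← Real.log_le_log_iff (by positivity) (by linarith), Real.log_mul (by positivity)
    (by linarith), Real.log_rpow (by positivity), Real.log_div hs0.ne' ht0.ne']
  linarith

/-- λ ≤ βΛ/x, and Λ grows at most like x^β. -/
lemma haz_le_rpow (hz : RegularHazard f b β) (h : IsHeavy f) :
    ∃ C > 0, ∀ x ≥ b, haz f x ≤ C * x ^ (β - 1) := by
  have hb0 : 0 < b := by linarith [hz.one_le]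
  have hcb := hz.one_le_cumHaz b le_rfl
  have hβ := hz.β_pos
  refine ⟨β * (cumHaz f b / b ^ β), by positivity, fun x hx => ?_⟩
  have hx0 : 0 < x := hb0.trans_le hx
  have h1 := hz.haz_le x hx
  have h2 := hz.rpow_mul_cumHaz_le h le_rfl hx
  rw [Real.div_rpow hb0.le hx0.le, div_mul_eq_mul_div, div_le_iff₀ (by positivity)] at h2
  have h3 : cumHaz f x ≤ cumHaz f b / b ^ β * x ^ β := by
    rw [div_mul_eq_mul_div, le_div_iff₀ (by positivity)]; linarith
  rw [Real.rpow_sub hx0, Real.rpow_one, ← mul_div_assoc, le_div_iff₀ hx0]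
  have h4 := mul_le_mul_of_nonneg_left h3 hβ.le
  linarith

lemma tendsto_haz (hz : RegularHazard f b β) (h : IsHeavy f) : Tendsto (haz f) atTop (𝓝 0) := by
  obtain ⟨C, hC, hle⟩ := hz.haz_le_rpow h
  have h1 : Tendsto (fun x : ℝ => C * x ^ (β - 1)) atTop (𝓝 0) := by
    have := (tendsto_rpow_neg_atTop (sub_pos.2 hz.β_lt_one)).const_mul C
    rw [mul_zero] at this
    simpa only [neg_sub] using this
  refine tendsto_of_tendsto_of_tendsto_of_le_of_le' tendsto_const_nhds h1 ?_ ?_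
  · filter_upwards [eventually_ge_atTop b] with x hx using (hz.haz_pos x hx).le
  · filter_upwards [eventually_ge_atTop b] with x hx using hle x hx

lemma longTailed (hz : RegularHazard f b β) (h : IsHeavy f) : LongTailed f := by
  refine IsHeavy.longTailed_of_nonneg fun x hx => ?_
  have h1 : Tendsto (fun t => Real.exp (haz f (t - x) * x)) atTop (𝓝 1) := by
    have := (((hz.tendsto_haz h).comp (tendsto_atTop_add_const_right atTop (-x) tendsto_id)).mul_const
      x).rexp
    simpa [← sub_eq_add_neg, Function.comp_def] using this
  refine tendsto_of_tendsto_of_tendsto_of_le_of_le' tendsto_const_nhds h1 ?_ ?_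
  · refine Eventually.of_forall fun t => ?_
    rw [one_le_div (h.tail_pos t)]
    exact h.tail_antitone (by linarith)
  · filter_upwards [eventually_ge_atTop (b + x)] with t ht
    have h2 := hz.cumHaz_sub_le h (show b ≤ t - x by linarith) (show t - x ≤ t by linarith)
    rw [h.tail_eq_exp, h.tail_eq_exp, ← Real.exp_sub, Real.exp_le_exp]
    rw [sub_sub_cancel] at h2
    linarith

/-- The derivative is F times p t^(p-1) + c - t^p λ. This monotonicity turns lower bounds on λ into
lower bounds on F/G. -/
lemma antitoneOn_rpow_mul_tail_sub (hz : RegularHazard f b β) (h : IsHeavy f) {p c T : ℝ}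
    (hT : b ≤ T) (hp : ∀ t ≥ T, p * t ^ (p - 1) + c ≤ t ^ p * haz f t) :
    AntitoneOn (fun t => t ^ p * tail f t - c * intTail f t) (Set.Ici T) := by
  intro s hs t _ hst
  have hbs : b ≤ s := hT.trans hs
  have hs0 : 0 < s := by linarith [hz.one_le]
  have hpos : ∀ x ∈ Set.Icc s t, x ≠ 0 := fun x hx => (hs0.trans_le hx.1).ne'
  have hrp : ∀ q : ℝ, ContinuousOn (fun x : ℝ => x ^ q) (Set.Icc s t) := fun q =>
    continuousOn_id.rpow_const fun x hx => Or.inl (hpos x hx)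
  refine le_of_hasDerivAt_off_countable (g := fun t => t ^ p * tail f t - c * intTail f t)
    (g' := fun x => (p * x ^ (p - 1) * tail f x + x ^ p * -f x) - c * -tail f x) hst
    hz.countable_not_continuousAt (((hrp p).mul h.continuous_tail.continuousOn).sub
      (continuous_const.mul h.continuous_intTail).continuousOn) (fun x hx => ?_) ?_ fun x hx => ?_
  · exact ((Real.hasDerivAt_rpow_const (Or.inl (hpos x (Set.Ioo_subset_Icc_self hx.1)))).mul
      (h.hasDerivAt_tail (continuousAt_of_notMem hbs hx))).sub ((h.hasDerivAt_intTail x).const_mul c)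
  · rw [← Set.uIcc_of_le hst] at hrp
    refine IntervalIntegrable.sub (IntervalIntegrable.add ?_ ?_) ?_
    · exact ((continuousOn_const.mul (hrp _)).mul h.continuous_tail.continuousOn).intervalIntegrable
    · exact h.integrable.neg.intervalIntegrable.continuousOn_mul (hrp p)
    · exact (continuous_const.mul h.continuous_tail.neg).intervalIntegrable _ _
  · have h1 := hp x (show T ≤ x from le_trans hs hx.1)
    have h2 := mul_le_mul_of_nonneg_right h1 (h.tail_pos x).le
    rw [h.density_eq x]
    linarith

lemma eventually_rpow_le (hz : RegularHazard f b β) (p N : ℝ) :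
    ∀ᶠ t in atTop, N * t ^ (p - 1) ≤ t ^ p * haz f t := by
  filter_upwards [hz.tendsto_mul_haz.eventually_ge_atTop N, eventually_gt_atTop 0] with t ht ht0
  have h1 : t ^ p = t ^ (p - 1) * t := by
    rw [← Real.rpow_add_one ht0.ne', sub_add_cancel]
  have h2 := mul_le_mul_of_nonneg_left ht (Real.rpow_pos_of_pos ht0 (p - 1)).le
  rw [h1]
  linarith

/-- With the exponent p + 1 and c = 0 the monotone quantity is bounded, which leaves t^p F ≤ C/t. -/
lemma tendsto_rpow_mul_tail (hz : RegularHazard f b β) (h : IsHeavy f) (p : ℝ) :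
    Tendsto (fun t => t ^ p * tail f t) atTop (𝓝 0) := by
  obtain ⟨T, hT⟩ := eventually_atTop.1 (hz.eventually_rpow_le (p + 1) (p + 1))
  have h1 := hz.antitoneOn_rpow_mul_tail_sub h (p := p + 1) (c := 0) (le_max_left b T)
    (fun t ht => by rw [add_zero]; exact hT t ((le_max_right b T).trans ht))
  set C := (max b T) ^ (p + 1) * tail f (max b T)
  have h2 : Tendsto (fun t : ℝ => C / t) atTop (𝓝 0) := tendsto_const_nhds.div_atTop tendsto_id
  refine tendsto_of_tendsto_of_tendsto_of_le_of_le' tendsto_const_nhds h2 ?_ ?_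
  · filter_upwards [eventually_gt_atTop 0] with t ht
    have := h.tail_pos t
    positivity
  · filter_upwards [eventually_ge_atTop (max b T), eventually_gt_atTop 0] with t ht ht0
    have h3 := h1 Set.self_mem_Ici ht ht
    simp only [zero_mul, sub_zero, Real.rpow_add_one ht0.ne' p] at h3
    rw [le_div_iff₀ ht0]
    linarith

/-- The difference of the two sides is eventually non-increasing and tends to 0, hence nonnegative.
-/
lemma eventually_mul_intTail_le (hz : RegularHazard f b β) (h : IsHeavy f) {p c : ℝ}
    (hp : ∀ᶠ t in atTop, p * t ^ (p - 1) + c ≤ t ^ p * haz f t) :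
    ∀ᶠ t in atTop, c * intTail f t ≤ t ^ p * tail f t := by
  obtain ⟨T, hT⟩ := eventually_atTop.1 hp
  have h1 := hz.antitoneOn_rpow_mul_tail_sub h (p := p) (c := c) (le_max_left b T)
    (fun t ht => hT t ((le_max_right b T).trans ht))
  have h2 : Tendsto (fun t => t ^ p * tail f t - c * intTail f t) atTop (𝓝 0) := by
    simpa using (hz.tendsto_rpow_mul_tail h p).sub (h.tendsto_intTail.const_mul c)
  filter_upwards [eventually_ge_atTop (max b T)] with t ht
  have h3 := le_of_tendsto h2 ((eventually_ge_atTop t).mono fun s hs => h1 ht (ht.trans hs) hs)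
  linarith

end RegularHazard

end

section

/-! ### Semiexponential tails: the cut points -/

variable {f : ℝ → ℝ} {b β : ℝ}

/-- The distance from `t` of the point where the cumulative hazard is smaller by `a`. -/
def hazGap (f : ℝ → ℝ) (a t : ℝ) : ℝ := t - cumHazInv f (cumHaz f t - a)

lemma sub_hazGap (f : ℝ → ℝ) (a t : ℝ) : t - hazGap f a t = cumHazInv f (cumHaz f t - a) := by
  rw [hazGap, sub_sub_cancel]

namespace RegularHazard

/-- Λ grows by exactly `a` across the gap, where λ is at least λ(t). -/
lemma haz_mul_hazGap_le (hz : RegularHazard f b β) (h : IsHeavy f) {a : ℝ} (ha : 0 < a) :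
    ∀ᶠ t in atTop, 0 ≤ hazGap f a t ∧ haz f t * hazGap f a t ≤ a := by
  filter_upwards [h.tendsto_cumHaz.eventually_gt_atTop a,
    (h.tendsto_shiftedInv a).eventually_ge_atTop b] with t h1 h2
  have h3 := h.cumHazInv_le ha.le h1
  refine ⟨sub_nonneg.2 h3, ?_⟩
  have h4 := hz.le_cumHaz_sub h h2 h3
  rw [h.cumHaz_cumHazInv (sub_pos.2 h1)] at h4
  rw [hazGap]
  linarith

lemma hazGap_le_mul (hz : RegularHazard f b β) (h : IsHeavy f) {a ε : ℝ} (ha : 0 < a)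
    (hε : 0 < ε) : ∀ᶠ t in atTop, hazGap f a t < ε * t := by
  filter_upwards [hz.haz_mul_hazGap_le h ha, hz.tendsto_mul_haz.eventually_gt_atTop (a / ε),
    eventually_ge_atTop b] with t ⟨_, h2⟩ h3 h4
  have h5 := hz.haz_pos t h4
  rw [div_lt_iff₀ hε] at h3
  refine lt_of_mul_lt_mul_left ?_ h5.le
  linarith

/-- The gap starts beyond t/2, so λ is at most C (t/2)^(β-1) on it; an increase of Λ by `a` needs
the stated length. -/
lemma exists_rpow_le_hazGap (hz : RegularHazard f b β) (h : IsHeavy f) {a : ℝ} (ha : 0 < a) :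
    ∃ c > 0, ∀ᶠ t in atTop, c * t ^ (1 - β) ≤ hazGap f a t := by
  obtain ⟨C, hC, hle⟩ := hz.haz_le_rpow h
  have hβ := hz.β_lt_one
  refine ⟨a / (C * (1 / 2) ^ (β - 1)), by positivity, ?_⟩
  filter_upwards [h.tendsto_cumHaz.eventually_gt_atTop a, eventually_gt_atTop 0,
    (h.tendsto_shiftedInv a).eventually_ge_atTop b,
    hz.hazGap_le_mul h ha one_half_pos] with t h1 ht0 h2 h3
  have h4 := h.cumHazInv_le ha.le h1
  have h5 := hz.cumHaz_sub_le h h2 h4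
  rw [h.cumHaz_cumHazInv (sub_pos.2 h1), sub_sub_cancel] at h5
  have h6 : 1 / 2 * t ≤ cumHazInv f (cumHaz f t - a) := by rw [hazGap] at h3; linarith
  have h7 := (hle _ h2).trans (mul_le_mul_of_nonneg_left
    (Real.rpow_le_rpow_of_nonpos (by positivity) h6 (by linarith : β - 1 ≤ 0)) hC.le)
  have h8 := h5.trans (mul_le_mul_of_nonneg_right h7 (sub_nonneg.2 h4))
  rw [Real.mul_rpow (by norm_num) ht0.le] at h8
  have h9 : t ^ (β - 1) * t ^ (1 - β) = 1 := by
    rw [← Real.rpow_add ht0]; simp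
  rw [div_mul_eq_mul_div, div_le_iff₀ (by positivity), hazGap]
  calc a * t ^ (1 - β) ≤ C * ((1 / 2) ^ (β - 1) * t ^ (β - 1)) *
        (t - cumHazInv f (cumHaz f t - a)) * t ^ (1 - β) := by gcongr
    _ = C * (1 / 2) ^ (β - 1) * (t - cumHazInv f (cumHaz f t - a)) *
        (t ^ (β - 1) * t ^ (1 - β)) := by ring
    _ = _ := by rw [h9]; ring

lemma tendsto_hazGap (hz : RegularHazard f b β) (h : IsHeavy f) {a : ℝ} (ha : 0 < a) :
    Tendsto (hazGap f a) atTop atTop := by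
  obtain ⟨c, hc, hle⟩ := hz.exists_rpow_le_hazGap h ha
  exact tendsto_atTop_mono' _ hle
    ((tendsto_rpow_atTop (sub_pos.2 hz.β_lt_one)).const_mul_atTop hc)

/-- The gap is at least c t^(1-β), so a power of t is at most a power of the gap, and the tail beats
every power. -/
lemma tendsto_rpow_mul_tail_hazGap (hz : RegularHazard f b β) (h : IsHeavy f) {a p : ℝ}
    (ha : 0 < a) (hp : 0 ≤ p) : Tendsto (fun t => t ^ p * tail f (hazGap f a t)) atTop (𝓝 0) := by
  obtain ⟨c, hc, hle⟩ := hz.exists_rpow_le_hazGap h ha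
  have hβ := sub_pos.2 hz.β_lt_one
  set q := p / (1 - β) with hq
  have hq0 : 0 ≤ q := by positivity
  have h1 : Tendsto (fun t => (c ^ q)⁻¹ * (hazGap f a t ^ q * tail f (hazGap f a t)))
      atTop (𝓝 0) := by
    simpa using ((hz.tendsto_rpow_mul_tail h q).comp (hz.tendsto_hazGap h ha)).const_mul (c ^ q)⁻¹
  refine tendsto_of_tendsto_of_tendsto_of_le_of_le' tendsto_const_nhds h1 ?_ ?_
  · filter_upwards [eventually_gt_atTop 0] with t ht
    have := h.tail_pos (hazGap f a t)
    positivity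
  · filter_upwards [hle, eventually_gt_atTop 0] with t h2 ht
    have h3 := Real.rpow_le_rpow (by positivity) h2 hq0
    rw [Real.mul_rpow hc.le (by positivity), ← Real.rpow_mul ht.le, hq,
      mul_div_cancel₀ _ hβ.ne', ← hq] at h3
    have h4 := h.tail_pos (hazGap f a t)
    rw [← mul_assoc]
    refine mul_le_mul_of_nonneg_right ?_ h4.le
    rw [inv_mul_eq_div, le_div_iff₀ (by positivity)]
    linarith

/-- F(t) is the integral of λF beyond t, and λ ≤ λ(t) there. -/
lemma tail_le_haz_mul_intTail (hz : RegularHazard f b β) (h : IsHeavy f) {t : ℝ} (ht : b ≤ t) :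
    tail f t ≤ haz f t * intTail f t := by
  rw [tail, h.real_eq measurableSet_Ioi, intTail, ← integral_const_mul]
  refine setIntegral_mono_on h.integrable.integrableOn ((h.integrableOn_tail t).const_mul _)
    measurableSet_Ioi fun x hx => ?_
  rw [h.density_eq x]
  have h1 := hz.anti ht (ht.trans (Set.mem_Ioi.1 hx).le) (Set.mem_Ioi.1 hx).le
  exact mul_le_mul_of_nonneg_right h1 (h.tail_pos x).le

/-- At the shifted point F is exactly e^a F(t). G grows by at most gap · e^a F(t), and gap · F(t) ≤
gap · λ(t) G(t) ≤ a G(t). -/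
lemma reg_dom (hz : RegularHazard f b β) (h : IsHeavy f) {a : ℝ} (ha : 0 < a) :
    ∃ C, ∀ᶠ t in atTop, tail f (t - hazGap f a t) * intTail f (t - hazGap f a t) ≤
      C * (tail f t * intTail f t) := by
  refine ⟨Real.exp a * (1 + a * Real.exp a), ?_⟩
  filter_upwards [h.tendsto_cumHaz.eventually_gt_atTop a, hz.haz_mul_hazGap_le h ha,
    eventually_ge_atTop b] with t h1 ⟨h2, h3⟩ hb
  have h4 : tail f (t - hazGap f a t) = Real.exp a * tail f t := by
    rw [sub_hazGap, h.tail_cumHazInv h1]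
  have h5 := h.intTail_sub_le (show t - hazGap f a t ≤ t by linarith)
  rw [h4, sub_sub_cancel] at h5
  have hG := h.intTail_pos t
  have hF := h.tail_pos t
  have h6 : hazGap f a t * tail f t ≤ a * intTail f t :=
    calc _ ≤ hazGap f a t * (haz f t * intTail f t) := by
          gcongr; exact hz.tail_le_haz_mul_intTail h hb
      _ = haz f t * hazGap f a t * intTail f t := by ring
      _ ≤ _ := by gcongr
  have h7 : intTail f (t - hazGap f a t) ≤ (1 + a * Real.exp a) * intTail f t := by
    have := mul_le_mul_of_nonneg_right h6 (Real.exp_pos a).le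
    linarith
  rw [h4]
  calc _ ≤ Real.exp a * tail f t * ((1 + a * Real.exp a) * intTail f t) := by gcongr
    _ = _ := by ring

/-- With y = x/t the power bound gives Λ(x) + 2Λ(t - x) ≥ (y^β + 2(1 - y)^β) Λ(t), and the bracket
is at least 2 by the choice of σ. -/
lemma tail_mul_sq_le (hz : RegularHazard f b β) (h : IsHeavy f) {σ t x : ℝ}
    (hσ : ∀ x ∈ Set.Icc 0 σ, 2 - 2 * (1 - x) ^ β - x ^ β ≤ 0) (hx : b ≤ x) (hxt : b ≤ t - x)
    (hxσ : x ≤ σ * t) : tail f x * tail f (t - x) ^ 2 ≤ tail f t ^ 2 := by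
  have hb := hz.one_le
  have ht : 0 < t := by linarith
  have h1 := hz.rpow_mul_cumHaz_le h hx (show x ≤ t by linarith)
  have h2 := hz.rpow_mul_cumHaz_le h hxt (show t - x ≤ t by linarith)
  rw [sub_div, div_self ht.ne'] at h2
  have h3 := hσ (x / t) ⟨div_nonneg (by linarith) ht.le, (div_le_iff₀ ht).2 hxσ⟩
  have h4 := mul_nonneg (sub_nonneg.2 h3) (zero_le_one.trans (hz.one_le_cumHaz t (by linarith)))
  rw [h.tail_eq_exp x, h.tail_eq_exp t, h.tail_eq_exp (t - x), ← Real.exp_nat_mul,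
    ← Real.exp_nat_mul, ← Real.exp_add, Real.exp_le_exp]
  push_cast
  linarith

lemma tail_mul_tail_le (hz : RegularHazard f b β) (h : IsHeavy f) {σ t u v : ℝ} (ht : b ≤ t)
    (hu : b ≤ u * t) (hv : b ≤ (1 - v) * t) (hu1 : u ≤ 1) (hv0 : 0 ≤ v)
    (hσ : 1 + σ ≤ u ^ β + (1 - v) ^ β) :
    tail f (u * t) * tail f ((1 - v) * t) ≤ tail f t * tail f t ^ σ := by
  have hb := hz.one_le
  have ht0 : 0 < t := by linarith
  have h1 := hz.rpow_mul_cumHaz_le h hu (mul_le_of_le_one_left ht0.le hu1)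
  have h2 := hz.rpow_mul_cumHaz_le h hv (mul_le_of_le_one_left ht0.le (by linarith))
  rw [mul_div_cancel_right₀ _ ht0.ne'] at h1 h2
  have h4 := mul_le_mul_of_nonneg_right hσ (zero_le_one.trans (hz.one_le_cumHaz t ht))
  rw [h.tail_eq_exp (u * t), h.tail_eq_exp t, h.tail_eq_exp ((1 - v) * t), ← Real.exp_mul,
    ← Real.exp_add, ← Real.exp_add, Real.exp_le_exp]
  linarith

lemma eventually_regular (hz : RegularHazard f b β) (h : IsHeavy f) :
    ∃ Y ≥ b, ∀ y ≥ Y, intTail f y ≤ y * tail f y ∧ 1 ≤ y * haz f y := by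
  have h1 := hz.eventually_mul_intTail_le h (p := 1) (c := 1) (by
    filter_upwards [hz.eventually_rpow_le 1 2] with t ht
    rw [sub_self, Real.rpow_zero] at ht ⊢
    linarith)
  obtain ⟨Y, hY⟩ := eventually_atTop.1 (h1.and (hz.tendsto_mul_haz.eventually_ge_atTop 1))
  refine ⟨max b Y, le_max_left _ _, fun y hy => ?_⟩
  have := hY y ((le_max_right _ _).trans hy)
  simpa using this

end RegularHazard

namespace IsGrid

variable {σ₁ : ℝ} {k : ℕ} {a : ℕ → ℝ}

lemma mono (hg : IsGrid β σ₁ k a) {i j : ℕ} (hi : 1 ≤ i) (hij : i ≤ j) (hj : j < k) :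
    a i ≤ a j := by
  induction j, hij using Nat.le_induction with
  | base => exact le_rfl
  | succ j hij ih => exact (ih (by omega)).trans (hg.step_pos j (hi.trans hij) hj).le

lemma pos (hg : IsGrid β σ₁ k a) {j : ℕ} (hj1 : 1 ≤ j) (hj : j < k) : 0 < a j :=
  hg.first_pos.trans_le (hg.mono le_rfl hj1 hj)

lemma lt_one (hg : IsGrid β σ₁ k a) {j : ℕ} (hj1 : 1 ≤ j) (hj : j < k) : a j < 1 :=
  (hg.mono hj1 (by omega : j ≤ k - 1) (by omega)).trans_lt hg.last_lt

end IsGrid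

lemma semiexpCuts_zero (f : ℝ → ℝ) (k : ℕ) (a : ℕ → ℝ) (aReg aBig t : ℝ) :
    semiexpCuts f k a aReg aBig t 0 = hazGap f aReg t := by
  rw [semiexpCuts, if_pos rfl, hazGap]

lemma semiexpCuts_mid (f : ℝ → ℝ) {k : ℕ} (a : ℕ → ℝ) (aReg aBig t : ℝ) {j : ℕ} (hj1 : 1 ≤ j)
    (hj : j < k) : semiexpCuts f k a aReg aBig t j = a j * t := by
  rw [semiexpCuts, if_neg (by omega), if_pos hj]

lemma semiexpCuts_last (f : ℝ → ℝ) {k : ℕ} (a : ℕ → ℝ) (aReg aBig t : ℝ) (hk : k ≠ 0) :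
    semiexpCuts f k a aReg aBig t k = t - hazGap f aBig t := by
  rw [semiexpCuts, if_neg hk, if_neg (lt_irrefl _), sub_hazGap]

namespace RegularHazard

variable {σ₁ aReg aBig : ℝ} {k : ℕ} {a : ℕ → ℝ}

lemma eventually_validCuts (hz : RegularHazard f b β) (h : IsHeavy f) (hg : IsGrid β σ₁ k a)
    (hR : 0 < aReg) (hB : 0 < aBig) :
    ∀ᶠ t in atTop, ValidCuts f k (semiexpCuts f k a aReg aBig t) aBig t := by
  have hk : k ≠ 0 := by have := hg.two_le; omega
  have hk1 : 1 ≤ k - 1 := by have := hg.two_le; omega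
  have hklt : k - 1 < k := by omega
  have ha1 := hg.first_pos
  have hal := sub_pos.2 hg.last_lt
  filter_upwards [(hz.tendsto_hazGap h hR).eventually_ge_atTop b,
    (hz.tendsto_hazGap h hB).eventually_ge_atTop b, hz.hazGap_le_mul h hR one_pos,
    hz.hazGap_le_mul h hB one_pos, hz.hazGap_le_mul h hR ha1, hz.hazGap_le_mul h hB hal,
    (h.tendsto_tail.comp (hz.tendsto_hazGap h hR)).eventually_le_const
        (show (0 : ℝ) < 1 / 2 by norm_num), (tendsto_id.const_mul_atTop ha1).eventually_ge_atTop b,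
    h.tendsto_cumHaz.eventually_gt_atTop aBig, eventually_gt_atTop 0]
    with t hRb hBb hR1 hB1 hRa hBa hhalf hab hcum ht0
  have hb := hz.one_le
  simp only [Function.comp_apply, id_eq] at hhalf hab
  refine ⟨fun j hj => ?_, ?_, ?_, ?_, fun j hj => ?_, fun _ => ?_, fun _ x hx => ?_⟩
  · rcases Nat.eq_zero_or_pos j with rfl | hj0
    · rw [semiexpCuts_zero]; linarith
    · rcases hj.lt_or_eq with hjk | rfl
      · rw [semiexpCuts_mid f a aReg aBig t hj0 hjk]
        exact mul_nonneg (hg.pos hj0 hjk).le ht0.le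
      · rw [semiexpCuts_last f a aReg aBig t hk]; linarith
  · rw [semiexpCuts_zero]; linarith
  · rw [semiexpCuts_zero]; linarith
  · rw [semiexpCuts_last f a aReg aBig t hk, sub_hazGap]
    exact h.tail_cumHazInv hcum
  · obtain ⟨hj1, hjk⟩ := Finset.mem_Ico.1 hj
    rw [semiexpCuts_mid f a aReg aBig t hj1 hjk]
    rcases hj1.eq_or_lt with rfl | hj2
    · rw [semiexpCuts_zero]
      exact hz.tail_lt h hRb hRa
    · obtain ⟨i, rfl⟩ : ∃ i, j = i + 1 := ⟨j - 1, by omega⟩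
      rw [Nat.add_sub_cancel, semiexpCuts_mid f a aReg aBig t (by omega) (by omega)]
      refine hz.tail_lt h ?_ (mul_lt_mul_of_pos_right (hg.step_pos i (by omega) hjk) ht0)
      exact hab.trans (mul_le_mul_of_nonneg_right (hg.mono le_rfl (by omega) (by omega)) ht0.le)
  · rw [semiexpCuts_last f a aReg aBig t hk, sub_sub_cancel,
      semiexpCuts_mid f a aReg aBig t hk1 hklt]
    exact hz.tail_lt h hBb (by linarith)
  · rw [semiexpCuts_last f a aReg aBig t hk] at hx
    have h1 : b ≤ t - x := by linarith [hx.2]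
    rw [h.density_eq]
    exact mul_pos (hz.haz_pos _ h1) (h.tail_pos _)

end RegularHazard

end

section

/-! ### Semiexponential tails: the interpolating components -/

variable {f : ℝ → ℝ} {b β σ₁ aReg aBig δ : ℝ} {k : ℕ} {a : ℕ → ℝ}

/-- `w` is the weight of one component, `v` its density before normalisation and `p` the normaliser.
For ordinary components v = u = f(x); for the reflected one v = f(t - x). -/
lemma mul_div_le_of_component_le {w u v p d : ℝ} (hw : 0 < w) (hu : 0 ≤ u) (hv : 0 < v)
    (hp : 0 < p) (hd : w * (v / p) ≤ d) : w * (u / d) ≤ u / v * p := by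
  have hd0 : 0 < d := lt_of_lt_of_le (by positivity) hd
  rw [mul_div_assoc', div_mul_eq_mul_div, div_le_div_iff₀ hd0 hv]
  rw [mul_div_assoc', div_le_iff₀ hp] at hd
  nlinarith

/-- Only an upper bound is claimed, so no measurability of φ is required. -/
lemma lintegral_Ioc_law_le (h : IsHeavy f) {φ : ℝ → ℝ≥0∞} {c d M : ℝ} (hM : 0 ≤ M)
    (hφ : ∀ x ∈ Set.Ioc c d, ENNReal.ofReal (f x) * φ x ≤ ENNReal.ofReal M) :
    ∫⁻ x in Set.Ioc c d, φ x ∂(law f) ≤ ENNReal.ofReal (M * (d - c)) := by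
  rw [law, restrict_withDensity measurableSet_Ioc]
  refine (lintegral_withDensity_le_lintegral_mul _ h.meas.ennreal_ofReal _).trans ?_
  refine (setLIntegral_mono' measurableSet_Ioc hφ).trans ?_
  rw [setLIntegral_const, Real.volume_Ioc, ENNReal.ofReal_mul hM]

namespace RegularHazard

/-- A pointwise form of the requirement on intermediate jumps. The factor t allows for the length of
the range of integration, and the weight on the left is of order F(t)/G(t), so dividing by it turns
F(t)² into F(t)G(t). -/
lemma eventually_interp_le (hz : RegularHazard f b β) (h : IsHeavy f) (hμ : mean f < 0)
    (hδ : δ ∈ Set.Ioo (0 : ℝ) (1 / 4)) (hg : IsGrid β σ₁ k a) (hR : 0 < aReg) (hB : 0 < aBig)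
    {η : ℝ} (hη : 0 < η) :
    ∀ᶠ t in atTop, ∀ x ∈ Set.Ioc (semiexpCuts f k a aReg aBig t 0) (semiexpCuts f k a aReg aBig t k),
      δ / (k + 1) * bigWeight f δ t *
        (f x / mixDensity f k (semiexpCuts f k a aReg aBig) δ t x) * intTail f (t - x) ^ 2 * f x * t
        ≤ η * tail f t ^ 2 := by
  have hk : k ≠ 0 := by have := hg.two_le; omega
  have hk1 : 1 ≤ k - 1 := by have := hg.two_le; omega
  have hklt : k - 1 < k := by omega
  obtain ⟨σ₂, hσ₂, hgap⟩ := hg.gap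
  obtain ⟨Y, hYb, hY⟩ := hz.eventually_regular h
  have ha1 := hg.first_pos
  have hal := sub_pos.2 hg.last_lt
  have hb := hz.one_le
  set l := haz f b with hl
  have hl0 : 0 < l := hz.haz_pos b le_rfl
  -- The three limits absorb the powers of t collected below: one each for the first strip, the
  -- strips between grid points, and the reflected strip.
  have I1 : ∀ᶠ t in atTop, l * (t ^ 3 * tail f (hazGap f aReg t)) ≤ η := by
    have := (hz.tendsto_rpow_mul_tail_hazGap h hR (Nat.cast_nonneg 3)).const_mul l
    simp only [Real.rpow_natCast, mul_zero] at this
    exact this.eventually_le_const hη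
  have I2 : ∀ᶠ t in atTop, l * (t ^ 3 * (tail f t ^ σ₂) ^ 2) ≤ η := by
    have h1 := ((hz.tendsto_rpow_mul_tail h (3 / (2 * σ₂))).rpow_const (p := 2 * σ₂)
      (Or.inr (by positivity))).const_mul l
    rw [Real.zero_rpow (by positivity), mul_zero] at h1
    filter_upwards [h1.eventually_le_const hη, eventually_gt_atTop 0] with t ht ht0
    have hF := (h.tail_pos t).le
    rw [Real.mul_rpow (by positivity) hF, ← Real.rpow_mul ht0.le,
      div_mul_cancel₀ _ (by positivity), mul_comm 2 σ₂, Real.rpow_mul hF] at ht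
    exact_mod_cast ht
  have I3 : ∀ᶠ t in atTop, l ^ 2 * (t ^ 4 * tail f (hazGap f aBig t)) ≤ η := by
    have := (hz.tendsto_rpow_mul_tail_hazGap h hB (Nat.cast_nonneg 4)).const_mul (l ^ 2)
    simp only [Real.rpow_natCast, mul_zero] at this
    exact this.eventually_le_const hη
  filter_upwards [hz.eventually_validCuts h hg hR hB, I1, I2, I3,
    (hz.tendsto_hazGap h hR).eventually_ge_atTop Y, (hz.tendsto_hazGap h hB).eventually_ge_atTop Y,
    (tendsto_id.const_mul_atTop ha1).eventually_ge_atTop Y,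
    (tendsto_id.const_mul_atTop hal).eventually_ge_atTop Y, eventually_ge_atTop b]
    with t hv i1 i2 i3 hRY hBY haY halY htb x hx
  simp only [id_eq] at haY halY
  have ht0 : 0 < t := by linarith
  have hw : 0 < δ / (k + 1) * bigWeight f δ t := h.interpWeight_pos hμ hδ k t
  have hle_l : ∀ y ≥ b, f y ≤ l * tail f y := fun y hy => by
    rw [h.density_eq]
    exact mul_le_mul_of_nonneg_right (hz.anti Set.self_mem_Ici hy hy) (h.tail_pos y).le
  have hGle : ∀ y ≥ Y, y ≤ t → intTail f y ≤ t * tail f y := fun y hy hyt =>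
    (hY y hy).1.trans (mul_le_mul_of_nonneg_right hyt (h.tail_pos y).le)
  have hfx : ∀ y ≥ b, 0 < f y := fun y hy => by
    rw [h.density_eq]; exact mul_pos (hz.haz_pos y hy) (h.tail_pos y)
  have hFt := h.tail_pos t
  obtain ⟨j, hj1, hjk, hxj⟩ := IsHeavy.exists_mem_Ioc_cut hx.1 hx.2
  have hc0 := semiexpCuts_zero f k a aReg aBig t
  have hx0 : Y ≤ x := by rw [hc0] at hx; linarith [hx.1]
  have hGx := h.intTail_nonneg (t - x)
  have hfx0 := hfx x (hYb.trans hx0)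
  have hFx := h.tail_pos x
  have hfl := hle_l x (hYb.trans hx0)
  rcases hjk.lt_or_eq with hjk' | rfl
  · have hjm : j ∈ Finset.Ico 1 k := Finset.mem_Ico.2 ⟨hj1, hjk'⟩
    have e1 := mul_div_le_of_component_le hw (h.nonneg x) hfx0 (hv.real_mid_pos h hjm)
      (h.mid_le_mixDensity hμ hδ hjm hxj)
    rw [div_self hfx0.ne', one_mul] at e1
    have e2 := e1.trans (measureReal_mono Set.Ioc_subset_Ioi_self
      (by have := h.prob; exact measure_ne_top _ _))
    rw [← tail] at e2
    rw [semiexpCuts_mid f a aReg aBig t hj1 hjk'] at hxj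
    have hla : (1 - a (k - 1)) * t ≤ (1 - a j) * t :=
      mul_le_mul_of_nonneg_right (by linarith [hg.mono hj1 (show j ≤ k - 1 by omega) hklt]) ht0.le
    rcases hj1.eq_or_lt with rfl | hj2
    -- First strip, x ≤ σ₁ t: G(t - x) ≤ t F(t - x) leads to F(x)F(t - x)², and the normaliser F(c₀)
    -- supplies the smallness.
    · rw [Nat.sub_self, hc0] at e2
      have e3 : Y ≤ t - x := by linarith [hxj.2]
      have e4 := hGle (t - x) e3 (by linarith)
      have e5 := hz.tail_mul_sq_le h hg.σ₁_small (hYb.trans hx0) (hYb.trans e3)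
        (hxj.2.trans (mul_le_mul_of_nonneg_right hg.first_le ht0.le))
      have hF1 := (h.tail_pos (hazGap f aReg t)).le
      calc _ ≤ tail f (hazGap f aReg t) * (t * tail f (t - x)) ^ 2 * (l * tail f x) * t := by
            gcongr
        _ = l * (t ^ 3 * tail f (hazGap f aReg t)) * (tail f x * tail f (t - x) ^ 2) := by ring
        _ ≤ _ := by gcongr
    -- Inner strip: both F(x) and F(t - x) are replaced by values at grid points, and the gap
    -- condition yields the extra factor F(t)^(2σ₂).
    · obtain ⟨i, rfl⟩ : ∃ i, j = i + 1 := ⟨j - 1, by omega⟩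
      have hi1 : 1 ≤ i := by omega
      rw [Nat.add_sub_cancel, semiexpCuts_mid f a aReg aBig t hi1 (by omega)] at hxj e2
      have e3 : (1 - a (i + 1)) * t ≤ t - x := by linarith [hxj.2]
      have e3' : Y ≤ (1 - a (i + 1)) * t := halY.trans hla
      have e4 : intTail f (t - x) ≤ t * tail f ((1 - a (i + 1)) * t) :=
        (h.intTail_antitone e3).trans (hGle _ e3' (by linarith))
      have e5 : tail f x ≤ tail f (a i * t) := h.tail_antitone hxj.1.le
      have e6 := hz.tail_mul_tail_le h htb
        (hYb.trans (haY.trans (mul_le_mul_of_nonneg_right (hg.mono le_rfl hi1 (by omega)) ht0.le)))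
        (hYb.trans e3') (hg.lt_one hi1 (by omega)).le (hg.pos hj1 hjk').le (hgap i hi1 hjk')
      have hF1 := (h.tail_pos (a i * t)).le
      have hF2 := (h.tail_pos ((1 - a (i + 1)) * t)).le
      calc _ ≤ tail f (a i * t) * (t * tail f ((1 - a (i + 1)) * t)) ^ 2 *
            (l * tail f (a i * t)) * t := by
              have := hfl.trans (mul_le_mul_of_nonneg_left e5 hl0.le)
              gcongr
        _ = l * t ^ 3 * (tail f (a i * t) * tail f ((1 - a (i + 1)) * t)) ^ 2 := by ring
        _ ≤ l * t ^ 3 * (tail f t * tail f t ^ σ₂) ^ 2 := by gcongr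
        _ = l * (t ^ 3 * (tail f t ^ σ₂) ^ 2) * tail f t ^ 2 := by ring
        _ ≤ _ := by gcongr
  -- Last strip, t - x ≤ σ₁ t: reflection puts f(x)²/f(t - x) in place of f(x). As F ≤ t f at t - x,
  -- the quotient G(t - x)²/f(t - x) costs only one power of F(t - x), so that F(t - x)F(x)² appears
  -- and the previous inequality applies with x and t - x exchanged.
  · have hck := semiexpCuts_last f a aReg aBig t hk
    have hxB : hazGap f aBig t ≤ t - x := by rw [hck] at hxj; linarith [hxj.2]
    have e3 : Y ≤ t - x := hBY.trans hxB
    have hfy := hfx (t - x) (hYb.trans e3)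
    have e1 := mul_div_le_of_component_le hw (h.nonneg x) hfy (hv.real_interp_pos h hk)
      (h.interp_le_mixDensity hμ hδ hk hxj)
    have e2 : (law f).real (Set.Ioc (t - semiexpCuts f j a aReg aBig t j)
        (t - semiexpCuts f j a aReg aBig t (j - 1))) ≤ tail f (hazGap f aBig t) := by
      rw [hck, sub_sub_cancel]
      exact measureReal_mono Set.Ioc_subset_Ioi_self
        (by have := h.prob; exact measure_ne_top _ _)
    have e2' := e1.trans (mul_le_mul_of_nonneg_left e2 (by positivity))
    have hxle : t - x ≤ σ₁ * t := by
      rw [semiexpCuts_mid f a aReg aBig t hk1 hklt] at hxj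
      have := mul_le_mul_of_nonneg_right hg.last_ge ht0.le
      linarith [hxj.1]
    have e4 := hGle (t - x) e3 (by linarith)
    have e5 := hz.tail_mul_sq_le h hg.σ₁_small (hYb.trans e3)
      (by rw [sub_sub_cancel]; exact hYb.trans hx0) hxle
    rw [sub_sub_cancel] at e5
    have hFy := h.tail_pos (t - x)
    have hF1 := (h.tail_pos (hazGap f aBig t)).le
    have e6 : tail f (t - x) ≤ t * f (t - x) := by
      have h1 := mul_le_mul_of_nonneg_right (hY (t - x) e3).2 hFy.le
      rw [one_mul, mul_assoc, ← h.density_eq] at h1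
      exact h1.trans (mul_le_mul_of_nonneg_right (by linarith) hfy.le)
    have e7 : intTail f (t - x) ^ 2 / f (t - x) ≤ t ^ 3 * tail f (t - x) := by
      rw [div_le_iff₀ hfy]
      calc _ ≤ (t * tail f (t - x)) ^ 2 := by gcongr
        _ = t ^ 2 * tail f (t - x) * tail f (t - x) := by ring
        _ ≤ t ^ 2 * tail f (t - x) * (t * f (t - x)) := by gcongr
        _ = _ := by ring
    calc _ ≤ f x / f (t - x) * tail f (hazGap f aBig t) * intTail f (t - x) ^ 2 * f x * t := by
          gcongr
      _ = tail f (hazGap f aBig t) * f x ^ 2 * t * (intTail f (t - x) ^ 2 / f (t - x)) := by ring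
      _ ≤ tail f (hazGap f aBig t) * (l * tail f x) ^ 2 * t * (t ^ 3 * tail f (t - x)) := by gcongr
      _ = l ^ 2 * (t ^ 4 * tail f (hazGap f aBig t)) * (tail f (t - x) * tail f x ^ 2) := by ring
      _ ≤ _ := by gcongr

lemma goodCuts_semiexpCuts (hz : RegularHazard f b β) (h : IsHeavy f) (hμ : mean f < 0)
    (hδ : δ ∈ Set.Ioo (0 : ℝ) (1 / 4)) (hg : IsGrid β σ₁ k a) (hR : 0 < aReg) (hB : 0 < aBig) :
    GoodCuts f k (semiexpCuts f k a aReg aBig) aBig δ where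
  meas j := by
    unfold semiexpCuts
    split_ifs
    · exact measurable_id.sub (h.measurable_shiftedInv aReg)
    · fun_prop
    · exact h.measurable_shiftedInv aBig
  longTailed := hz.longTailed h
  valid := hz.eventually_validCuts h hg hR hB
  reg_tendsto := by
    simp only [semiexpCuts_zero]
    exact hz.tendsto_hazGap h hR
  reg_dom := by
    simp only [semiexpCuts_zero]
    exact hz.reg_dom h hR
  mid η hη := by
    have hk : k ≠ 0 := by have := hg.two_le; omega
    have hθ := IsHeavy.thetaConst_pos hμ hδ
    have hδ0 := hδ.1
    set ζ := δ / (k + 1) * (2 * thetaConst f δ) with hζ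
    have hζ0 : 0 < ζ := by positivity
    have hr := h.tendsto_ratio (hz.longTailed h)
    have e1 := (hr.const_mul (2 * thetaConst f δ)).eventually_le_const
      (show 2 * thetaConst f δ * 0 < δ ^ 2 by rw [mul_zero]; positivity)
    filter_upwards [hz.eventually_interp_le h hμ hδ hg hR hB (mul_pos hζ0 hη), e1,
      eventually_gt_atTop 0, (hz.tendsto_hazGap h hR).eventually_ge_atTop 0,
      (hz.tendsto_hazGap h hB).eventually_ge_atTop 0] with t h1 h2 ht0 hR0 hB0
    have hF := h.tail_pos t
    have hG := h.intTail_pos t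
    have hw : δ / (k + 1) * bigWeight f δ t = ζ * tail f t / intTail f t := by
      rw [bigWeight, min_eq_left (by rw [mul_div_assoc]; exact h2), hζ]; ring
    set M := η * (tail f t * intTail f t) / t with hM
    have hM0 : 0 ≤ M := by positivity
    refine (lintegral_Ioc_law_le h (M := M) hM0 fun x hx => ?_).trans
      (ENNReal.ofReal_le_ofReal ?_)
    · have h3 := h1 x hx
      have h4 := h.mixDensity_nonneg hμ hδ (k := k) (c := semiexpCuts f k a aReg aBig) t x
      have h5 := h.nonneg x
      rw [← ENNReal.ofReal_mul (by positivity), ← ENNReal.ofReal_mul h5]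
      refine ENNReal.ofReal_le_ofReal ?_
      rw [hM, le_div_iff₀ ht0]
      rw [hw] at h3
      refine le_of_mul_le_mul_left ?_ (show 0 < ζ * tail f t / intTail f t by positivity)
      calc _ = ζ * tail f t / intTail f t *
            (f x / mixDensity f k (semiexpCuts f k a aReg aBig) δ t x) *
            intTail f (t - x) ^ 2 * f x * t := by ring
        _ ≤ _ := h3
        _ = _ := by field_simp
    · rw [semiexpCuts_zero, semiexpCuts_last f a aReg aBig t hk]
      calc M * (t - hazGap f aBig t - hazGap f aReg t) ≤ M * t := by
            gcongr; linarith
        _ = _ := by rw [hM]; field_simp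

end RegularHazard

end

section

/-! ### Semiexponential tails: the scheme -/

lemma mul_rpow_le_rpow {β u c : ℝ} (hβ : β ≤ 1) (hu : 0 < u) (huc : u ≤ c) :
    u * c ^ (β - 1) ≤ u ^ β := by
  have h1 := Real.rpow_le_rpow_of_nonpos hu huc (sub_nonpos.2 hβ)
  calc u * c ^ (β - 1) ≤ u * u ^ (β - 1) := by gcongr
    _ = u ^ β := by rw [mul_comm, ← Real.rpow_add_one hu.ne', sub_add_cancel]

/-- An equally spaced grid j/k with k large. The gap condition asks that u^β + v^β exceed 1 by the
spacing s when u + v = 1 - s, a quantitative form of concavity. -/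
lemma exists_isGrid {β : ℝ} (hβ0 : 0 < β) (hβ1 : β < 1) : ∃ σ₁ k a, IsGrid β σ₁ k a := by
  -- Chosen so that ε^(β-1) = 3, hence x^β ≥ 3x on [0, ε]. Similarly x^β ≥ qx on (0, 1/2] with q >
  -- 1.
  set ε : ℝ := (1 / 3) ^ (1 / (1 - β)) with hε
  set q : ℝ := (1 / 2) ^ (β - 1) with hq
  have hβ := sub_pos.2 hβ1
  have hε0 : 0 < ε := by positivity
  have hε1 : ε < 1 := Real.rpow_lt_one (by norm_num) (by norm_num) (by positivity)
  have hε3 : ε ^ (β - 1) = 3 := by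
    rw [hε, ← Real.rpow_mul (by norm_num), show 1 / (1 - β) * (β - 1) = -1 by field_simp; ring,
      Real.rpow_neg_one]
    norm_num
  have hq1 : 1 < q := Real.one_lt_rpow_of_pos_of_lt_one_of_neg (by norm_num) (by norm_num)
    (by linarith)
  have hq2 : q ≤ 2 := by
    have h1 : q ≤ (1 / 2 : ℝ) ^ (-1 : ℝ) :=
      Real.rpow_le_rpow_of_exponent_ge (by norm_num) (by norm_num) (by linarith)
    rw [Real.rpow_neg_one] at h1
    linarith
  have hgapε : ∀ s u v : ℝ, 0 < s → 2 * s ≤ ε * (q - 1) → s ≤ u → u ≤ v → u + v = 1 - s →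
      1 + s ≤ u ^ β + v ^ β := by
    intro s u v hs hsε hsu huv huv1
    have hu0 : 0 < u := by linarith
    have h1 := mul_rpow_le_rpow hβ1.le (hu0.trans_le huv) (show v ≤ 1 by linarith)
    rw [Real.one_rpow, mul_one] at h1
    -- The larger summand satisfies v^β ≥ v. For u ≤ ε the smaller one gains 2u ≥ 2s over u;
    -- otherwise it gains (q - 1)u ≥ (q - 1)ε ≥ 2s. Both make up for u + v = 1 - s.
    rcases le_total u ε with hue | hue
    · have h2 := mul_rpow_le_rpow hβ1.le hu0 hue
      rw [hε3] at h2
      linarith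
    · have h2 := mul_rpow_le_rpow hβ1.le hu0 (show u ≤ 1 / 2 by linarith)
      have h3 := mul_le_mul_of_nonneg_right hue (sub_nonneg.2 hq1.le)
      linarith
  obtain ⟨k, hk⟩ := exists_nat_gt (2 / (ε * (q - 1)))
  have hk0 : (0 : ℝ) < k := lt_of_le_of_lt (by have := sub_pos.2 hq1; positivity) hk
  set s : ℝ := 1 / k with hs
  have hs0 : 0 < s := by positivity
  have hks : k * s = 1 := by rw [hs]; field_simp
  have hsε : 2 * s ≤ ε * (q - 1) := by
    rw [div_lt_iff₀ (mul_pos hε0 (sub_pos.2 hq1))] at hk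
    rw [hs, mul_one_div, div_le_iff₀ hk0]
    linarith
  have hsε' : 2 * s ≤ ε := hsε.trans (mul_le_of_le_one_right hε0.le (by linarith))
  have hk2 : 2 ≤ k := by
    by_contra! hlt
    have h1 : (k : ℝ) ≤ 1 := by exact_mod_cast Nat.lt_succ_iff.1 hlt
    nlinarith
  have hcast : ((k - 1 : ℕ) : ℝ) = k - 1 := by rw [Nat.cast_sub (by omega), Nat.cast_one]
  refine ⟨2 * s, k, fun j => j * s, ?_⟩
  refine ⟨by positivity, fun x hx => ?_, hk2, ?_, ?_, fun j _ _ => ?_, fun j _ _ => ?_, ?_, ?_,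
    s, hs0, fun j hj1 hjk => ?_⟩
  · rcases hx.1.eq_or_lt with rfl | hx0
    · rw [Real.zero_rpow hβ0.ne']; norm_num
    · have h1 := mul_rpow_le_rpow hβ1.le hx0 (hx.2.trans hsε')
      rw [hε3] at h1
      have h2 := mul_rpow_le_rpow hβ1.le (u := 1 - x) (by linarith [hx.2])
        (show 1 - x ≤ 1 by linarith)
      rw [Real.one_rpow, mul_one] at h2
      linarith
  · simpa using hs0
  · simp only [Nat.cast_one]; linarith
  · push_cast; linarith
  · push_cast; linarith
  · simp only [hcast]; linarith
  · simp only [hcast]; linarith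
  · have h1 : (1 : ℝ) ≤ j := by exact_mod_cast hj1
    have h2 : (j : ℝ) + 2 ≤ k := by exact_mod_cast hjk
    have h3 : s ≤ j * s := le_mul_of_one_le_left hs0.le h1
    have h4 := mul_le_mul_of_nonneg_right h2 hs0.le
    push_cast
    rcases le_total (j * s) (1 - (j + 1) * s) with h5 | h5
    · exact hgapε s _ _ hs0 hsε h3 h5 (by ring)
    · rw [add_comm ((j * s) ^ β)]
      exact hgapε s _ _ hs0 hsε (by linarith) h5 (by ring)

namespace IsHeavy

variable {f : ℝ → ℝ} {b β : ℝ}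

/-- The factor 2 in the weight is used to split t^γ F/G into two equal copies. One is at least d/2,
by the lower bound on the hazard, and gives the constant drift; the other is at least N t^(γ-1),
because tF/G → ∞, and pays for the upward drift of the regular jumps. -/
lemma eventually_drift (h : IsHeavy f) (hz : RegularHazard f b β) (hμ : mean f < 0) {δ a β' d : ℝ}
    (hδ : δ ∈ Set.Ioo (0 : ℝ) (1 / 4)) (hβ'0 : 0 ≤ β')
    (hd : ∀ᶠ x in atTop, d * x ^ (β' - 1) ≤ haz f x) :
    ∀ᶠ t in atTop, (1 - β') * t ^ (1 - β' - 1) * (-mean f + 1) +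
      thetaConst f δ * Real.exp (-a) * (d / 2) ≤
      2 * thetaConst f δ * (tail f t / intTail f t) * Real.exp (-a) * t ^ (1 - β') := by
  set γ := 1 - β' with hγ
  set w := thetaConst f δ * Real.exp (-a) with hw
  have hw0 : 0 < w := mul_pos (thetaConst_pos hμ hδ) (Real.exp_pos _)
  have e1 := hz.eventually_mul_intTail_le h (p := γ) (c := d / 2) (by
    filter_upwards [hz.eventually_rpow_le γ 2, hd, eventually_gt_atTop 0] with t h1 h2 ht0
    have h3 : t ^ γ * t ^ (β' - 1) = 1 := by
      rw [← Real.rpow_add ht0, hγ]; simp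
    have h4 := mul_le_mul_of_nonneg_left h2 (Real.rpow_pos_of_pos ht0 γ).le
    have h5 : t ^ γ * (d * t ^ (β' - 1)) = d := by rw [mul_left_comm, h3, mul_one]
    have h6 : γ * t ^ (γ - 1) ≤ 1 * t ^ (γ - 1) := by gcongr; linarith
    linarith)
  set N := (-mean f + 1) / w with hN
  have e2 := hz.eventually_mul_intTail_le h (p := 1) (c := N) (by
    filter_upwards [hz.eventually_rpow_le 1 (1 + N)] with t ht
    rw [sub_self, Real.rpow_zero] at ht ⊢
    linarith)
  filter_upwards [e1, e2, eventually_gt_atTop 0] with t h1 h2 ht0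
  have hG := h.intTail_pos t
  have hp := Real.rpow_pos_of_pos ht0 (γ - 1)
  rw [← le_div_iff₀ hG] at h1 h2
  rw [Real.rpow_one] at h2
  have h3 : t ^ (γ - 1) * N ≤ t ^ γ * tail f t / intTail f t := by
    refine (mul_le_mul_of_nonneg_left h2 hp.le).trans_eq ?_
    rw [← mul_div_assoc, ← mul_assoc, ← Real.rpow_add_one ht0.ne', sub_add_cancel]
  have h4 : w * N = -mean f + 1 := by rw [hN]; field_simp
  have h5 : γ * t ^ (γ - 1) * (-mean f + 1) ≤ 1 * t ^ (γ - 1) * (-mean f + 1) := by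
    have : 0 ≤ -mean f + 1 := by linarith
    gcongr; linarith
  have h6 := mul_le_mul_of_nonneg_left (add_le_add h1 h3) hw0.le
  calc _ ≤ t ^ (γ - 1) * (w * N) + w * (d / 2) := by rw [h4]; linarith
    _ = w * (d / 2 + t ^ (γ - 1) * N) := by ring
    _ ≤ _ := h6
    _ = _ := by rw [hw]; ring

/-- The scheme with interpolating components for semiexponential tails. -/
theorem semiexp_scheme (h : IsHeavy f) (hμ : mean f < 0) {b₀ : ℝ} (hS : SemiexpTail f b₀ β)
    {Ω : Type*} [MeasurableSpace Ω] {P : Measure Ω} [IsProbabilityMeasure P] {X : ℕ → Ω → ℝ}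
    (hX : ∀ n, Measurable (X n)) (hindep : iIndepFun X P) (hlaw : ∀ n, P.map (X n) = law f)
    (hint : Integrable (X 0) P) (hmean : ∫ ω, X 0 ω ∂P < 0) {σ₁ : ℝ} {k : ℕ} {a : ℕ → ℝ}
    (hg : IsGrid β σ₁ k a) {aReg aBig δ₀ : ℝ} (hR : 0 < aReg) (hB : 0 < aBig)
    (hδ : δ₀ ∈ Set.Ioo (0 : ℝ) (1 / 4)) :
    ∃ κ₀ > 0, ∀ κ ≥ κ₀,
      StronglyEfficient P X f (sampler f k (semiexpCuts f k a aReg aBig) δ₀ κ) ∧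
      ∀ β' ∈ Set.Icc 0 β, ∀ d > 0, (∀ᶠ x in atTop, d * x ^ (β' - 1) ≤ haz f x) →
        ∃ ρ₀ > 0, ∃ ρ₁ > 0, ∀ b > 0,
          expTermination (sampler f k (semiexpCuts f k a aReg aBig) δ₀ κ) b ≤
            ENNReal.ofReal (ρ₀ + ρ₁ * b ^ (1 - β')) := by
  obtain ⟨b, hz⟩ := h.exists_regularHazard hS
  have hgood := hz.goodCuts_semiexpCuts h hμ hδ hg hR hB
  obtain ⟨κ₀, hκ₀, hκ⟩ := h.exists_stronglyEfficient hμ hδ hgood hX hindep hlaw hint hmean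
  refine ⟨κ₀, hκ₀, fun κ hκκ => ⟨(hκ κ hκκ).1, fun β' hβ' d hd hev => ?_⟩⟩
  obtain ⟨t₀, ht₀, hv⟩ := (hκ κ hκκ).2
  have hβ1 := hz.β_lt_one
  have hθ := thetaConst_pos hμ hδ
  exact h.exists_termination hμ hδ hB.le hgood ht₀ hv (by linarith [hβ'.2]) (by linarith [hβ'.1])
    one_pos (by positivity) (h.eventually_drift hz hμ hδ hβ'.1 hev)

end IsHeavy

/-! ### The increment distribution -/

section Increments

variable {Ω : Type*} [MeasurableSpace Ω] {P : Measure Ω} {X : ℕ → Ω → ℝ} {f : ℝ → ℝ}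

lemma integrable_id_law (hX : ∀ n, Measurable (X n)) (hlaw : ∀ n, P.map (X n) = law f)
    (hint : Integrable (X 0) P) : Integrable (fun x : ℝ => x) (law f) := by
  rw [← hlaw 0]
  exact (integrable_map_measure aestronglyMeasurable_id (hX 0).aemeasurable).2 hint

lemma mean_eq_integral (hX : ∀ n, Measurable (X n)) (hlaw : ∀ n, P.map (X n) = law f) :
    mean f = ∫ ω, X 0 ω ∂P := by
  rw [mean, ← hlaw 0]
  exact integral_map (hX 0).aemeasurable aestronglyMeasurable_id

end Increments

end

end RWImportance

end

theorem mainTheorem2 {Ω : Type*} [MeasurableSpace Ω] (P : Measure Ω) [IsProbabilityMeasure P]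
    (X : ℕ → Ω → ℝ) (f : ℝ → ℝ)
    (hX : ∀ n, Measurable (X n)) (hindep : iIndepFun X P)
    (hf : Measurable f) (hf0 : ∀ x, 0 ≤ f x)
    (hlaw : ∀ n, P.map (X n) = RWImportance.law f)
    (hint : Integrable (X 0) P) (hmean : ∫ ω, X 0 ω ∂P < 0) :
    (∀ ι : ℝ, 3 / 2 < ι → RWImportance.RegVaryingTail f ι →
      ∃ ε > 0, ∀ aBig ∈ Set.Ioo (0 : ℝ) ε, ∀ δ₀ ∈ Set.Ioo (0 : ℝ) (min ε (1 / 4)),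
        ∃ κ₀ > 0, ∀ κ ≥ κ₀,
          RWImportance.StronglyEfficient P X f
            (RWImportance.sampler f 0 (RWImportance.regCuts f aBig) δ₀ κ) ∧
          ∃ ρ₀ > 0, ∃ ρ₁ > 0, ∀ b > 0,
            RWImportance.expTermination
              (RWImportance.sampler f 0 (RWImportance.regCuts f aBig) δ₀ κ) b ≤
                ENNReal.ofReal (ρ₀ + ρ₁ * b)) ∧
    (∀ b₀ β₀ : ℝ, RWImportance.SemiexpTail f b₀ β₀ →
      (∃ σ₁ k a, RWImportance.IsGrid β₀ σ₁ k a) ∧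
      ∀ σ₁ k a, RWImportance.IsGrid β₀ σ₁ k a →
        ∀ aReg > 0, ∀ aBig > 0, ∀ δ₀ ∈ Set.Ioo (0 : ℝ) (1 / 4),
          ∃ κ₀ > 0, ∀ κ ≥ κ₀,
            RWImportance.StronglyEfficient P X f
              (RWImportance.sampler f k (RWImportance.semiexpCuts f k a aReg aBig) δ₀ κ) ∧
            ∀ β ∈ Set.Icc 0 β₀, ∀ δ > 0,
              (∀ᶠ x in atTop, δ * x ^ (β - 1) ≤ RWImportance.haz f x) →
              ∃ ρ₀ > 0, ∃ ρ₁ > 0, ∀ b > 0,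
                RWImportance.expTermination
                  (RWImportance.sampler f k
                    (RWImportance.semiexpCuts f k a aReg aBig) δ₀ κ) b ≤
                  ENNReal.ofReal (ρ₀ + ρ₁ * b ^ (1 - β))) := by
  have hp := RWImportance.isProbabilityMeasure_law hX hlaw
  have hi := RWImportance.integrable_id_law hX hlaw hint
  have hμ : RWImportance.mean f < 0 := by rwa [RWImportance.mean_eq_integral hX hlaw]
  refine ⟨fun ι hι hR => ?_, fun b₀ β₀ hS => ⟨RWImportance.exists_isGrid hS.β₀_pos hS.β₀_lt_one,
    fun σ₁ k a hg aReg hReg aBig hBig δ₀ hδ => ?_⟩⟩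
  · exact RWImportance.IsHeavy.regVarying_scheme ⟨hf, hf0, hp, hi, hR.tail_pos hp⟩ hμ hι hR hX
      hindep hlaw hint hmean
  · exact RWImportance.IsHeavy.semiexp_scheme ⟨hf, hf0, hp, hi, hS.tail_pos hp⟩ hμ hS hX
      hindep hlaw hint hmean hg hReg hBig hδ
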